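/- Let $n$ be a dimension and let $d\gamma(x)=\pi^{-n/2}e^{-|x|^2}dx$ on $\mathbb{R}^n$. Let $\{h_\beta\}_{\beta\in\mathbb{N}_0^n}$ be the Hermite polynomials normalized in $L^2(\gamma)$, and $\mathcal{P}_jf=\sum_{|\beta|=j}\langle f,h_\beta\rangle h_\beta$, so that the Ornstein–Uhlenbeck operator (the closure on $L^2(\gamma)$ of $-\tfrac12\Delta+x\cdot\nabla$ on $C_c^\infty(\mathbb{R}^n)$) is $\mathcal{L}=\sum_{j\ge0}j\,\mathcal{P}_j$. For a multi-index $\alpha\in\mathbb{N}_0^n$ the new Gaussian Riesz transform on $L^2(\gamma)$ is $$R^*_\alpha=D^{*\alpha}(\mathcal{L}+I)^{-|\alpha|/2},\qquad (\mathcal{L}+I)^{-|\alpha|/2}=\sum_{j\ge0}(j+1)^{-|\alpha|/2}\mathcal{P}_j,\qquad D^{*\alpha}=\delta_1^{*\alpha_1}\cdots\delta_n^{*\alpha_n},$$ where $\delta_i^*v=-\tfrac1{\sqrt2}e^{|x|^2}\partial_i(e^{-|x|^2}v)$ is the formal adjoint in $L^2(\gamma)$ of $\delta_i=\tfrac1{\sqrt2}\partial_i$,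 with derivatives in the weak sense. A ball $B=B(c_B,r_B)$ is admissible if $0<r_B\le m(|c_B|)$, where $m(s)=1$ for $0\le s\le1$ and $m(s)=1/s$ for $s>1$. For $1<r\le\infty$, a Gaussian $(1,r)$-atom is either the constant function $1$ or a function $a\in L^r(\gamma)$ supported in an admissible ball $B$ with $\int a\,d\gamma=0$ and $\|a\|_{L^r(\gamma)}\le\gamma(B)^{1/r-1}$. The Hardy space $\mathcal{H}^{1,r}(\gamma)$ is the space of all $f\in L^1(\gamma)$ of the form $f=\sum_{j}\lambda_ja_j$ with $(1,r)$-atoms $a_j$ and complex $\lambda_j$, $\sum_j|\lambda_j|<\infty$; its norm $\|f\|_{\mathcal{H}^{1,r}(\gamma)}$ is the infimum of $\sum_j|\lambda_j|$ over all such representations. (These spaces coincide for all $1<r\le\infty$, with equivalent norms, and any one of them is called $\mathcal{H}^1(\gamma)$.) **Theorem.** For every dimension $n$ and every multi-index $\alpha\in\mathbb{N}_0^n$, $R^*_\alpha$ is a well-defined operator on $L^2(\gamma)$, and for every $1<r\le\infty$ it is bounded from $\mathcal{H}^{1,r}(\gamma)$ to $L^1(\gamma)$: there is exactly one linear operator $T:\mathcal{H}^{1,r}(\gamma)\to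 L^1(\gamma)$ that agrees with $R^*_\alpha$ on $L^2(\gamma)\cap\mathcal{H}^{1,r}(\gamma)$ and satisfies $\|Tf\|_{L^1(\gamma)}\le C\,\|f\|_{\mathcal{H}^{1,r}(\gamma)}$ for all $f\in\mathcal{H}^{1,r}(\gamma)$, with a constant $C$ that does not depend on $f$. -/

import Mathlib

open MeasureTheory
open scoped ENNReal ContDiff

namespace GaussianHardy

noncomputable section

/-- The Gaussian measure `dγ(x) = π^{-n/2} exp(-|x|²) dx` on `ℝⁿ`. -/
def gaussMeasure (n : ℕ) : Measure (EuclideanSpace ℝ (Fin n)) :=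
  volume.withDensity fun x =>
    ENNReal.ofReal (Real.pi ^ (-(n : ℝ) / 2) * Real.exp (-‖x‖ ^ 2))

/-- The normalized Hermite polynomial `h_β = H_β / √(2^{|β|} β!)`. Here `Polynomial.hermite` is the
probabilists' polynomial `He_k`, and `H_k(t) = 2^{k/2} He_k(√2 t)`. -/
def hermiteFn {n : ℕ} (β : Fin n → ℕ) (x : EuclideanSpace ℝ (Fin n)) : ℝ :=
  ∏ i, Polynomial.aeval (√2 * x i) (Polynomial.hermite (β i)) / √((β i).factorial : ℝ)

theorem integrable_polynomial_mul_exp (p : Polynomial ℝ) :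
    Integrable fun t : ℝ => p.eval t * Real.exp (-t ^ 2) := by
  induction p using Polynomial.induction_on' with
  | add p q hp hq =>
    refine (hp.add hq).congr (Filter.Eventually.of_forall fun t => ?_)
    simp [add_mul]
  | monomial k a =>
    have h := integrable_rpow_mul_exp_neg_mul_sq (b := 1) one_pos (s := (k : ℝ))
      (by have : (0 : ℝ) ≤ k := k.cast_nonneg
          linarith)
    simpa [Polynomial.eval_monomial, mul_assoc] using h.const_mul a

theorem memLp_hermiteFn {n : ℕ} (β : Fin n → ℕ) :
    MemLp (fun x => (hermiteFn β x : ℂ)) 2 (gaussMeasure n) := by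
  have hc : Continuous fun x : EuclideanSpace ℝ (Fin n) => hermiteFn β x := by
    unfold hermiteFn
    fun_prop
  rw [memLp_two_iff_integrable_sq_norm (by fun_prop)]
  unfold gaussMeasure
  rw [integrable_withDensity_iff_integrable_smul' (by fun_prop) (by simp)]
  let q : Fin n → Polynomial ℝ := fun i =>
    (Polynomial.C (√((β i).factorial : ℝ))⁻¹ *
      (((Polynomial.hermite (β i)).map (algebraMap ℤ ℝ)).comp
        (Polynomial.C √2 * Polynomial.X))) ^ 2
  have h1 : Integrable fun y : Fin n → ℝ => ∏ i, ((q i).eval (y i) * Real.exp (-(y i) ^ 2)) :=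
    Integrable.fintype_prod fun i => integrable_polynomial_mul_exp (q i)
  have h2 := ((EuclideanSpace.volume_preserving_symm_measurableEquiv_toLp
    (Fin n)).integrable_comp_emb (MeasurableEquiv.measurableEmbedding _)).2 h1
  refine (h2.const_mul (Real.pi ^ (-(n : ℝ) / 2))).congr (Filter.Eventually.of_forall fun x => ?_)
  have hpos : 0 ≤ Real.pi ^ (-(n : ℝ) / 2) * Real.exp (-‖x‖ ^ 2) := by positivity
  have he : Real.exp (-‖x‖ ^ 2) = ∏ i, Real.exp (-(x i) ^ 2) := by
    rw [← Real.exp_sum, EuclideanSpace.real_norm_sq_eq, Finset.sum_neg_distrib]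
  simp only [Function.comp, ENNReal.toReal_ofReal hpos, smul_eq_mul, Complex.norm_real,
    Real.norm_eq_abs, sq_abs]
  rw [Finset.prod_mul_distrib, he]
  have hq : (hermiteFn β x) ^ 2 = ∏ i, (q i).eval (x i) := by
    unfold hermiteFn
    rw [← Finset.prod_pow]
    refine Finset.prod_congr rfl fun i _ => ?_
    simp [q, Polynomial.aeval_def, Polynomial.eval₂_eq_eval_map, div_eq_inv_mul]
  rw [hq]
  have hx : (MeasurableEquiv.toLp 2 (Fin n → ℝ)).symm x = x.ofLp := rfl
  rw [hx]
  ring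

/-- `h_β` as an element of the complex Hilbert space `L²(γ)`. -/
def hermiteL2 {n : ℕ} (β : Fin n → ℕ) : Lp ℂ 2 (gaussMeasure n) :=
  (memLp_hermiteFn β).toLp _

/-- The projection `P_j f = ∑_{|β| = j} ⟨f, h_β⟩ h_β` onto the Wiener chaos of order `j`. -/
def chaosProj {n : ℕ} (j : ℕ) (f : Lp ℂ 2 (gaussMeasure n)) : Lp ℂ 2 (gaussMeasure n) :=
  ∑ β ∈ Finset.piAntidiag (Finset.univ : Finset (Fin n)) j,
    (inner ℂ (hermiteL2 β) f : ℂ) • hermiteL2 β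

/-- `u = (𝓛 + I)^{-s} f`, where `𝓛` is the Ornstein-Uhlenbeck operator, whose spectral
decomposition is `𝓛 = ∑_j j P_j`: the series `∑_j (j + 1)^{-s} P_j f` converges to `u` in `L²(γ)`. -/
def IsResolventPower {n : ℕ} (s : ℝ) (f u : Lp ℂ 2 (gaussMeasure n)) : Prop :=
  HasSum (fun j : ℕ => ((((j : ℝ) + 1) ^ (-s) : ℝ) : ℂ) • chaosProj j f) u

/-- `δ_i = 2^{-1/2} ∂/∂x_i`. -/
def delta {n : ℕ} (i : Fin n) (φ : EuclideanSpace ℝ (Fin n) → ℝ) :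
    EuclideanSpace ℝ (Fin n) → ℝ :=
  fun x => (√2)⁻¹ * fderiv ℝ φ x (EuclideanSpace.single i 1)

/-- `D^α φ = δ_1^{α_1} ⋯ δ_n^{α_n} φ`. -/
def deltaPow {n : ℕ} (α : Fin n → ℕ) (φ : EuclideanSpace ℝ (Fin n) → ℝ) :
    EuclideanSpace ℝ (Fin n) → ℝ :=
  (List.finRange n).foldr (fun i ψ => (delta i)^[α i] ψ) φ

/-- `g = D^{*α} u`, with `D^{*α} = δ_1^{*α_1} ⋯ δ_n^{*α_n}` and
`δ_i^* v = -2^{-1/2} exp(|x|²) ∂_i (exp(-|x|²) v)` the formal adjoint of `δ_i` in `L²(γ)`; the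
derivatives are taken in the weak sense. -/
def IsWeakDeltaStar {n : ℕ} (α : Fin n → ℕ) (u g : Lp ℂ 2 (gaussMeasure n)) : Prop :=
  ∀ φ : EuclideanSpace ℝ (Fin n) → ℝ, ContDiff ℝ ∞ φ → HasCompactSupport φ →
    ∫ x, g x * (φ x : ℂ) ∂(gaussMeasure n) = ∫ x, u x * (deltaPow α φ x : ℂ) ∂(gaussMeasure n)

/-- `g = R*_α f`, where `R*_α = D^{*α} (𝓛 + I)^{-|α|/2}` is the new Gaussian Riesz transform
on `L²(γ)`. -/
def IsNewRiesz {n : ℕ} (α : Fin n → ℕ) (f g : Lp ℂ 2 (gaussMeasure n)) : Prop :=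
  ∃ u : Lp ℂ 2 (gaussMeasure n),
    IsResolventPower (((∑ i, α i : ℕ) : ℝ) / 2) f u ∧ IsWeakDeltaStar α u g

/-- The function `m(s) = 1` for `0 ≤ s ≤ 1` and `m(s) = 1/s` for `s > 1`. -/
def admissibleRadius (s : ℝ) : ℝ := if s ≤ 1 then 1 else 1 / s

/-- Gaussian `(1,r)`-atoms, `1 < r ≤ ∞`: the constant function `1`, and the functions
`a ∈ L^r(γ)` supported in an admissible ball `B`, with `∫ a dγ = 0` and
`‖a‖_r ≤ γ(B)^{1/r - 1}`. -/
def IsAtom {n : ℕ} (r : ℝ≥0∞) (a : EuclideanSpace ℝ (Fin n) → ℂ) : Prop :=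
  (∀ᵐ x ∂(gaussMeasure n), a x = 1) ∨
  ∃ (c : EuclideanSpace ℝ (Fin n)) (ρ : ℝ), 0 < ρ ∧ ρ ≤ admissibleRadius ‖c‖ ∧
    MemLp a r (gaussMeasure n) ∧
    (∀ᵐ x ∂(gaussMeasure n), x ∉ Metric.ball c ρ → a x = 0) ∧
    ∫ x, a x ∂(gaussMeasure n) = 0 ∧
    eLpNorm a r (gaussMeasure n) ≤ gaussMeasure n (Metric.ball c ρ) ^ ((1 / r).toReal - 1)

/-- `f = ∑_j λ_j a_j` in `L¹(γ)` with `(1,r)`-atoms `a_j` and `∑_j |λ_j| < ∞`. -/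
def IsAtomicDecomposition {n : ℕ} (r : ℝ≥0∞) (f : Lp ℂ 1 (gaussMeasure n))
    (l : ℕ → ℂ) (a : ℕ → Lp ℂ 1 (gaussMeasure n)) : Prop :=
  (∀ j, IsAtom r (a j)) ∧ Summable (fun j => ‖l j‖) ∧ HasSum (fun j => l j • a j) f

theorem exists_interleave {E : Type*} [NormedAddCommGroup E] [Module ℂ E] {P : E → Prop} {f g : E}
    {l l' : ℕ → ℂ} {a a' : ℕ → E}
    (hf : (∀ j, P (a j)) ∧ Summable (fun j => ‖l j‖) ∧ HasSum (fun j => l j • a j) f)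
    (hg : (∀ j, P (a' j)) ∧ Summable (fun j => ‖l' j‖) ∧ HasSum (fun j => l' j • a' j) g) :
    ∃ (m : ℕ → ℂ) (b : ℕ → E),
      (∀ j, P (b j)) ∧ Summable (fun j => ‖m j‖) ∧ HasSum (fun j => m j • b j) (f + g) := by
  let e := Equiv.natSumNatEquivNat.symm
  refine ⟨fun j => Sum.elim l l' (e j), fun j => Sum.elim a a' (e j), fun j => ?_, ?_, ?_⟩
  · show P (Sum.elim a a' (e j))
    rcases e j with k | k
    exacts [hf.1 k, hg.1 k]
  · have h : HasSum (fun s : ℕ ⊕ ℕ => ‖Sum.elim l l' s‖) (∑' j, ‖l j‖ + ∑' j, ‖l' j‖) :=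
      HasSum.sum (f := fun s : ℕ ⊕ ℕ => ‖Sum.elim l l' s‖) hf.2.1.hasSum hg.2.1.hasSum
    exact (e.summable_iff (f := fun s : ℕ ⊕ ℕ => ‖Sum.elim l l' s‖)).2 h.summable
  · have h : HasSum (fun s : ℕ ⊕ ℕ => Sum.elim l l' s • Sum.elim a a' s) (f + g) :=
      HasSum.sum (f := fun s : ℕ ⊕ ℕ => Sum.elim l l' s • Sum.elim a a' s) hf.2.2 hg.2.2
    exact (e.hasSum_iff (f := fun s : ℕ ⊕ ℕ => Sum.elim l l' s • Sum.elim a a' s)).2 h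

/-- The atomic Hardy space `𝓗^{1,r}(γ)`, as a subspace of `L¹(γ)`. -/
def hardySpace (n : ℕ) (r : ℝ≥0∞) : Submodule ℂ (Lp ℂ 1 (gaussMeasure n)) where
  carrier := {f | ∃ l a, IsAtomicDecomposition r f l a}
  add_mem' := by
    rintro f g ⟨l, a, hf⟩ ⟨l', a', hg⟩
    exact exists_interleave (P := fun a : Lp ℂ 1 (gaussMeasure n) => IsAtom r a) hf hg
  zero_mem' := by
    refine ⟨0, 0, fun j => Or.inr ⟨0, 1, one_pos, by simp [admissibleRadius], ?_, ?_, ?_, ?_⟩,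
      by simp, by simp⟩
    · exact (memLp_congr_ae (Lp.coeFn_zero ℂ 1 (gaussMeasure n))).2 MemLp.zero
    · filter_upwards [Lp.coeFn_zero ℂ 1 (gaussMeasure n)] with x hx _ using hx
    · rw [Pi.zero_apply, integral_congr_ae (Lp.coeFn_zero ℂ 1 (gaussMeasure n))]
      simp
    · rw [Pi.zero_apply, eLpNorm_congr_ae (Lp.coeFn_zero ℂ 1 (gaussMeasure n))]
      simp
  smul_mem' := by
    rintro c f ⟨l, a, h1, h2, h3⟩
    refine ⟨fun j => c * l j, a, h1, ?_, ?_⟩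
    · simpa [norm_mul] using h2.mul_left ‖c‖
    · simpa [mul_smul] using h3.const_smul c

/-- The norm of `𝓗^{1,r}(γ)`: the infimum of `∑_j |λ_j|` over all atomic decompositions. -/
def hardyNorm {n : ℕ} {r : ℝ≥0∞} (f : hardySpace n r) : ℝ :=
  sInf {t | ∃ l a, IsAtomicDecomposition r (f : Lp ℂ 1 (gaussMeasure n)) l a ∧
    t = ∑' j, ‖l j‖}

end

end GaussianHardy

/-!
The proof has an `L²` part, a kernel estimate, and a Calderón-Zygmund argument, all formulated in
terms of test functions.

The Hermite polynomials form a Hilbert basis of `L²(γ)`, and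
`D^{*α} h_β = √((β + α)! / β!) h_{β + α}`, where the factor is at most a multiple of
`(|β| + 1)^{|α|/2}`, the inverse of the eigenvalue of `(𝓛 + I)^{-|α|/2}` on `h_β`. So `R*_α` is an
everywhere defined bounded operator on `L²(γ)` (`exists_isNewRiesz`). Its action is described by
duality: `∫ (R*_α f) φ dγ = ∫ f Ψ_φ dγ` for every test function `φ`, with the bounded continuous
function `Ψ_φ = (𝓛 + I)^{-|α|/2} D^α φ` (`rieszDual`, `IsNewRiesz.integral_mul_eq`). By Mehler's
formula, the integral formula `(𝓛 + I)^{-s} = Γ(s)⁻¹ ∫₀^∞ t^{s-1} e^{-t} e^{-t𝓛} dt` and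
integration by parts, `Ψ_φ` is an integral of `φ` itself against derivatives of Gaussians.

Everything reduces to a uniform bound for `∫ a Ψ_φ dγ` over the atoms `a` and the test functions
`|φ| ≤ 1`. If `φ` vanishes on the double of an admissible ball, then `Ψ_φ` has bounded oscillation
on that ball: short times are controlled by the distance to the support of `φ`, long times by the
translation continuity of Hermite functions (`exists_abs_rieszDual_sub_le`). Together with the `L²`
bound for the part of `φ` near the ball and the doubling property of `γ` on admissible sets, this
bounds `∫ g Ψ_φ dγ` for *bounded* `g` of mean zero (`exists_abs_integral_mul_rieszDual_le`).

To pass from bounded functions to `L^p`, `p > 1`, the Calderón-Zygmund decomposition is run on a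
tree of dyadic cells, all of them admissible, inside a cube comparable with the given ball
(`exists_meanZeroBound`). At the height `Λ` times the mean of a function, the contribution of the
bad part carries a factor `Λ^{1-p}`, and so is absorbed in the bound to be proved; since `Ψ_φ` is
continuous, the induction starts at sufficiently small cells. It follows that `‖R*_α a‖ ≤ A` in
`L¹(γ)` for all atoms `a` in `L²(γ)` other than the constant (`exists_norm_le_of_isNewRiesz`).

The relation `∫ g φ dγ = ∫ f Ψ_φ dγ` for all `φ` defines a closed graph in `L¹(γ) × L¹(γ)`
(`rieszGraph`), which contains the graph of `R*_α`. Atoms are limits of multiples of atoms in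
`L²(γ)`, so the graph is defined and bounded on the Hardy space (`exists_extension`). It is the
only bounded extension because `L²(γ) ∩ 𝓗^{1,r}(γ)` is dense in the atomic norm
(`exists_hardyNorm_sub_lt`).
-/

/-! ### Hermite polynomials in one variable -/

namespace GaussianHardy

open Polynomial in
/-- The polynomials `He_k` form an Appell sequence. -/
theorem derivative_hermite_succ (k : ℕ) :
    derivative (hermite (k + 1)) = ((k : ℤ[X]) + 1) * hermite k := by
  induction k with
  | zero => simp
  | succ k ih =>
    rw [hermite_succ (k + 1), derivative_sub, derivative_mul, ih, derivative_mul, derivative_X]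
    have h : derivative (hermite k) = X * hermite k - hermite (k + 1) := by
      rw [hermite_succ]; ring
    have h2 : derivative ((k : ℤ[X]) + 1) = 0 := by simp
    rw [h2, h]
    push_cast
    ring

/-- The one-variable polynomial `t ↦ He_k(√2 t)`, orthogonal with respect to `exp(-t²) dt`. -/
noncomputable def hermitePoly (k : ℕ) : Polynomial ℝ :=
  ((Polynomial.hermite k).map (algebraMap ℤ ℝ)).comp (Polynomial.C √2 * Polynomial.X)

theorem eval_hermitePoly (k : ℕ) (t : ℝ) :
    (hermitePoly k).eval t = Polynomial.aeval (√2 * t) (Polynomial.hermite k) := by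
  simp [hermitePoly, Polynomial.aeval_def, Polynomial.eval₂_eq_eval_map]

theorem hermitePoly_zero : hermitePoly 0 = 1 := by
  simp [hermitePoly]

open Polynomial in
theorem derivative_hermitePoly (k : ℕ) :
    derivative (hermitePoly k) =
      C √2 * ((derivative (hermite k)).map (algebraMap ℤ ℝ)).comp (C √2 * X) := by
  rw [hermitePoly, derivative_comp, derivative_map]
  simp

open Polynomial in
theorem derivative_hermitePoly_succ (k : ℕ) :
    derivative (hermitePoly (k + 1)) = C (√2 * (k + 1)) * hermitePoly k := by
  rw [derivative_hermitePoly, derivative_hermite_succ, hermitePoly]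
  simp
  ring

open Polynomial in
theorem hermitePoly_succ (k : ℕ) :
    hermitePoly (k + 1) =
      C √2 * X * hermitePoly k - C (√2)⁻¹ * derivative (hermitePoly k) := by
  have h2 : √2 ≠ (0 : ℝ) := by positivity
  rw [derivative_hermitePoly, ← mul_assoc, ← C_mul, inv_mul_cancel₀ h2, hermitePoly, hermite_succ,
    hermitePoly]
  simp

open Polynomial in
theorem hermitePoly_succ_succ (k : ℕ) :
    hermitePoly (k + 2) =
      C √2 * X * hermitePoly (k + 1) - C ((k : ℝ) + 1) * hermitePoly k := by
  have h2 : √2 ≠ (0 : ℝ) := by positivity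
  rw [hermitePoly_succ, derivative_hermitePoly_succ, ← mul_assoc, ← C_mul, ← mul_assoc,
    inv_mul_cancel₀ h2, one_mul]

theorem integrable_eval_mul_exp (p : Polynomial ℝ) :
    Integrable fun t : ℝ => p.eval t * Real.exp (-t ^ 2) :=
  integrable_polynomial_mul_exp p

open Polynomial in
/-- Gaussian integration by parts. -/
theorem integral_derivative_mul_exp (p : Polynomial ℝ) :
    ∫ t : ℝ, (derivative p).eval t * Real.exp (-t ^ 2) =
      ∫ t : ℝ, (2 * t * p.eval t) * Real.exp (-t ^ 2) := by
  have hi := integrable_eval_mul_exp (C 2 * X * p)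
  have hd : ∀ t : ℝ, HasDerivAt (fun t => p.eval t * Real.exp (-t ^ 2))
      ((derivative p).eval t * Real.exp (-t ^ 2) - (2 * t * p.eval t) * Real.exp (-t ^ 2)) t := by
    intro t
    have h1 := p.hasDerivAt t
    have h2 : HasDerivAt (fun t : ℝ => Real.exp (-t ^ 2)) (Real.exp (-t ^ 2) * (-(2 * t))) t := by
      have := ((hasDerivAt_pow 2 t).neg).exp
      simpa using this
    exact (h1.fun_mul h2).congr_deriv (by ring)
  have hi' : Integrable fun t : ℝ => (2 * t * p.eval t) * Real.exp (-t ^ 2) := by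
    simpa using hi
  have h := integral_eq_zero_of_hasDerivAt_of_integrable hd
    ((integrable_eval_mul_exp _).sub hi') (integrable_eval_mul_exp p)
  rw [integral_sub (integrable_eval_mul_exp _) hi'] at h
  linarith

open Polynomial in
theorem integral_hermitePoly_succ_mul (k : ℕ) (p : Polynomial ℝ) :
    ∫ t : ℝ, ((hermitePoly (k + 1)).eval t * p.eval t) * Real.exp (-t ^ 2) =
      (√2)⁻¹ * ∫ t : ℝ, ((hermitePoly k).eval t * (derivative p).eval t) * Real.exp (-t ^ 2) := by
  have h2 : √2 ≠ (0 : ℝ) := by positivity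
  have h22 : √2 * √2 = (2 : ℝ) := Real.mul_self_sqrt (by norm_num)
  have e := integral_derivative_mul_exp (hermitePoly k * p)
  have i1 := integrable_eval_mul_exp (derivative (hermitePoly k) * p)
  have i2 := integrable_eval_mul_exp (hermitePoly k * derivative p)
  have i3 := integrable_eval_mul_exp (C 2 * X * (hermitePoly k * p))
  simp only [eval_mul, eval_C, eval_X, derivative_mul, eval_add, add_mul] at e i1 i2 i3
  rw [integral_add i1 i2] at e
  have e2 : ∀ t : ℝ, ((hermitePoly (k + 1)).eval t * p.eval t) * Real.exp (-t ^ 2) =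
      (√2)⁻¹ * ((2 * t * ((hermitePoly k).eval t * p.eval t)) * Real.exp (-t ^ 2)
        - ((derivative (hermitePoly k)).eval t * p.eval t) * Real.exp (-t ^ 2)) := by
    intro t
    rw [hermitePoly_succ]
    simp only [eval_mul, eval_C, eval_X, eval_sub]
    have : √2 = (√2)⁻¹ * 2 := by field_simp; linarith
    nth_rw 1 [this]
    ring
  simp_rw [e2]
  rw [integral_const_mul, integral_sub i3 i1, ← e]
  ring

theorem integral_exp_neg_sq : ∫ t : ℝ, Real.exp (-t ^ 2) = √Real.pi := by
  simpa using integral_gaussian 1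

open Polynomial in
/-- Orthogonality of the one-variable Hermite polynomials. -/
theorem integral_hermitePoly_mul_hermitePoly (m k : ℕ) :
    ∫ t : ℝ, ((hermitePoly m).eval t * (hermitePoly k).eval t) * Real.exp (-t ^ 2) =
      if m = k then (m.factorial : ℝ) * √Real.pi else 0 := by
  have h2 : √2 ≠ (0 : ℝ) := by positivity
  induction m generalizing k with
  | zero =>
    cases k with
    | zero => simp [hermitePoly_zero, integral_exp_neg_sq]
    | succ k =>
      have := integral_hermitePoly_succ_mul k 1
      simpa [hermitePoly_zero] using this
  | succ m ih =>
    rw [integral_hermitePoly_succ_mul]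
    cases k with
    | zero => simp [hermitePoly_zero]
    | succ k =>
      rw [derivative_hermitePoly_succ]
      have : ∀ t : ℝ, (hermitePoly m).eval t * (C (√2 * ((k : ℝ) + 1)) * hermitePoly k).eval t *
          Real.exp (-t ^ 2) = (√2 * (k + 1)) *
            ((hermitePoly m).eval t * (hermitePoly k).eval t * Real.exp (-t ^ 2)) := by
        intro t
        simp only [eval_mul, eval_C]
        ring
      simp_rw [this]
      rw [integral_const_mul, ih]
      by_cases h : m = k
      · subst h
        simp [Nat.factorial_succ]
        field_simp
      · simp [h]

open Polynomial in
/-- The Hermite polynomials are eigenfunctions of the Mehler averages. -/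
theorem integral_hermitePoly_rotate {r σ : ℝ} (h : r ^ 2 + σ ^ 2 = 1) (k : ℕ) (x : ℝ) :
    ∫ w : ℝ, (hermitePoly k).eval (r * x + σ * w) * Real.exp (-w ^ 2) =
      √Real.pi * (r ^ k * (hermitePoly k).eval x) := by
  have h2 : √2 ≠ (0 : ℝ) := by positivity
  have h22 : √2 * √2 = (2 : ℝ) := Real.mul_self_sqrt (by norm_num)
  have key : ∀ k : ℕ, ∫ w : ℝ, (hermitePoly (k + 1)).eval (r * x + σ * w) * Real.exp (-w ^ 2) =
      √2 * r * x * (∫ w : ℝ, (hermitePoly k).eval (r * x + σ * w) * Real.exp (-w ^ 2))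
      - r ^ 2 * (√2)⁻¹ *
        ∫ w : ℝ, (derivative (hermitePoly k)).eval (r * x + σ * w) * Real.exp (-w ^ 2) := by
    intro k
    let q : ℝ[X] := C (r * x) + C σ * X
    have e := integral_derivative_mul_exp ((hermitePoly k).comp q)
    have i1 := integrable_eval_mul_exp ((hermitePoly k).comp q)
    have i2 := integrable_eval_mul_exp ((derivative (hermitePoly k)).comp q)
    have i3 := integrable_eval_mul_exp (C 2 * X * (hermitePoly k).comp q)
    rw [derivative_comp] at e
    have hq : derivative q = C σ := by simp [q]
    rw [hq] at e
    have hqe : ∀ w, q.eval w = r * x + σ * w := fun w => by simp [q]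
    simp only [eval_mul, eval_C, eval_X, eval_comp, hqe, mul_assoc] at e i1 i2 i3
    rw [integral_const_mul, integral_const_mul] at e
    have e2 : ∀ w : ℝ, (hermitePoly (k + 1)).eval (r * x + σ * w) * Real.exp (-w ^ 2) =
        √2 * r * x * ((hermitePoly k).eval (r * x + σ * w) * Real.exp (-w ^ 2))
        + (√2)⁻¹ * σ * (2 * (w * ((hermitePoly k).eval (r * x + σ * w) * Real.exp (-w ^ 2))))
        - (√2)⁻¹ *
          ((derivative (hermitePoly k)).eval (r * x + σ * w) * Real.exp (-w ^ 2)) := by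
      intro w
      rw [hermitePoly_succ]
      simp only [eval_mul, eval_C, eval_X, eval_sub]
      have : √2 = (√2)⁻¹ * 2 := by field_simp; linarith
      nth_rw 1 [this]
      nth_rw 3 [this]
      ring
    simp_rw [e2]
    have i13 : Integrable fun w : ℝ =>
        √2 * r * x * ((hermitePoly k).eval (r * x + σ * w) * Real.exp (-w ^ 2)) + (√2)⁻¹ * σ *
          (2 * (w * ((hermitePoly k).eval (r * x + σ * w) * Real.exp (-w ^ 2)))) :=
      (i1.const_mul _).add (i3.const_mul _)
    rw [integral_sub i13 (i2.const_mul _), integral_add (i1.const_mul _) (i3.const_mul _),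
      integral_const_mul, integral_const_mul,
      integral_const_mul, integral_const_mul, ← e]
    have : r ^ 2 = 1 - σ ^ 2 := by linarith
    rw [this]
    ring
  induction k using Nat.strong_induction_on with
  | _ k ih =>
    match k with
    | 0 => simp [hermitePoly_zero, integral_exp_neg_sq]
    | 1 =>
      rw [key 0, ih 0 (by norm_num)]
      simp [hermitePoly_zero, hermitePoly_succ]
      ring
    | k + 2 =>
      rw [key (k + 1), ih (k + 1) (by omega), derivative_hermitePoly_succ]
      simp only [eval_mul, eval_C, mul_assoc]
      rw [integral_const_mul, integral_const_mul, ih k (by omega), hermitePoly_succ_succ]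
      simp only [eval_mul, eval_C, eval_X, eval_sub]
      field_simp
      ring

end GaussianHardy

/-! ### The Gaussian measure -/

namespace GaussianHardy

variable {n : ℕ}

theorem integral_gaussMeasure {F : Type*} [NormedAddCommGroup F] [NormedSpace ℝ F]
    (f : EuclideanSpace ℝ (Fin n) → F) :
    ∫ x, f x ∂(gaussMeasure n) =
      ∫ x, (Real.pi ^ (-(n : ℝ) / 2) * Real.exp (-‖x‖ ^ 2)) • f x := by
  unfold gaussMeasure
  rw [integral_withDensity_eq_integral_toReal_smul (by fun_prop) (by simp)]
  refine integral_congr_ae (Filter.Eventually.of_forall fun x => ?_)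
  have : 0 ≤ Real.pi ^ (-(n : ℝ) / 2) * Real.exp (-‖x‖ ^ 2) := by positivity
  simp only [ENNReal.toReal_ofReal this]

theorem integrable_gaussMeasure_iff {F : Type*} [NormedAddCommGroup F] [NormedSpace ℝ F]
    {f : EuclideanSpace ℝ (Fin n) → F} :
    Integrable f (gaussMeasure n) ↔ Integrable fun x => Real.exp (-‖x‖ ^ 2) • f x := by
  unfold gaussMeasure
  rw [integrable_withDensity_iff_integrable_smul' (by fun_prop) (by simp)]
  have h : ∀ x : EuclideanSpace ℝ (Fin n),
      (ENNReal.ofReal (Real.pi ^ (-(n : ℝ) / 2) * Real.exp (-‖x‖ ^ 2))).toReal • f x =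
        (Real.pi ^ (-(n : ℝ) / 2)) • (Real.exp (-‖x‖ ^ 2) • f x) := by
    intro x
    have : 0 ≤ Real.pi ^ (-(n : ℝ) / 2) * Real.exp (-‖x‖ ^ 2) := by positivity
    rw [ENNReal.toReal_ofReal this, smul_smul]
  simp_rw [h]
  have hp : Real.pi ^ (-(n : ℝ) / 2) ≠ 0 := by positivity
  exact integrable_smul_iff hp _

theorem exp_neg_norm_sq (x : EuclideanSpace ℝ (Fin n)) :
    Real.exp (-‖x‖ ^ 2) = ∏ i, Real.exp (-(x i) ^ 2) := by
  rw [← Real.exp_sum, EuclideanSpace.real_norm_sq_eq, Finset.sum_neg_distrib]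

theorem integral_prod_eq_prod (f : Fin n → ℝ → ℝ) :
    ∫ x : EuclideanSpace ℝ (Fin n), ∏ i, f i (x i) = ∏ i, ∫ t, f i t := by
  rw [← integral_fintype_prod_volume_eq_prod]
  exact ((EuclideanSpace.volume_preserving_symm_measurableEquiv_toLp (Fin n)).integral_comp
    (MeasurableEquiv.measurableEmbedding _) fun y : Fin n → ℝ => ∏ i, f i (y i))

theorem pi_rpow_eq_prod : Real.pi ^ (-(n : ℝ) / 2) = ∏ _i : Fin n, (√Real.pi)⁻¹ := by
  rw [Finset.prod_const, Finset.card_univ, Fintype.card_fin, Real.sqrt_eq_rpow,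
    ← Real.rpow_neg Real.pi_pos.le, ← Real.rpow_natCast, ← Real.rpow_mul Real.pi_pos.le]
  congr 1
  ring

/-- Integrals of tensor products against the Gaussian measure. -/
theorem integral_prod_gaussMeasure (f : Fin n → ℝ → ℝ) :
    ∫ x, ∏ i, f i (x i) ∂(gaussMeasure n) =
      ∏ i, (√Real.pi)⁻¹ * ∫ t, f i t * Real.exp (-t ^ 2) := by
  rw [integral_gaussMeasure, Finset.prod_mul_distrib, ← pi_rpow_eq_prod, ← integral_prod_eq_prod,
    ← integral_const_mul]
  refine integral_congr_ae (Filter.Eventually.of_forall fun x => ?_)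
  simp only [smul_eq_mul]
  rw [exp_neg_norm_sq, Finset.prod_mul_distrib]
  ring

theorem integrable_exp_neg_mul_norm_sq {b : ℝ} (hb : 0 < b) :
    Integrable fun x : EuclideanSpace ℝ (Fin n) => Real.exp (-b * ‖x‖ ^ 2) := by
  have h := (GaussianFourier.integrable_cexp_neg_mul_sq_norm_add (V := EuclideanSpace ℝ (Fin n))
    (b := (b : ℂ)) (by simpa using hb) 0 0).norm
  refine h.congr (Filter.Eventually.of_forall fun x => ?_)
  simp only [Complex.norm_exp]
  congr 1
  simp [← Complex.ofReal_pow]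

instance : IsProbabilityMeasure (gaussMeasure n) := by
  have hi : Integrable (fun _ : EuclideanSpace ℝ (Fin n) => (1 : ℝ)) (gaussMeasure n) := by
    rw [integrable_gaussMeasure_iff]
    simpa using integrable_exp_neg_mul_norm_sq (n := n) one_pos
  have h := integral_prod_gaussMeasure (n := n) fun _ _ => 1
  have hs : √Real.pi ≠ 0 := by positivity
  simp only [Finset.prod_const_one, one_mul, integral_exp_neg_sq, inv_mul_cancel₀ hs] at h
  have : IsFiniteMeasure (gaussMeasure n) := by
    rw [integrable_const_iff] at hi
    exact hi.resolve_left one_ne_zero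
  rw [integral_const, smul_eq_mul, mul_one] at h
  refine ⟨?_⟩
  rw [Measure.real, ENNReal.toReal_eq_one_iff] at h
  exact h

theorem exp_mul_norm_le (a : ℝ) (x : EuclideanSpace ℝ (Fin n)) :
    Real.exp (-‖x‖ ^ 2) * Real.exp (a * ‖x‖) ≤
      Real.exp (a ^ 2 / 2) * Real.exp (-(1 / 2) * ‖x‖ ^ 2) := by
  rw [← Real.exp_add, ← Real.exp_add]
  refine Real.exp_le_exp.2 ?_
  nlinarith [sq_nonneg (a - ‖x‖)]

theorem integrable_exp_mul_norm (a : ℝ) :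
    Integrable (fun x : EuclideanSpace ℝ (Fin n) => Real.exp (a * ‖x‖)) (gaussMeasure n) := by
  rw [integrable_gaussMeasure_iff]
  refine ((integrable_exp_neg_mul_norm_sq (n := n) (b := 1 / 2) (by norm_num)).const_mul
    (Real.exp (a ^ 2 / 2))).mono' (by fun_prop) (Filter.Eventually.of_forall fun x => ?_)
  rw [Real.norm_of_nonneg (by positivity), smul_eq_mul]
  exact exp_mul_norm_le a x

theorem memLp_exp_mul_norm (a : ℝ) :
    MemLp (fun x : EuclideanSpace ℝ (Fin n) => Real.exp (a * ‖x‖)) 2 (gaussMeasure n) := by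
  rw [memLp_two_iff_integrable_sq (by fun_prop)]
  refine (integrable_exp_mul_norm (2 * a)).congr (Filter.Eventually.of_forall fun x => ?_)
  simp only [← Real.exp_nat_mul]
  congr 1
  push_cast
  ring

/-! ### Hermite polynomials in several variables -/

/-- The product `∏_i He_{β_i}(√2 x_i)`, that is, `√(β!) h_β`. -/
noncomputable def hermiteProd (β : Fin n → ℕ) (x : EuclideanSpace ℝ (Fin n)) : ℝ :=
  ∏ i, (hermitePoly (β i)).eval (x i)

/-- `√(β!)`. -/
noncomputable def sqrtFactorial (β : Fin n → ℕ) : ℝ := ∏ i, √((β i).factorial : ℝ)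

theorem sqrtFactorial_pos (β : Fin n → ℕ) : 0 < sqrtFactorial β :=
  Finset.prod_pos fun i _ => Real.sqrt_pos.2 (by exact_mod_cast Nat.factorial_pos _)

theorem hermiteFn_eq (β : Fin n → ℕ) (x : EuclideanSpace ℝ (Fin n)) :
    hermiteFn β x = (sqrtFactorial β)⁻¹ * hermiteProd β x := by
  simp only [hermiteFn, hermiteProd, eval_hermitePoly, Finset.prod_div_distrib, sqrtFactorial]
  rw [div_eq_inv_mul]

theorem continuous_hermiteProd (β : Fin n → ℕ) : Continuous (hermiteProd (n := n) β) := by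
  unfold hermiteProd
  fun_prop

theorem continuous_hermiteFn (β : Fin n → ℕ) : Continuous (hermiteFn (n := n) β) := by
  unfold hermiteFn
  fun_prop

theorem memLp_hermiteFn_real (β : Fin n → ℕ) : MemLp (hermiteFn β) 2 (gaussMeasure n) := by
  simpa using (memLp_hermiteFn β).re

theorem integral_hermiteProd_mul (β β' : Fin n → ℕ) :
    ∫ x, hermiteProd β x * hermiteProd β' x ∂(gaussMeasure n) =
      if β = β' then sqrtFactorial β ^ 2 else 0 := by
  have hs : √Real.pi ≠ 0 := by positivity
  simp_rw [hermiteProd, ← Finset.prod_mul_distrib]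
  rw [integral_prod_gaussMeasure fun i t =>
    (hermitePoly (β i)).eval t * (hermitePoly (β' i)).eval t]
  simp_rw [integral_hermitePoly_mul_hermitePoly]
  split_ifs with h
  · subst h
    rw [sqrtFactorial, ← Finset.prod_pow]
    refine Finset.prod_congr rfl fun i _ => ?_
    rw [if_pos rfl, Real.sq_sqrt (by positivity)]
    field_simp
  · obtain ⟨i, hi⟩ := Function.ne_iff.1 h
    exact Finset.prod_eq_zero (Finset.mem_univ i) (by simp [hi])

theorem integral_hermiteFn_mul (β β' : Fin n → ℕ) :
    ∫ x, hermiteFn β x * hermiteFn β' x ∂(gaussMeasure n) = if β = β' then 1 else 0 := by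
  have h : ∀ x : EuclideanSpace ℝ (Fin n), hermiteFn β x * hermiteFn β' x =
      ((sqrtFactorial β)⁻¹ * (sqrtFactorial β')⁻¹) * (hermiteProd β x * hermiteProd β' x) := by
    intro x
    rw [hermiteFn_eq, hermiteFn_eq]
    ring
  simp_rw [h]
  rw [integral_const_mul, integral_hermiteProd_mul]
  have := (sqrtFactorial_pos β).ne'
  split_ifs with h
  · subst h
    field_simp
  · simp

theorem coeFn_hermiteL2 (β : Fin n → ℕ) :
    hermiteL2 β =ᵐ[gaussMeasure n] fun x => (hermiteFn β x : ℂ) :=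
  (memLp_hermiteFn β).coeFn_toLp

theorem inner_hermiteL2 (β : Fin n → ℕ) (f : Lp ℂ 2 (gaussMeasure n)) :
    (inner ℂ (hermiteL2 β) f : ℂ) = ∫ x, (hermiteFn β x : ℂ) * f x ∂(gaussMeasure n) := by
  rw [L2.inner_def]
  refine integral_congr_ae ?_
  filter_upwards [coeFn_hermiteL2 β] with x hx
  rw [hx]
  simp [mul_comm]

theorem orthonormal_hermiteL2 :
    Orthonormal ℂ (hermiteL2 : (Fin n → ℕ) → Lp ℂ 2 (gaussMeasure n)) := by
  classical
  rw [orthonormal_iff_ite]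
  intro β β'
  rw [inner_hermiteL2]
  have : ∫ x, (hermiteFn β x : ℂ) * hermiteL2 β' x ∂(gaussMeasure n) =
      ∫ x, ((hermiteFn β x * hermiteFn β' x : ℝ) : ℂ) ∂(gaussMeasure n) := by
    refine integral_congr_ae ?_
    filter_upwards [coeFn_hermiteL2 β'] with x hx
    rw [hx]
    simp
  rw [this, integral_complex_ofReal, integral_hermiteFn_mul]
  split_ifs <;> simp

/-! ### Completeness of the Hermite polynomials -/

/-- The linear span of the Hermite polynomials. -/
noncomputable def hermiteSpan (n : ℕ) : Submodule ℝ (EuclideanSpace ℝ (Fin n) → ℝ) :=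
  Submodule.span ℝ (Set.range hermiteProd)

theorem coord_mul_hermiteProd (β : Fin n → ℕ) (i : Fin n) :
    (fun x => x i * hermiteProd β x) ∈ hermiteSpan n := by
  have h2 : √2 ≠ (0 : ℝ) := by positivity
  have key : ∀ (k : ℕ) (x : EuclideanSpace ℝ (Fin n)),
      hermiteProd (Function.update β i k) x =
        (hermitePoly k).eval (x i) * ∏ j ∈ Finset.univ.erase i, (hermitePoly (β j)).eval (x j) := by
    intro k x
    rw [hermiteProd, ← Finset.mul_prod_erase _ _ (Finset.mem_univ i)]
    congr 1
    · simp
    · refine Finset.prod_congr rfl fun j hj => ?_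
      rw [Function.update_of_ne (Finset.ne_of_mem_erase hj)]
  have key0 := key (β i)
  rw [Function.update_eq_self] at key0
  have mem : ∀ k, hermiteProd (Function.update β i k) ∈ hermiteSpan n :=
    fun k => Submodule.subset_span ⟨_, rfl⟩
  rcases hk : β i with _ | k
  · have : (fun x => x i * hermiteProd β x) = (√2)⁻¹ • hermiteProd (Function.update β i 1) := by
      funext x
      simp only [Pi.smul_apply, smul_eq_mul, key0, key, hk]
      simp [hermitePoly_succ, hermitePoly_zero]
      field_simp
    rw [this]
    exact Submodule.smul_mem _ _ (mem _)
  · have : (fun x => x i * hermiteProd β x) = (√2)⁻¹ • hermiteProd (Function.update β i (k + 2)) +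
        ((√2)⁻¹ * (k + 1)) • hermiteProd (Function.update β i k) := by
      funext x
      simp only [Pi.smul_apply, Pi.add_apply, smul_eq_mul, key0, key, hk, hermitePoly_succ_succ]
      simp
      field_simp
      ring
    rw [this]
    exact Submodule.add_mem _ (Submodule.smul_mem _ _ (mem _)) (Submodule.smul_mem _ _ (mem _))

theorem coord_mul_mem_hermiteSpan {w : EuclideanSpace ℝ (Fin n) → ℝ} (hw : w ∈ hermiteSpan n)
    (i : Fin n) : (fun x => x i * w x) ∈ hermiteSpan n := by
  induction hw using Submodule.span_induction with
  | mem w h =>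
    obtain ⟨β, rfl⟩ := h
    exact coord_mul_hermiteProd β i
  | zero =>
    simp only [Pi.zero_apply, mul_zero]
    exact Submodule.zero_mem _
  | add u v _ _ hu hv =>
    simp only [Pi.add_apply, mul_add]
    exact Submodule.add_mem _ hu hv
  | smul c u _ hu =>
    have : (fun x : EuclideanSpace ℝ (Fin n) => x i * (c • u) x) = c • fun x => x i * u x := by
      funext x
      simp only [Pi.smul_apply, smul_eq_mul]
      ring
    rw [this]
    exact Submodule.smul_mem _ _ hu

theorem inner_pow_mem_hermiteSpan (ξ : EuclideanSpace ℝ (Fin n)) (k : ℕ) :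
    (fun x => (inner ℝ x ξ : ℝ) ^ k) ∈ hermiteSpan n := by
  induction k with
  | zero =>
    refine Submodule.subset_span ⟨0, ?_⟩
    funext x
    simp [hermiteProd, hermitePoly_zero]
  | succ k ih =>
    have : (fun x => (inner ℝ x ξ : ℝ) ^ (k + 1)) =
        ∑ i, (ξ i) • fun x : EuclideanSpace ℝ (Fin n) => x i * (inner ℝ x ξ : ℝ) ^ k := by
      funext x
      simp only [Finset.sum_apply, Pi.smul_apply, smul_eq_mul, ← mul_assoc]
      rw [← Finset.sum_mul, pow_succ', PiLp.inner_apply]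
      simp
    rw [this]
    exact Submodule.sum_mem _ fun i _ => Submodule.smul_mem _ _ (coord_mul_mem_hermiteSpan ih i)

theorem memLp_and_integral_eq_zero_of_mem_hermiteSpan {f : EuclideanSpace ℝ (Fin n) → ℝ}
    (hf : MemLp f 2 (gaussMeasure n))
    (h0 : ∀ β, ∫ x, hermiteFn β x * f x ∂(gaussMeasure n) = 0)
    {w : EuclideanSpace ℝ (Fin n) → ℝ} (hw : w ∈ hermiteSpan n) :
    MemLp w 2 (gaussMeasure n) ∧ ∫ x, w x * f x ∂(gaussMeasure n) = 0 := by
  induction hw using Submodule.span_induction with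
  | mem w h =>
    obtain ⟨β, rfl⟩ := h
    have h1 : hermiteProd β = fun x : EuclideanSpace ℝ (Fin n) =>
        sqrtFactorial β * hermiteFn β x := by
      funext x
      rw [hermiteFn_eq, mul_inv_cancel_left₀ (sqrtFactorial_pos β).ne']
    rw [h1]
    refine ⟨(memLp_hermiteFn_real β).const_mul _, ?_⟩
    simp_rw [mul_assoc]
    rw [integral_const_mul, h0, mul_zero]
  | zero => exact ⟨MemLp.zero, by simp⟩
  | add u v _ _ hu hv =>
    refine ⟨hu.1.add hv.1, ?_⟩
    simp only [Pi.add_apply, add_mul]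
    have hu' : Integrable (fun x => u x * f x) (gaussMeasure n) := hu.1.integrable_mul hf
    have hv' : Integrable (fun x => v x * f x) (gaussMeasure n) := hv.1.integrable_mul hf
    rw [integral_add hu' hv', hu.2, hv.2, add_zero]
  | smul c u _ hu =>
    refine ⟨hu.1.const_smul c, ?_⟩
    simp only [Pi.smul_apply, smul_eq_mul, mul_assoc]
    rw [integral_const_mul, hu.2, mul_zero]

/-- Orthogonality to all polynomials forces the Fourier transform to vanish: expand the
exponential, which is legitimate since `exp(|ξ||x|)` is square integrable. -/
theorem integral_exp_inner_mul_eq_zero {f : EuclideanSpace ℝ (Fin n) → ℝ}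
    (hf : MemLp f 2 (gaussMeasure n))
    (h0 : ∀ β, ∫ x, hermiteFn β x * f x ∂(gaussMeasure n) = 0) (ξ : EuclideanSpace ℝ (Fin n)) :
    ∫ x, Complex.exp ((inner ℝ x ξ : ℝ) * Complex.I) * (f x : ℂ) ∂(gaussMeasure n) = 0 := by
  have hs := hasSum_integral_of_dominated_convergence (μ := gaussMeasure n)
    (F := fun (k : ℕ) (x : EuclideanSpace ℝ (Fin n)) =>
      (((inner ℝ x ξ : ℝ) : ℂ) * Complex.I) ^ k / (k.factorial : ℂ) * (f x : ℂ))
    (f := fun x => Complex.exp ((inner ℝ x ξ : ℝ) * Complex.I) * (f x : ℂ))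
    (fun k x => (‖ξ‖ * ‖x‖) ^ k / (k.factorial : ℝ) * |f x|)
    (fun k => ?_) (fun k => Filter.Eventually.of_forall fun x => ?_)
    (Filter.Eventually.of_forall fun x => ?_) ?_ (Filter.Eventually.of_forall fun x => ?_)
  · have hz : ∀ k : ℕ, ∫ x, (((inner ℝ x ξ : ℝ) : ℂ) * Complex.I) ^ k / (k.factorial : ℂ) *
        (f x : ℂ) ∂(gaussMeasure n) = 0 := by
      intro k
      have := (memLp_and_integral_eq_zero_of_mem_hermiteSpan hf h0
        (inner_pow_mem_hermiteSpan ξ k)).2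
      have h2 : ∀ x : EuclideanSpace ℝ (Fin n),
          (((inner ℝ x ξ : ℝ) : ℂ) * Complex.I) ^ k / (k.factorial : ℂ) * (f x : ℂ) =
          (Complex.I ^ k / (k.factorial : ℂ)) * (((inner ℝ x ξ : ℝ) ^ k * f x : ℝ) : ℂ) := by
        intro x
        push_cast
        ring
      simp_rw [h2]
      rw [integral_const_mul, integral_complex_ofReal, this]
      simp
    simp_rw [hz] at hs
    exact hs.unique hasSum_zero
  · have := hf.1
    have h3 : AEStronglyMeasurable (fun x => (f x : ℂ)) (gaussMeasure n) :=
      Complex.continuous_ofReal.comp_aestronglyMeasurable this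
    refine AEStronglyMeasurable.mul (Continuous.aestronglyMeasurable ?_) h3
    fun_prop
  · simp only [norm_mul, norm_div, norm_pow, Complex.norm_real, Complex.norm_I, mul_one,
      Complex.norm_natCast, Real.norm_eq_abs]
    gcongr
    rw [mul_comm]
    exact abs_real_inner_le_norm x ξ
  · exact (Real.summable_pow_div_factorial _).mul_right _
  · have h4 : ∀ x : EuclideanSpace ℝ (Fin n),
        ∑' k : ℕ, (‖ξ‖ * ‖x‖) ^ k / (k.factorial : ℝ) * |f x| = Real.exp (‖ξ‖ * ‖x‖) * |f x| := by
      intro x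
      rw [tsum_mul_right, Real.exp_eq_exp_ℝ, NormedSpace.exp_eq_tsum_div]
    simp_rw [h4]
    exact (memLp_exp_mul_norm ‖ξ‖).integrable_mul hf.abs
  · refine HasSum.mul_right _ ?_
    rw [Complex.exp_eq_exp_ℂ]
    exact NormedSpace.expSeries_div_hasSum_exp _

/-- The finite measures `f⁺ γ` and `f⁻ γ` have the same characteristic function, so they are
equal. -/
theorem ae_eq_zero_of_forall_hermite_real {f : EuclideanSpace ℝ (Fin n) → ℝ}
    (hf : MemLp f 2 (gaussMeasure n))
    (h0 : ∀ β, ∫ x, hermiteFn β x * f x ∂(gaussMeasure n) = 0) :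
    f =ᵐ[gaussMeasure n] 0 := by
  have hi : Integrable f (gaussMeasure n) := hf.integrable (by norm_num)
  let μ₁ := (gaussMeasure n).withDensity fun x => ENNReal.ofReal (f x)
  let μ₂ := (gaussMeasure n).withDensity fun x => ENNReal.ofReal (-f x)
  have f1 : IsFiniteMeasure μ₁ := isFiniteMeasure_withDensity_ofReal hi.2
  have f2 : IsFiniteMeasure μ₂ := isFiniteMeasure_withDensity_ofReal hi.neg.2
  have m1 : AEMeasurable (fun x => ENNReal.ofReal (f x)) (gaussMeasure n) :=
    hi.1.aemeasurable.ennreal_ofReal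
  have m2 : AEMeasurable (fun x => ENNReal.ofReal (-f x)) (gaussMeasure n) :=
    hi.neg.1.aemeasurable.ennreal_ofReal
  have hint : ∀ (g : EuclideanSpace ℝ (Fin n) → ℝ) (ξ : EuclideanSpace ℝ (Fin n)),
      Integrable g (gaussMeasure n) → Integrable (fun x => (ENNReal.ofReal (g x)).toReal •
        Complex.exp ((inner ℝ x ξ : ℝ) * Complex.I)) (gaussMeasure n) := by
    intro g ξ hg
    refine hg.mono ?_ (Filter.Eventually.of_forall fun x => ?_)
    · refine AEStronglyMeasurable.smul
        hg.1.aemeasurable.ennreal_ofReal.ennreal_toReal.aestronglyMeasurable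
        (Continuous.aestronglyMeasurable ?_)
      fun_prop
    · rw [norm_smul, Complex.norm_exp_ofReal_mul_I, mul_one, ENNReal.toReal_ofReal',
        Real.norm_eq_abs, Real.norm_eq_abs, abs_of_nonneg (le_max_right _ _)]
      exact max_le (le_abs_self _) (abs_nonneg _)
  have hch : charFun μ₁ = charFun μ₂ := by
    funext ξ
    rw [charFun_apply, charFun_apply,
      integral_withDensity_eq_integral_toReal_smul₀ m1 (by simp),
      integral_withDensity_eq_integral_toReal_smul₀ m2 (by simp), ← sub_eq_zero,
      ← integral_sub (hint f ξ hi) (hint (fun x => -f x) ξ hi.neg),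
      ← integral_exp_inner_mul_eq_zero hf h0 ξ]
    refine integral_congr_ae (Filter.Eventually.of_forall fun x => ?_)
    simp only [← sub_smul, ENNReal.toReal_ofReal']
    rw [show max (f x) 0 - max (-f x) 0 = f x by
      rcases le_total 0 (f x) with h | h
      · rw [max_eq_left h, max_eq_right (by linarith), sub_zero]
      · rw [max_eq_right h, max_eq_left (by linarith)]; ring]
    rw [Complex.real_smul, mul_comm]
  have := Measure.ext_of_charFun hch
  rw [withDensity_eq_iff m1 m2] at this
  · filter_upwards [this] with x hx
    have h5 := congrArg ENNReal.toReal hx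
    simp only [ENNReal.toReal_ofReal'] at h5
    rcases le_total 0 (f x) with h | h
    · rw [max_eq_left h, max_eq_right (by linarith)] at h5
      exact h5
    · rw [max_eq_right h, max_eq_left (by linarith)] at h5
      show f x = 0
      linarith
  · exact hi.lintegral_lt_top.ne

theorem eq_zero_of_forall_inner_hermiteL2 {f : Lp ℂ 2 (gaussMeasure n)}
    (h : ∀ β, (inner ℂ (hermiteL2 β) f : ℂ) = 0) : f = 0 := by
  have hf := Lp.memLp f
  have hi : ∀ β : Fin n → ℕ, Integrable (fun x => (hermiteFn β x : ℂ) * f x) (gaussMeasure n) :=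
    fun β => (memLp_hermiteFn β).integrable_mul hf
  have hre : ∀ β : Fin n → ℕ, ∫ x, hermiteFn β x * (f x).re ∂(gaussMeasure n) = 0 := by
    intro β
    have h1 := h β
    rw [inner_hermiteL2] at h1
    have h2 := integral_re (hi β)
    rw [h1] at h2
    simpa using h2
  have him : ∀ β : Fin n → ℕ, ∫ x, hermiteFn β x * (f x).im ∂(gaussMeasure n) = 0 := by
    intro β
    have h1 := h β
    rw [inner_hermiteL2] at h1
    have h2 := integral_im (hi β)
    rw [h1] at h2
    simpa using h2
  have e1 := ae_eq_zero_of_forall_hermite_real hf.re hre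
  have e2 := ae_eq_zero_of_forall_hermite_real hf.im him
  rw [Lp.eq_zero_iff_ae_eq_zero]
  filter_upwards [e1, e2] with x h1 h2
  exact Complex.ext h1 h2

/-- The normalized Hermite polynomials form a Hilbert basis of `L²(γ)`. -/
noncomputable def hermiteBasis (n : ℕ) :
    HilbertBasis (Fin n → ℕ) ℂ (Lp ℂ 2 (gaussMeasure n)) :=
  HilbertBasis.mkOfOrthogonalEqBot orthonormal_hermiteL2 (by
    rw [Submodule.eq_bot_iff]
    intro f hf
    refine eq_zero_of_forall_inner_hermiteL2 fun β => ?_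
    exact (Submodule.mem_orthogonal _ _).1 hf _ (Submodule.subset_span ⟨β, rfl⟩))

theorem hermiteBasis_apply (β : Fin n → ℕ) : hermiteBasis n β = hermiteL2 β := by
  rw [hermiteBasis, HilbertBasis.coe_mkOfOrthogonalEqBot]

end GaussianHardy

/-! ### Hermite functions and integration by parts -/

namespace GaussianHardy

variable {n : ℕ}

theorem exists_abs_eval_mul_exp_le (p : Polynomial ℝ) :
    ∃ C, 0 ≤ C ∧ ∀ t : ℝ, |p.eval t * Real.exp (-t ^ 2)| ≤ C * Real.exp (-t ^ 2 / 2) := by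
  induction p using Polynomial.induction_on' with
  | add p q hp hq =>
    obtain ⟨C, hC, h⟩ := hp
    obtain ⟨D, hD, h'⟩ := hq
    refine ⟨C + D, by positivity, fun t => ?_⟩
    rw [Polynomial.eval_add, add_mul, add_mul]
    exact (abs_add_le _ _).trans (add_le_add (h t) (h' t))
  | monomial k a =>
    refine ⟨|a| * (k.factorial * Real.exp (1 / 2)), by positivity, fun t => ?_⟩
    have h1 := Real.pow_div_factorial_le_exp |t| (abs_nonneg t) k
    rw [div_le_iff₀ (by positivity)] at h1
    have h2 : Real.exp |t| * Real.exp (-t ^ 2) ≤ Real.exp (1 / 2) * Real.exp (-t ^ 2 / 2) := by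
      rw [← Real.exp_add, ← Real.exp_add]
      refine Real.exp_le_exp.2 ?_
      nlinarith [sq_nonneg (|t| - 1), sq_abs t]
    rw [Polynomial.eval_monomial, abs_mul, abs_mul, abs_pow, Real.abs_exp, mul_assoc, mul_assoc]
    refine mul_le_mul_of_nonneg_left ?_ (abs_nonneg a)
    calc |t| ^ k * Real.exp (-t ^ 2) ≤ (Real.exp |t| * k.factorial) * Real.exp (-t ^ 2) := by gcongr
      _ = k.factorial * (Real.exp |t| * Real.exp (-t ^ 2)) := by ring
      _ ≤ k.factorial * (Real.exp (1 / 2) * Real.exp (-t ^ 2 / 2)) := by gcongr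
      _ = _ := by ring

/-- The Hermite function `G_β(z) = ∏_i He_{β_i}(√2 z_i) exp(-|z|²)`, a multiple of
`∂^β exp(-|z|²)`. -/
noncomputable def gaussHermite (β : Fin n → ℕ) (z : EuclideanSpace ℝ (Fin n)) : ℝ :=
  hermiteProd β z * Real.exp (-‖z‖ ^ 2)

theorem gaussHermite_eq_prod (β : Fin n → ℕ) (z : EuclideanSpace ℝ (Fin n)) :
    gaussHermite β z = ∏ i, (hermitePoly (β i)).eval (z i) * Real.exp (-(z i) ^ 2) := by
  rw [gaussHermite, hermiteProd, exp_neg_norm_sq, Finset.prod_mul_distrib]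

theorem continuous_gaussHermite (β : Fin n → ℕ) : Continuous (gaussHermite (n := n) β) := by
  unfold gaussHermite
  exact (continuous_hermiteProd β).mul (by fun_prop)

theorem hasDerivAt_hermitePoly_mul_exp (k : ℕ) (t : ℝ) :
    HasDerivAt (fun t => (hermitePoly k).eval t * Real.exp (-t ^ 2))
      (-√2 * ((hermitePoly (k + 1)).eval t * Real.exp (-t ^ 2))) t := by
  have h2 : √2 ≠ (0 : ℝ) := by positivity
  have h22 : √2 * √2 = (2 : ℝ) := Real.mul_self_sqrt (by norm_num)
  have h1 := (hermitePoly k).hasDerivAt t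
  have h3 : HasDerivAt (fun t : ℝ => Real.exp (-t ^ 2)) (Real.exp (-t ^ 2) * (-(2 * t))) t := by
    have := ((hasDerivAt_pow 2 t).neg).exp
    simpa using this
  refine (h1.fun_mul h3).congr_deriv ?_
  rw [hermitePoly_succ]
  simp only [Polynomial.eval_mul, Polynomial.eval_sub, Polynomial.eval_C, Polynomial.eval_X]
  field_simp
  rw [Real.sq_sqrt (by norm_num)]
  ring

theorem prod_erase_mul_gaussHermite (β : Fin n → ℕ) (i : Fin n)
    (z : EuclideanSpace ℝ (Fin n)) :
    (∏ j ∈ Finset.univ.erase i, (hermitePoly (β j)).eval (z j) * Real.exp (-(z j) ^ 2)) *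
      ((hermitePoly (β i + 1)).eval (z i) * Real.exp (-(z i) ^ 2)) =
      gaussHermite (β + Pi.single i 1) z := by
  rw [gaussHermite_eq_prod, ← Finset.prod_erase_mul _ _ (Finset.mem_univ i)]
  congr 1
  · refine Finset.prod_congr rfl fun j hj => ?_
    rw [Pi.add_apply, Pi.single_eq_of_ne (Finset.ne_of_mem_erase hj), add_zero]
  · simp

theorem hasFDerivAt_gaussHermite (β : Fin n → ℕ) (z : EuclideanSpace ℝ (Fin n)) :
    HasFDerivAt (gaussHermite β)
      (∑ i, (-√2 * gaussHermite (β + Pi.single i 1) z) •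
        (EuclideanSpace.proj i : EuclideanSpace ℝ (Fin n) →L[ℝ] ℝ)) z := by
  have h : ∀ i : Fin n, HasFDerivAt
      (fun z : EuclideanSpace ℝ (Fin n) => (hermitePoly (β i)).eval (z i) * Real.exp (-(z i) ^ 2))
      ((-√2 * ((hermitePoly (β i + 1)).eval (z i) * Real.exp (-(z i) ^ 2))) •
        (EuclideanSpace.proj i : EuclideanSpace ℝ (Fin n) →L[ℝ] ℝ)) z := fun i =>
    HasDerivAt.comp_hasFDerivAt (h₂ := fun t => (hermitePoly (β i)).eval t * Real.exp (-t ^ 2)) z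
      (hasDerivAt_hermitePoly_mul_exp (β i) (z i))
      (EuclideanSpace.proj i : EuclideanSpace ℝ (Fin n) →L[ℝ] ℝ).hasFDerivAt
  have h' := HasFDerivAt.finsetProd (u := Finset.univ) fun i _ => h i
  have e : (gaussHermite β : EuclideanSpace ℝ (Fin n) → ℝ) = fun z =>
      ∏ i, (hermitePoly (β i)).eval (z i) * Real.exp (-(z i) ^ 2) :=
    funext fun z => gaussHermite_eq_prod β z
  rw [e]
  refine h'.congr_fderiv (Finset.sum_congr rfl fun i _ => ?_)
  rw [smul_smul, ← prod_erase_mul_gaussHermite]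
  congr 1
  ring

theorem fderiv_gaussHermite_single (β : Fin n → ℕ) (i : Fin n) (z : EuclideanSpace ℝ (Fin n)) :
    fderiv ℝ (gaussHermite β) z (EuclideanSpace.single i 1) =
      -√2 * gaussHermite (β + Pi.single i 1) z := by
  rw [(hasFDerivAt_gaussHermite β z).fderiv]
  simp

theorem exists_abs_gaussHermite_le (β : Fin n → ℕ) :
    ∃ C, 0 ≤ C ∧ ∀ z : EuclideanSpace ℝ (Fin n),
      |gaussHermite β z| ≤ C * Real.exp (-(1 / 2) * ‖z‖ ^ 2) := by
  choose C hC h using fun i : Fin n => exists_abs_eval_mul_exp_le (hermitePoly (β i))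
  refine ⟨∏ i, C i, Finset.prod_nonneg fun i _ => hC i, fun z => ?_⟩
  have e : Real.exp (-(1 / 2) * ‖z‖ ^ 2) = ∏ i, Real.exp (-(z i) ^ 2 / 2) := by
    rw [← Real.exp_sum, EuclideanSpace.real_norm_sq_eq, Finset.mul_sum]
    congr 1
    exact Finset.sum_congr rfl fun i _ => by ring
  rw [gaussHermite_eq_prod, Finset.abs_prod, e, ← Finset.prod_mul_distrib]
  exact Finset.prod_le_prod (fun i _ => abs_nonneg _) fun i _ => h i (z i)

theorem integrable_gaussHermite (β : Fin n → ℕ) : Integrable (gaussHermite (n := n) β) := by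
  obtain ⟨C, _, h⟩ := exists_abs_gaussHermite_le β
  exact ((integrable_exp_neg_mul_norm_sq (by norm_num)).const_mul C).mono'
    (continuous_gaussHermite β).aestronglyMeasurable (Filter.Eventually.of_forall h)

theorem integrable_norm_mul_gaussHermite (β : Fin n → ℕ) :
    Integrable fun z : EuclideanSpace ℝ (Fin n) => ‖z‖ * |gaussHermite β z| := by
  obtain ⟨C, hC, h⟩ := exists_abs_gaussHermite_le β
  refine ((integrable_exp_neg_mul_norm_sq (b := 1 / 4) (by norm_num)).const_mul
    (C * Real.exp 1)).mono'
    ((continuous_norm.mul (continuous_gaussHermite β).abs).aestronglyMeasurable)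
    (Filter.Eventually.of_forall fun z => ?_)
  rw [Real.norm_of_nonneg (by positivity)]
  have h1 : ‖z‖ * Real.exp (-(1 / 2) * ‖z‖ ^ 2) ≤ Real.exp 1 * Real.exp (-(1 / 4) * ‖z‖ ^ 2) := by
    have h2 : ‖z‖ ≤ Real.exp ‖z‖ := by linarith [Real.add_one_le_exp ‖z‖]
    refine (mul_le_mul_of_nonneg_right h2 (Real.exp_nonneg _)).trans ?_
    rw [← Real.exp_add, ← Real.exp_add]
    refine Real.exp_le_exp.2 ?_
    nlinarith [sq_nonneg (‖z‖ - 2)]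
  calc ‖z‖ * |gaussHermite β z| ≤ ‖z‖ * (C * Real.exp (-(1 / 2) * ‖z‖ ^ 2)) := by
        gcongr; exact h z
    _ = C * (‖z‖ * Real.exp (-(1 / 2) * ‖z‖ ^ 2)) := by ring
    _ ≤ C * (Real.exp 1 * Real.exp (-(1 / 4) * ‖z‖ ^ 2)) := by gcongr
    _ = _ := by ring

/-- The test functions: smooth and compactly supported. -/
def IsTest (φ : EuclideanSpace ℝ (Fin n) → ℝ) : Prop :=
  ContDiff ℝ ∞ φ ∧ HasCompactSupport φ

namespace IsTest

variable {φ : EuclideanSpace ℝ (Fin n) → ℝ}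

theorem continuous (h : IsTest φ) : Continuous φ := h.1.continuous

theorem exists_bound (h : IsTest φ) : ∃ C, 0 ≤ C ∧ ∀ x, |φ x| ≤ C := by
  obtain ⟨C, hC⟩ := h.2.exists_bound_of_continuous h.continuous
  exact ⟨C, (norm_nonneg _).trans (hC 0), hC⟩

theorem delta (h : IsTest φ) (i : Fin n) : IsTest (delta i φ) := by
  refine ⟨?_, ?_⟩
  · exact contDiff_const.mul
      ((h.1.fderiv_right (m := ∞) (by simp)).clm_apply contDiff_const)
  · exact (h.2.fderiv_apply (𝕜 := ℝ) (EuclideanSpace.single i 1)).mul_left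

theorem delta_iterate (h : IsTest φ) (i : Fin n) (k : ℕ) :
    IsTest ((GaussianHardy.delta i)^[k] φ) := by
  induction k with
  | zero => exact h
  | succ k ih =>
    rw [Function.iterate_succ_apply']
    exact ih.delta i

theorem foldr_delta (h : IsTest φ) (α : Fin n → ℕ) (l : List (Fin n)) :
    IsTest (l.foldr (fun i ψ => (GaussianHardy.delta i)^[α i] ψ) φ) := by
  induction l with
  | nil => exact h
  | cons i l ih => exact ih.delta_iterate i _

theorem deltaPow (h : IsTest φ) (α : Fin n → ℕ) : IsTest (deltaPow α φ) :=
  h.foldr_delta α _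

end IsTest

theorem integrable_gaussHermite_mul (β : Fin n → ℕ) {ψ : EuclideanSpace ℝ (Fin n) → ℝ}
    (hψ : Continuous ψ) {C : ℝ} (hC : ∀ x, |ψ x| ≤ C) :
    Integrable fun z => gaussHermite β z * ψ z :=
  (integrable_gaussHermite β).mul_bdd hψ.aestronglyMeasurable (Filter.Eventually.of_forall hC)

/-- Integration by parts: `G_{β+e_i}` is a multiple of `∂_i G_β`, and each derivative falling on
`φ(b + σ z)` costs a factor `σ⁻¹`. -/
theorem integral_gaussHermite_mul_delta (β : Fin n → ℕ) (i : Fin n)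
    {φ : EuclideanSpace ℝ (Fin n) → ℝ} (hφ : IsTest φ) (b : EuclideanSpace ℝ (Fin n)) {σ : ℝ}
    (hσ : σ ≠ 0) :
    ∫ z, gaussHermite β z * delta i φ (b + σ • z) =
      σ⁻¹ * ∫ z, gaussHermite (β + Pi.single i 1) z * φ (b + σ • z) := by
  have h2 : √2 ≠ (0 : ℝ) := by positivity
  obtain ⟨C, _, hC⟩ := hφ.exists_bound
  obtain ⟨D, _, hD⟩ := (hφ.delta i).exists_bound
  have hder : ∀ z, HasFDerivAt (fun z => φ (b + σ • z))
      ((fderiv ℝ φ (b + σ • z)).comp (σ • ContinuousLinearMap.id ℝ _)) z := fun z =>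
    ((hφ.1.differentiable (by simp)) _).hasFDerivAt.comp z
      (((hasFDerivAt_id z).const_smul σ).const_add b)
  have hcont : Continuous fun z : EuclideanSpace ℝ (Fin n) => b + σ • z := by fun_prop
  have e : ∀ z, fderiv ℝ (fun z => φ (b + σ • z)) z (EuclideanSpace.single i 1) =
      (√2 * σ) * delta i φ (b + σ • z) := by
    intro z
    rw [(hder z).fderiv, delta]
    simp
    field_simp
  have ibp := integral_mul_fderiv_eq_neg_fderiv_mul_of_integrable (𝕜 := ℝ)
    (μ := (volume : Measure (EuclideanSpace ℝ (Fin n)))) (f := gaussHermite β)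
    (g := fun z => φ (b + σ • z)) (v := EuclideanSpace.single i 1) ?_ ?_ ?_ ?_ ?_
  · simp_rw [e, fderiv_gaussHermite_single] at ibp
    have e1 : ∀ z, gaussHermite β z * (√2 * σ * delta i φ (b + σ • z)) =
        (√2 * σ) * (gaussHermite β z * delta i φ (b + σ • z)) := fun z => by ring
    have e2 : ∀ z, -√2 * gaussHermite (β + Pi.single i 1) z * φ (b + σ • z) =
        -√2 * (gaussHermite (β + Pi.single i 1) z * φ (b + σ • z)) := fun z => by ring
    simp_rw [e1, e2] at ibp
    rw [integral_const_mul, integral_const_mul] at ibp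
    field_simp
    apply mul_left_cancel₀ h2
    linarith
  · simp_rw [fderiv_gaussHermite_single, mul_assoc]
    exact (integrable_gaussHermite_mul _ (hφ.continuous.comp hcont) fun x => hC _).const_mul _
  · simp_rw [e]
    have := (integrable_gaussHermite_mul β ((hφ.delta i).continuous.comp hcont)
      fun x => hD _).const_mul (√2 * σ)
    refine this.congr (Filter.Eventually.of_forall fun z => ?_)
    simp only [Function.comp]
    ring
  · exact integrable_gaussHermite_mul _ (hφ.continuous.comp hcont) fun x => hC _
  · exact fun z _ => (hasFDerivAt_gaussHermite β z).differentiableAt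
  · exact fun z _ => (hder z).differentiableAt

theorem integral_gaussHermite_mul_delta_iterate (β : Fin n → ℕ) (i : Fin n)
    {φ : EuclideanSpace ℝ (Fin n) → ℝ} (hφ : IsTest φ) (b : EuclideanSpace ℝ (Fin n)) {σ : ℝ}
    (hσ : σ ≠ 0) (k : ℕ) :
    ∫ z, gaussHermite β z * (delta i)^[k] φ (b + σ • z) =
      σ⁻¹ ^ k * ∫ z, gaussHermite (β + Pi.single i k) z * φ (b + σ • z) := by
  induction k generalizing β with
  | zero => simp
  | succ k ih =>
    rw [Function.iterate_succ_apply',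
      integral_gaussHermite_mul_delta β i (hφ.delta_iterate i k) b hσ, ih, ← mul_assoc,
      ← pow_succ', add_assoc, ← Pi.single_add, add_comm 1 k]

theorem integral_gaussHermite_mul_foldr (β α : Fin n → ℕ)
    {φ : EuclideanSpace ℝ (Fin n) → ℝ} (hφ : IsTest φ) (b : EuclideanSpace ℝ (Fin n)) {σ : ℝ}
    (hσ : σ ≠ 0) (l : List (Fin n)) :
    ∫ z, gaussHermite β z * l.foldr (fun i ψ => (delta i)^[α i] ψ) φ (b + σ • z) =
      σ⁻¹ ^ (l.map α).sum *
        ∫ z, gaussHermite (β + (l.map fun i => Pi.single i (α i)).sum) z * φ (b + σ • z) := by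
  induction l generalizing β with
  | nil => simp
  | cons i l ih =>
    rw [List.foldr_cons, integral_gaussHermite_mul_delta_iterate β i (hφ.foldr_delta α l) b hσ, ih]
    simp only [List.map_cons, List.sum_cons]
    rw [← mul_assoc, ← pow_add, add_assoc]

/-- Repeated integration by parts against a Hermite function, in all affine coordinates. -/
theorem integral_gaussHermite_mul_deltaPow (β α : Fin n → ℕ)
    {φ : EuclideanSpace ℝ (Fin n) → ℝ} (hφ : IsTest φ) (b : EuclideanSpace ℝ (Fin n)) {σ : ℝ}
    (hσ : σ ≠ 0) :
    ∫ z, gaussHermite β z * deltaPow α φ (b + σ • z) =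
      σ⁻¹ ^ (∑ i, α i) * ∫ z, gaussHermite (β + α) z * φ (b + σ • z) := by
  have h := integral_gaussHermite_mul_foldr β α hφ b hσ (List.finRange n)
  have h1 : ((List.finRange n).map α).sum = ∑ i, α i := by
    rw [← List.ofFn_eq_map, List.sum_ofFn]
  have h2 : ((List.finRange n).map fun i => (Pi.single i (α i) : Fin n → ℕ)).sum = α := by
    rw [← List.ofFn_eq_map, List.sum_ofFn]
    exact Finset.univ_sum_single α
  rw [h1, h2] at h
  exact h

end GaussianHardy

/-! ### The Ornstein-Uhlenbeck semigroup -/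

namespace GaussianHardy

variable {n : ℕ}

/-- For `r² + σ² = 1`, the orthogonal reflection `(y, z) ↦ (r y + σ z, σ y - r z)`. -/
def rotation (n : ℕ) (r σ : ℝ) :
    (EuclideanSpace ℝ (Fin n) × EuclideanSpace ℝ (Fin n)) →ₗ[ℝ]
      (EuclideanSpace ℝ (Fin n) × EuclideanSpace ℝ (Fin n)) where
  toFun p := (r • p.1 + σ • p.2, σ • p.1 - r • p.2)
  map_add' p q := by
    ext <;> simp <;> ring
  map_smul' c p := by
    ext <;> simp <;> ring

theorem rotation_apply (r σ : ℝ) (p : EuclideanSpace ℝ (Fin n) × EuclideanSpace ℝ (Fin n)) :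
    rotation n r σ p = (r • p.1 + σ • p.2, σ • p.1 - r • p.2) := rfl

theorem continuous_rotation (r σ : ℝ) : Continuous (rotation n r σ) := by
  have : (rotation n r σ : _ → _) = fun p => (r • p.1 + σ • p.2, σ • p.1 - r • p.2) := rfl
  rw [this]
  fun_prop

theorem rotation_rotation {r σ : ℝ} (h : r ^ 2 + σ ^ 2 = 1)
    (p : EuclideanSpace ℝ (Fin n) × EuclideanSpace ℝ (Fin n)) :
    rotation n r σ (rotation n r σ p) = p := by
  ext i
  · simp [rotation_apply]
    linear_combination (p.1 i) * h
  · simp [rotation_apply]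
    linear_combination (p.2 i) * h

theorem norm_sq_rotation {r σ : ℝ} (h : r ^ 2 + σ ^ 2 = 1)
    (p : EuclideanSpace ℝ (Fin n) × EuclideanSpace ℝ (Fin n)) :
    ‖(rotation n r σ p).1‖ ^ 2 + ‖(rotation n r σ p).2‖ ^ 2 = ‖p.1‖ ^ 2 + ‖p.2‖ ^ 2 := by
  simp only [rotation_apply]
  rw [norm_add_sq_real, norm_sub_sq_real]
  simp only [norm_smul, mul_pow, Real.norm_eq_abs, sq_abs, inner_smul_left, inner_smul_right]
  simp only [conj_trivial]
  linear_combination (‖p.1‖ ^ 2 + ‖p.2‖ ^ 2) * h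

theorem measurePreserving_rotation_volume {r σ : ℝ} (h : r ^ 2 + σ ^ 2 = 1) :
    MeasurePreserving (rotation n r σ) := by
  have hd : LinearMap.det (rotation n r σ) * LinearMap.det (rotation n r σ) = 1 := by
    rw [← LinearMap.det_comp]
    have : (rotation n r σ) ∘ₗ (rotation n r σ) = LinearMap.id :=
      LinearMap.ext fun p => rotation_rotation h p
    rw [this, LinearMap.det_id]
  have hd0 : LinearMap.det (rotation n r σ) ≠ 0 := left_ne_zero_of_mul_eq_one hd
  have habs : |(LinearMap.det (rotation n r σ))⁻¹| = 1 := by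
    rcases mul_self_eq_one_iff.1 hd with h1 | h1 <;> simp [h1]
  refine ⟨(continuous_rotation r σ).measurable, ?_⟩
  have : (volume : Measure (EuclideanSpace ℝ (Fin n) ×
      EuclideanSpace ℝ (Fin n))).IsAddHaarMeasure := by
    rw [Measure.volume_eq_prod]
    infer_instance
  rw [Measure.map_linearMap_addHaar_eq_smul_addHaar _ hd0, habs]
  simp

/-- The Gaussian measure on `ℝⁿ × ℝⁿ` is rotation invariant. -/
theorem measurePreserving_rotation {r σ : ℝ} (h : r ^ 2 + σ ^ 2 = 1) :
    MeasurePreserving (rotation n r σ) ((gaussMeasure n).prod (gaussMeasure n))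
      ((gaussMeasure n).prod (gaussMeasure n)) := by
  have hm : Measurable (rotation n r σ) := (continuous_rotation r σ).measurable
  refine ⟨hm, ?_⟩
  have hw : Measurable fun x : EuclideanSpace ℝ (Fin n) =>
      ENNReal.ofReal (Real.pi ^ (-(n : ℝ) / 2) * Real.exp (-‖x‖ ^ 2)) := by fun_prop
  ext s hs
  rw [Measure.map_apply hm hs]
  unfold gaussMeasure
  rw [prod_withDensity hw hw, withDensity_apply _ hs, withDensity_apply _ (hm hs),
    ← lintegral_indicator hs, ← lintegral_indicator (hm hs), ← Measure.volume_eq_prod]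
  have hmeas : Measurable (s.indicator fun z : EuclideanSpace ℝ (Fin n) ×
      EuclideanSpace ℝ (Fin n) =>
      ENNReal.ofReal (Real.pi ^ (-(n : ℝ) / 2) * Real.exp (-‖z.1‖ ^ 2)) *
        ENNReal.ofReal (Real.pi ^ (-(n : ℝ) / 2) * Real.exp (-‖z.2‖ ^ 2))) := by
    refine Measurable.indicator ?_ hs
    fun_prop
  rw [← (measurePreserving_rotation_volume h).lintegral_comp hmeas]
  refine lintegral_congr fun p => ?_
  by_cases hp : rotation n r σ p ∈ s
  · rw [Set.indicator_of_mem hp, Set.indicator_of_mem (show p ∈ rotation n r σ ⁻¹' s from hp),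
      ← ENNReal.ofReal_mul (by positivity), ← ENNReal.ofReal_mul (by positivity)]
    congr 1
    have e : ∀ a b : ℝ, Real.pi ^ (-(n : ℝ) / 2) * Real.exp (-a ^ 2) *
        (Real.pi ^ (-(n : ℝ) / 2) * Real.exp (-b ^ 2)) =
        (Real.pi ^ (-(n : ℝ) / 2)) ^ 2 * Real.exp (-(a ^ 2 + b ^ 2)) := by
      intro a b
      rw [neg_add, Real.exp_add]
      ring
    rw [e, e, norm_sq_rotation h]
  · rw [Set.indicator_of_notMem hp, Set.indicator_of_notMem (show p ∉ rotation n r σ ⁻¹' s from hp)]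

theorem integral_hermiteFn_rotate (β : Fin n → ℕ) {r σ : ℝ} (h : r ^ 2 + σ ^ 2 = 1)
    (x : EuclideanSpace ℝ (Fin n)) :
    ∫ w, hermiteFn β (r • x + σ • w) ∂(gaussMeasure n) = r ^ (∑ i, β i) * hermiteFn β x := by
  have hs : √Real.pi ≠ 0 := by positivity
  simp_rw [hermiteFn_eq]
  rw [integral_const_mul]
  have := integral_prod_gaussMeasure (n := n) fun i w =>
    (hermitePoly (β i)).eval (r * x i + σ * w)
  simp only [integral_hermitePoly_rotate h, inv_mul_cancel_left₀ hs, Finset.prod_mul_distrib]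
    at this
  simp only [hermiteProd, PiLp.add_apply, PiLp.smul_apply, smul_eq_mul]
  rw [this, Finset.prod_pow_eq_pow_sum]
  ring

theorem integrable_hermiteFn (β : Fin n → ℕ) : Integrable (hermiteFn β) (gaussMeasure n) :=
  (memLp_hermiteFn_real β).integrable (by norm_num)

/-- The Mehler average `e^{-t𝓛} η (y) = ∫ η(e^{-t} y + √(1 - e^{-2t}) z) dγ(z)`. -/
noncomputable def mehler (η : EuclideanSpace ℝ (Fin n) → ℝ) (t : ℝ)
    (y : EuclideanSpace ℝ (Fin n)) : ℝ :=
  ∫ z, η (Real.exp (-t) • y + √(1 - Real.exp (-t) ^ 2) • z) ∂(gaussMeasure n)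

theorem exp_neg_sq_add_sq {t : ℝ} (ht : 0 ≤ t) :
    Real.exp (-t) ^ 2 + √(1 - Real.exp (-t) ^ 2) ^ 2 = 1 := by
  rw [Real.sq_sqrt]
  · ring
  · have : Real.exp (-t) ≤ 1 := Real.exp_le_one_iff.2 (by linarith)
    nlinarith [Real.exp_pos (-t)]

variable {η : EuclideanSpace ℝ (Fin n) → ℝ}

theorem continuous_mehler (hη : Continuous η) {C : ℝ} (hC : ∀ x, |η x| ≤ C) :
    Continuous fun p : ℝ × EuclideanSpace ℝ (Fin n) => mehler η p.1 p.2 := by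
  unfold mehler
  refine continuous_of_dominated (bound := fun _ => C) (fun p => ?_) (fun p => ?_)
    (integrable_const C) ?_
  · exact Continuous.aestronglyMeasurable (by fun_prop)
  · exact Filter.Eventually.of_forall fun z => hC _
  · exact Filter.Eventually.of_forall fun z => by fun_prop

theorem abs_mehler_le {C : ℝ} (hC : ∀ x, |η x| ≤ C) (t : ℝ) (y : EuclideanSpace ℝ (Fin n)) :
    |mehler η t y| ≤ C := by
  have := norm_integral_le_of_norm_le_const (μ := gaussMeasure n)
    (f := fun z => η (Real.exp (-t) • y + √(1 - Real.exp (-t) ^ 2) • z)) (C := C)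
    (Filter.Eventually.of_forall fun z => hC _)
  rw [probReal_univ, mul_one] at this
  exact this

/-- The Hermite coefficients of `e^{-t𝓛} η`. -/
theorem integral_hermiteFn_mul_mehler (hη : Continuous η) {C : ℝ} (hC : ∀ x, |η x| ≤ C)
    (β : Fin n → ℕ) {t : ℝ} (ht : 0 ≤ t) :
    ∫ y, hermiteFn β y * mehler η t y ∂(gaussMeasure n) =
      Real.exp (-t) ^ (∑ i, β i) * ∫ y, hermiteFn β y * η y ∂(gaussMeasure n) := by
  set r := Real.exp (-t) with hr
  set σ := √(1 - Real.exp (-t) ^ 2) with hσ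
  have h : r ^ 2 + σ ^ 2 = 1 := exp_neg_sq_add_sq ht
  let F : EuclideanSpace ℝ (Fin n) × EuclideanSpace ℝ (Fin n) → ℝ := fun p =>
    hermiteFn β p.1 * η (r • p.1 + σ • p.2)
  have hFi : Integrable F ((gaussMeasure n).prod (gaussMeasure n)) := by
    refine ((integrable_hermiteFn β).comp_fst (gaussMeasure n)).mul_bdd (c := C)
      (Continuous.aestronglyMeasurable (by fun_prop)) (Filter.Eventually.of_forall fun p => hC _)
  have hmp := measurePreserving_rotation (n := n) h
  have hFc : Continuous F := by
    have := continuous_hermiteFn β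
    fun_prop
  have e1 : ∫ y, hermiteFn β y * mehler η t y ∂(gaussMeasure n) =
      ∫ p, F p ∂((gaussMeasure n).prod (gaussMeasure n)) := by
    rw [integral_prod _ hFi]
    refine integral_congr_ae (Filter.Eventually.of_forall fun y => ?_)
    simp only [F, mehler]
    rw [integral_const_mul]
  have e2 : ∫ p, F (rotation n r σ p) ∂((gaussMeasure n).prod (gaussMeasure n)) =
      ∫ p, F p ∂((gaussMeasure n).prod (gaussMeasure n)) := by
    conv_rhs => rw [← hmp.map_eq]
    rw [integral_map hmp.measurable.aemeasurable hFc.aestronglyMeasurable]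
  have e3 : ∀ p : EuclideanSpace ℝ (Fin n) × EuclideanSpace ℝ (Fin n),
      F (rotation n r σ p) = hermiteFn β (r • p.1 + σ • p.2) * η p.1 := by
    intro p
    have : r • (rotation n r σ p).1 + σ • (rotation n r σ p).2 = p.1 :=
      congrArg Prod.fst (rotation_rotation h p)
    simp only [F, this]
    rfl
  have hFi' : Integrable (fun p => F (rotation n r σ p))
      ((gaussMeasure n).prod (gaussMeasure n)) := by
    rw [← hmp.map_eq] at hFi
    exact (integrable_map_measure hFc.aestronglyMeasurable hmp.measurable.aemeasurable).1 hFi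
  rw [e1, ← e2, integral_prod _ hFi', ← integral_const_mul]
  refine integral_congr_ae (Filter.Eventually.of_forall fun y => ?_)
  simp only [e3]
  rw [integral_mul_const, integral_hermiteFn_rotate β h]
  ring

/-! ### The operator `(𝓛 + I)^{-s}` -/

/-- `(𝓛 + I)^{-s} η = Γ(s)⁻¹ ∫_0^∞ t^{s-1} e^{-t} e^{-t𝓛} η dt`, for `s > 0`. -/
noncomputable def resolventPower (s : ℝ) (η : EuclideanSpace ℝ (Fin n) → ℝ)
    (y : EuclideanSpace ℝ (Fin n)) : ℝ :=
  (Real.Gamma s)⁻¹ * ∫ t in Set.Ioi (0 : ℝ), Real.exp (-t) * t ^ (s - 1) * mehler η t y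

theorem integrableOn_mehler {s : ℝ} (hs : 0 < s) (hη : Continuous η) {C : ℝ}
    (hC : ∀ x, |η x| ≤ C) (y : EuclideanSpace ℝ (Fin n)) :
    IntegrableOn (fun t : ℝ => Real.exp (-t) * t ^ (s - 1) * mehler η t y) (Set.Ioi 0) :=
  (Real.GammaIntegral_convergent hs).mul_bdd (c := C)
    (((continuous_mehler hη hC).comp (by fun_prop : Continuous fun t : ℝ =>
      (t, y))).aestronglyMeasurable)
    (Filter.Eventually.of_forall fun t => abs_mehler_le hC t y)

theorem continuous_resolventPower {s : ℝ} (hs : 0 < s) (hη : Continuous η) {C : ℝ}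
    (hC : ∀ x, |η x| ≤ C) : Continuous (resolventPower s η) := by
  unfold resolventPower
  refine continuous_const.mul (continuous_of_dominated
    (bound := fun t => Real.exp (-t) * t ^ (s - 1) * C) (fun y => ?_) (fun y => ?_) ?_ ?_)
  · exact (integrableOn_mehler hs hη hC y).1
  · filter_upwards [ae_restrict_mem measurableSet_Ioi] with t ht
    have : 0 ≤ Real.exp (-t) * t ^ (s - 1) :=
      mul_nonneg (Real.exp_nonneg _) (Real.rpow_nonneg (le_of_lt ht) _)
    rw [norm_mul, Real.norm_of_nonneg this]
    exact mul_le_mul_of_nonneg_left (abs_mehler_le hC t y) this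
  · exact (Real.GammaIntegral_convergent hs).mul_const C
  · refine Filter.Eventually.of_forall fun t => ?_
    exact continuous_const.mul ((continuous_mehler hη hC).comp (by fun_prop :
      Continuous fun y : EuclideanSpace ℝ (Fin n) => (t, y)))

theorem abs_resolventPower_le {s : ℝ} (hs : 0 < s) {C : ℝ}
    (hC : ∀ x, |η x| ≤ C) (y : EuclideanSpace ℝ (Fin n)) : |resolventPower s η y| ≤ C := by
  have hG := Real.Gamma_pos_of_pos hs
  have h : |∫ t in Set.Ioi (0 : ℝ), Real.exp (-t) * t ^ (s - 1) * mehler η t y| ≤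
      ∫ t in Set.Ioi (0 : ℝ), Real.exp (-t) * t ^ (s - 1) * C := by
    rw [← Real.norm_eq_abs]
    refine norm_integral_le_of_norm_le
      (Integrable.mul_const (𝕜 := ℝ) (Real.GammaIntegral_convergent hs) C) ?_
    filter_upwards [ae_restrict_mem measurableSet_Ioi] with t ht
    have : 0 ≤ Real.exp (-t) * t ^ (s - 1) :=
      mul_nonneg (Real.exp_nonneg _) (Real.rpow_nonneg (le_of_lt ht) _)
    rw [norm_mul, Real.norm_of_nonneg this]
    exact mul_le_mul_of_nonneg_left (abs_mehler_le hC t y) this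
  rw [integral_mul_const, ← Real.Gamma_eq_integral hs] at h
  rw [resolventPower, abs_mul, abs_inv, abs_of_pos hG]
  calc (Real.Gamma s)⁻¹ * _ ≤ (Real.Gamma s)⁻¹ * (Real.Gamma s * C) := by gcongr
    _ = C := by field_simp

theorem integral_hermiteFn_mul_resolventPower {s : ℝ} (hs : 0 < s) (hη : Continuous η) {C : ℝ}
    (hC : ∀ x, |η x| ≤ C) (β : Fin n → ℕ) :
    ∫ y, hermiteFn β y * resolventPower s η y ∂(gaussMeasure n) =
      (((∑ i, β i : ℕ) : ℝ) + 1) ^ (-s) * ∫ y, hermiteFn β y * η y ∂(gaussMeasure n) := by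
  have hG := Real.Gamma_pos_of_pos hs
  have hint : Integrable (fun p : EuclideanSpace ℝ (Fin n) × ℝ =>
      hermiteFn β p.1 * (Real.exp (-p.2) * p.2 ^ (s - 1)) * mehler η p.2 p.1)
      ((gaussMeasure n).prod (volume.restrict (Set.Ioi 0))) := by
    refine Integrable.mul_bdd (c := C) ?_ ?_ (Filter.Eventually.of_forall fun p =>
      abs_mehler_le hC _ _)
    · exact (integrable_hermiteFn β).mul_prod (Real.GammaIntegral_convergent hs)
    · exact ((continuous_mehler hη hC).comp (by fun_prop :
        Continuous fun p : EuclideanSpace ℝ (Fin n) × ℝ => (p.2, p.1))).aestronglyMeasurable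
  have e1 : ∀ y, hermiteFn β y * resolventPower s η y =
      (Real.Gamma s)⁻¹ * ∫ t in Set.Ioi (0 : ℝ),
        hermiteFn β y * (Real.exp (-t) * t ^ (s - 1)) * mehler η t y := by
    intro y
    rw [resolventPower]
    simp_rw [mul_assoc (hermiteFn β y)]
    rw [integral_const_mul]
    ring
  simp_rw [e1]
  rw [integral_const_mul, integral_integral_swap hint]
  have e2 : ∀ t ∈ Set.Ioi (0 : ℝ),
      ∫ y, hermiteFn β y * (Real.exp (-t) * t ^ (s - 1)) * mehler η t y ∂(gaussMeasure n) =
      (t ^ (s - 1) * Real.exp (-((((∑ i, β i : ℕ) : ℝ) + 1) * t))) *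
        ∫ y, hermiteFn β y * η y ∂(gaussMeasure n) := by
    intro t ht
    have : ∀ y, hermiteFn β y * (Real.exp (-t) * t ^ (s - 1)) * mehler η t y =
        (Real.exp (-t) * t ^ (s - 1)) * (hermiteFn β y * mehler η t y) := fun y => by ring
    simp_rw [this]
    rw [integral_const_mul, integral_hermiteFn_mul_mehler hη hC β (le_of_lt ht),
      ← Real.exp_nat_mul]
    have e3 : Real.exp (-((((∑ i, β i : ℕ) : ℝ) + 1) * t)) =
        Real.exp (-t) * Real.exp (((∑ i, β i : ℕ) : ℝ) * -t) := by
      rw [← Real.exp_add]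
      congr 1
      ring
    rw [e3]
    ring
  rw [setIntegral_congr_fun measurableSet_Ioi e2, integral_mul_const,
    Real.integral_rpow_mul_exp_neg_mul_Ioi hs (by positivity), Real.rpow_neg (by positivity),
    one_div, Real.inv_rpow (by positivity)]
  field_simp

end GaussianHardy

/-! ### Oscillation of `(𝓛 + I)^{-|α|/2} D^α φ` away from the support of `φ` -/

namespace GaussianHardy

variable {n : ℕ}

theorem exists_norm_fderiv_gaussHermite_le (α : Fin n → ℕ) :
    ∃ C, 0 ≤ C ∧ ∀ z : EuclideanSpace ℝ (Fin n),
      ‖fderiv ℝ (gaussHermite α) z‖ ≤ C * Real.exp (-(1 / 2) * ‖z‖ ^ 2) := by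
  choose C hC h using fun i : Fin n => exists_abs_gaussHermite_le (α + Pi.single i 1)
  refine ⟨∑ i, √2 * C i, Finset.sum_nonneg fun i _ => mul_nonneg (by positivity) (hC i),
    fun z => ?_⟩
  rw [(hasFDerivAt_gaussHermite α z).fderiv, Finset.sum_mul]
  refine norm_sum_le_of_le _ fun i _ => ?_
  rw [norm_smul]
  have h1 : ‖(EuclideanSpace.proj i : EuclideanSpace ℝ (Fin n) →L[ℝ] ℝ)‖ ≤ 1 :=
    ContinuousLinearMap.opNorm_le_bound _ zero_le_one fun x => by
      rw [one_mul]
      exact PiLp.norm_apply_le x i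
  calc _ ≤ ‖-√2 * gaussHermite (α + Pi.single i 1) z‖ * 1 := by gcongr
    _ = √2 * |gaussHermite (α + Pi.single i 1) z| := by
        rw [mul_one, norm_mul, norm_neg, Real.norm_of_nonneg (by positivity), Real.norm_eq_abs]
    _ ≤ √2 * (C i * Real.exp (-(1 / 2) * ‖z‖ ^ 2)) := by gcongr; exact h i z
    _ = _ := by ring

/-- Translation is Lipschitz in `L¹` on Hermite functions. -/
theorem exists_integral_abs_gaussHermite_translate_le (α : Fin n → ℕ) :
    ∃ A, 0 ≤ A ∧ ∀ h : EuclideanSpace ℝ (Fin n),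
      ∫ z, |gaussHermite α (z + h) - gaussHermite α z| ≤ A * ‖h‖ := by
  obtain ⟨C, hC, hb⟩ := exists_norm_fderiv_gaussHermite_le α
  have hi := integrable_gaussHermite α
  have hg := integrable_exp_neg_mul_norm_sq (n := n) (b := 1 / 4) (by norm_num)
  set A₁ := ∫ z : EuclideanSpace ℝ (Fin n), |gaussHermite α z| with hA₁
  set A₂ := ∫ z : EuclideanSpace ℝ (Fin n), Real.exp (-(1 / 4) * ‖z‖ ^ 2) with hA₂
  have p1 : 0 ≤ A₁ := integral_nonneg fun _ => abs_nonneg _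
  have p2 : 0 ≤ A₂ := integral_nonneg fun _ => Real.exp_nonneg _
  refine ⟨2 * A₁ + C * Real.exp (1 / 2) * A₂, by positivity, fun h => ?_⟩
  rcases le_total ‖h‖ 1 with h1 | h1
  · have hpt : ∀ z : EuclideanSpace ℝ (Fin n), |gaussHermite α (z + h) - gaussHermite α z| ≤
        (C * Real.exp (1 / 2) * ‖h‖) * Real.exp (-(1 / 4) * ‖z‖ ^ 2) := by
      intro z
      have := Convex.norm_image_sub_le_of_norm_fderiv_le (𝕜 := ℝ) (f := gaussHermite α)
        (s := Metric.closedBall z ‖h‖) (x := z) (y := z + h)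
        (C := C * (Real.exp (1 / 2) * Real.exp (-(1 / 4) * ‖z‖ ^ 2)))
        (fun w _ => (hasFDerivAt_gaussHermite α w).differentiableAt) (fun w hw => ?_)
        (convex_closedBall _ _) (Metric.mem_closedBall_self (norm_nonneg _)) (by simp)
      · rw [add_sub_cancel_left] at this
        refine this.trans (le_of_eq (by ring))
      · refine (hb w).trans (mul_le_mul_of_nonneg_left ?_ hC)
        rw [← Real.exp_add]
        refine Real.exp_le_exp.2 ?_
        have h3 : ‖z‖ ≤ ‖w‖ + 1 := by
          have h4 : ‖w - z‖ ≤ 1 := (mem_closedBall_iff_norm.1 hw).trans h1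
          have h5 := norm_sub_norm_le z w
          rw [norm_sub_rev] at h5
          linarith
        nlinarith [sq_nonneg (‖w‖ - 1), norm_nonneg z, norm_nonneg w]
    calc _ ≤ ∫ z : EuclideanSpace ℝ (Fin n),
            (C * Real.exp (1 / 2) * ‖h‖) * Real.exp (-(1 / 4) * ‖z‖ ^ 2) :=
          integral_mono_of_nonneg (Filter.Eventually.of_forall fun _ => abs_nonneg _)
            (hg.const_mul _) (Filter.Eventually.of_forall hpt)
      _ = (C * Real.exp (1 / 2) * A₂) * ‖h‖ := by rw [integral_const_mul]; ring
      _ ≤ _ := by gcongr; linarith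
  · have e : ∫ z, |gaussHermite α (z + h)| = A₁ :=
      integral_add_right_eq_self (fun z => |gaussHermite α z|) h
    have hi' : Integrable fun z => gaussHermite α (z + h) := hi.comp_add_right h
    calc _ ≤ ∫ z, (|gaussHermite α (z + h)| + |gaussHermite α z|) :=
          integral_mono_of_nonneg (Filter.Eventually.of_forall fun _ => abs_nonneg _)
            (hi'.abs.add hi.abs) (Filter.Eventually.of_forall fun z => abs_sub _ _)
      _ = 2 * A₁ := by rw [integral_add hi'.abs hi.abs, e]; ring
      _ ≤ (2 * A₁) * ‖h‖ := le_mul_of_one_le_right (by positivity) h1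
      _ ≤ _ := by gcongr; linarith [show 0 ≤ C * Real.exp (1 / 2) * A₂ by positivity]

theorem one_sub_exp_sq_pos {t : ℝ} (ht : 0 < t) : 0 < √(1 - Real.exp (-t) ^ 2) := by
  refine Real.sqrt_pos.2 ?_
  have : Real.exp (-t) < 1 := Real.exp_lt_one_iff.2 (by linarith)
  nlinarith [Real.exp_pos (-t)]

theorem exp_neg_sq (t : ℝ) : Real.exp (-t) ^ 2 = Real.exp (-(2 * t)) := by
  rw [← Real.exp_nat_mul]
  congr 1
  push_cast
  ring

theorem exp_neg_sq_mul_le (t : ℝ) : Real.exp (-t) ^ 2 * (1 + 2 * t) ≤ 1 := by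
  rw [exp_neg_sq, Real.exp_neg, inv_mul_le_one₀ (Real.exp_pos _)]
  linarith [Real.add_one_le_exp (2 * t)]

theorem one_sub_exp_sq_le {t : ℝ} : √(1 - Real.exp (-t) ^ 2) ≤ √(2 * t) := by
  refine Real.sqrt_le_sqrt ?_
  rw [exp_neg_sq]
  linarith [Real.add_one_le_exp (-(2 * t))]

theorem exp_div_one_sub_exp_sq_le {t : ℝ} (ht : 0 < t) :
    Real.exp (-t) / √(1 - Real.exp (-t) ^ 2) ≤ 1 / √(2 * t) := by
  rw [div_le_div_iff₀ (one_sub_exp_sq_pos ht) (by positivity), one_mul]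
  refine Real.le_sqrt_of_sq_le ?_
  rw [mul_pow, Real.sq_sqrt (by positivity)]
  linarith [exp_neg_sq_mul_le t]

/-- Mehler averages of derivatives, after integration by parts. -/
theorem mehler_deltaPow (α : Fin n → ℕ) {φ : EuclideanSpace ℝ (Fin n) → ℝ} (hφ : IsTest φ)
    {t : ℝ} (ht : 0 < t) (y : EuclideanSpace ℝ (Fin n)) :
    mehler (deltaPow α φ) t y = Real.pi ^ (-(n : ℝ) / 2) *
      ((√(1 - Real.exp (-t) ^ 2))⁻¹ ^ (∑ i, α i) *
        ∫ z, gaussHermite α z * φ (Real.exp (-t) • y + √(1 - Real.exp (-t) ^ 2) • z)) := by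
  have h := integral_gaussHermite_mul_deltaPow 0 α hφ (Real.exp (-t) • y)
    (one_sub_exp_sq_pos ht).ne'
  rw [zero_add] at h
  rw [← h, mehler, integral_gaussMeasure, ← integral_const_mul]
  refine integral_congr_ae (Filter.Eventually.of_forall fun z => ?_)
  simp only [gaussHermite, hermiteProd, Pi.zero_apply, hermitePoly_zero, Polynomial.eval_one,
    Finset.prod_const_one, one_mul, smul_eq_mul, mul_assoc]

/-- For short times the Mehler kernel at distance `R` is controlled by its first moment. The
drift `(1 - e^{-t}) |y|` is harmless because `R (1 + |c|) ≤ κ`. -/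
theorem abs_integral_gaussHermite_mul_le_of_small (α : Fin n → ℕ) {κ R t : ℝ}
    {c y : EuclideanSpace ℝ (Fin n)} {φ : EuclideanSpace ℝ (Fin n) → ℝ} (hR : 0 < R)
    (hRc : R * (1 + ‖c‖) ≤ κ) (hφ1 : ∀ x, |φ x| ≤ 1)
    (hφ0 : ∀ x, ‖x - c‖ < 2 * R → φ x = 0) (hy : ‖y - c‖ ≤ R) (ht : 0 < t)
    (htR : t ≤ R ^ 2 / (2 * (κ + κ ^ 2))) :
    |∫ z, gaussHermite α z * φ (Real.exp (-t) • y + √(1 - Real.exp (-t) ^ 2) • z)| ≤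
      (2 * √(1 - Real.exp (-t) ^ 2) / R) * ∫ z : EuclideanSpace ℝ (Fin n),
        ‖z‖ * |gaussHermite α z| := by
  set r := Real.exp (-t) with hr
  set σ := √(1 - Real.exp (-t) ^ 2) with hσ
  have hσ0 : 0 < σ := one_sub_exp_sq_pos ht
  have hRκ : R ≤ κ := by nlinarith [norm_nonneg c]
  have hκ : 0 < κ := hR.trans_le hRκ
  have hr1 : r ≤ 1 := Real.exp_le_one_iff.2 (by linarith)
  have hrt : 1 - r ≤ t := by linarith [Real.add_one_le_exp (-t)]
  have hyn : ‖y‖ ≤ ‖c‖ + R := by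
    have := norm_sub_norm_le y c
    linarith
  have hdrift : (1 - r) * ‖y‖ ≤ R / 2 := by
    calc (1 - r) * ‖y‖ ≤ t * ‖y‖ := by gcongr
      _ ≤ R ^ 2 / (2 * (κ + κ ^ 2)) * (‖c‖ + R) := by gcongr
      _ = R * (R * (‖c‖ + R)) / (2 * (κ + κ ^ 2)) := by ring
      _ ≤ R * (κ + κ ^ 2) / (2 * (κ + κ ^ 2)) := by
          gcongr
          nlinarith
      _ = R / 2 := by field_simp
  have hpt : ∀ z, ‖gaussHermite α z * φ (r • y + σ • z)‖ ≤
      (2 * σ / R) * (‖z‖ * |gaussHermite α z|) := by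
    intro z
    rw [norm_mul, Real.norm_eq_abs, Real.norm_eq_abs]
    by_cases hz : φ (r • y + σ • z) = 0
    · rw [hz, abs_zero, mul_zero]
      positivity
    · have h1 : 2 * R ≤ ‖r • y + σ • z - c‖ := not_lt.1 fun h => hz (hφ0 _ h)
      have h2 : r • y + σ • z - c = (y - c) + (-((1 - r) • y) + σ • z) := by
        rw [sub_smul, one_smul]
        abel
      have h3 : ‖r • y + σ • z - c‖ ≤ R + ((1 - r) * ‖y‖ + σ * ‖z‖) := by
        rw [h2]
        refine (norm_add_le _ _).trans (add_le_add hy ((norm_add_le _ _).trans ?_))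
        rw [norm_neg, norm_smul, norm_smul, Real.norm_of_nonneg (by linarith),
          Real.norm_of_nonneg hσ0.le]
      have h4 : 1 ≤ 2 * σ / R * ‖z‖ := by
        rw [div_mul_eq_mul_div, le_div_iff₀ hR]
        linarith
      calc |gaussHermite α z| * |φ (r • y + σ • z)| ≤ |gaussHermite α z| * (2 * σ / R * ‖z‖) := by
            gcongr
            exact (hφ1 _).trans h4
        _ = _ := by ring
  have := norm_integral_le_of_norm_le ((integrable_norm_mul_gaussHermite α).const_mul (2 * σ / R))
    (Filter.Eventually.of_forall hpt)
  rwa [integral_const_mul, Real.norm_eq_abs] at this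

/-- For long times the difference of Mehler kernels is a translation. -/
theorem abs_integral_gaussHermite_mul_sub_le {α : Fin n → ℕ} {A : ℝ}
    (hA : ∀ h : EuclideanSpace ℝ (Fin n),
      ∫ z, |gaussHermite α (z + h) - gaussHermite α z| ≤ A * ‖h‖)
    {φ : EuclideanSpace ℝ (Fin n) → ℝ} (hφ : Continuous φ) (hφ1 : ∀ x, |φ x| ≤ 1)
    {r σ : ℝ} (hr : 0 < r) (hσ : 0 < σ) (y c : EuclideanSpace ℝ (Fin n)) :
    |(∫ z, gaussHermite α z * φ (r • y + σ • z)) - ∫ z, gaussHermite α z * φ (r • c + σ • z)| ≤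
      A * (r / σ * ‖y - c‖) := by
  set h : EuclideanSpace ℝ (Fin n) := (r / σ) • (c - y) with hh
  have hi : ∀ b, Integrable fun z => gaussHermite α z * φ (b + σ • z) := fun b =>
    integrable_gaussHermite_mul α (ψ := fun z => φ (b + σ • z)) (by fun_prop) fun _ => hφ1 _
  have e : ∀ z, r • y + σ • (z + h) = r • c + σ • z := by
    intro z
    rw [hh, smul_add, smul_smul, mul_div_cancel₀ _ hσ.ne', smul_sub]
    abel
  have e1 : ∫ z, gaussHermite α z * φ (r • y + σ • z) =
      ∫ z, gaussHermite α (z + h) * φ (r • c + σ • z) := by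
    rw [← integral_add_right_eq_self _ h]
    simp_rw [e]
  have hi1 : Integrable fun z => gaussHermite α (z + h) * φ (r • c + σ • z) := by
    have := (hi (r • y)).comp_add_right h
    simpa only [e] using this
  rw [e1, ← integral_sub hi1 (hi _)]
  have hd : Integrable fun z => |gaussHermite α (z + h) - gaussHermite α z| :=
    (((integrable_gaussHermite α).comp_add_right h).sub (integrable_gaussHermite α)).abs
  have := norm_integral_le_of_norm_le (f := fun z => gaussHermite α (z + h) * φ (r • c + σ • z) -
    gaussHermite α z * φ (r • c + σ • z)) hd (Filter.Eventually.of_forall fun z => by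
      rw [← sub_mul, norm_mul, Real.norm_eq_abs, Real.norm_eq_abs]
      exact mul_le_of_le_one_right (abs_nonneg _) (hφ1 _))
  rw [Real.norm_eq_abs] at this
  refine this.trans ((hA h).trans ?_)
  rw [hh, norm_smul, Real.norm_of_nonneg (by positivity), norm_sub_rev]

/-- The factor `e^{-t} t^{m/2-1} (1 - e^{-2t})^{-m/2}` is at most a multiple of `1/t`. -/
theorem exists_exp_mul_rpow_mul_le {m : ℕ} (hm : m ≠ 0) :
    ∃ A, 0 ≤ A ∧ ∀ t : ℝ, 0 < t →
      Real.exp (-t) * t ^ ((m : ℝ) / 2 - 1) * (√(1 - Real.exp (-t) ^ 2))⁻¹ ^ m ≤ A * t⁻¹ := by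
  set s : ℝ := (m : ℝ) / 2 with hs
  have hs0 : 0 < s := by positivity
  refine ⟨s ^ s * Real.exp (1 / 2), by positivity, fun t ht => ?_⟩
  set σ := √(1 - Real.exp (-t) ^ 2) with hσ
  have hσ0 : 0 < σ := one_sub_exp_sq_pos ht
  have h1 : σ⁻¹ ^ 2 ≤ (1 / 2 + t) * t⁻¹ := by
    have h2 : σ ^ 2 = 1 - Real.exp (-t) ^ 2 := by
      have := exp_neg_sq_add_sq ht.le
      linarith
    rw [inv_pow, inv_le_iff_one_le_mul₀ (by positivity), h2]
    have h3 := exp_neg_sq_mul_le t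
    have h4 : 1 ≤ ((1 / 2 + t) * (1 - Real.exp (-t) ^ 2)) * t⁻¹ := by
      rw [← div_eq_mul_inv, le_div_iff₀ ht]
      linarith
    linarith
  have h5 : σ⁻¹ ^ m = (σ⁻¹ ^ 2) ^ s := by
    rw [← Real.rpow_natCast (σ⁻¹) 2, ← Real.rpow_mul (by positivity), ← Real.rpow_natCast]
    congr 1
    rw [hs]
    push_cast
    ring
  have h6 : σ⁻¹ ^ m ≤ (1 / 2 + t) ^ s * t ^ (-s) := by
    rw [h5, Real.rpow_neg ht.le, ← Real.inv_rpow ht.le, ← Real.mul_rpow (by positivity)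
      (by positivity)]
    exact Real.rpow_le_rpow (by positivity) h1 hs0.le
  have h7 : (1 / 2 + t) ^ s ≤ s ^ s * Real.exp (1 / 2 + t) := by
    have h8 : (1 / 2 + t) / s ≤ Real.exp ((1 / 2 + t) / s) := by
      linarith [Real.add_one_le_exp ((1 / 2 + t) / s)]
    have h9 : 1 / 2 + t ≤ s * Real.exp ((1 / 2 + t) / s) := by
      rw [div_le_iff₀ hs0] at h8
      linarith
    calc (1 / 2 + t) ^ s ≤ (s * Real.exp ((1 / 2 + t) / s)) ^ s :=
          Real.rpow_le_rpow (by positivity) h9 hs0.le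
      _ = s ^ s * Real.exp (1 / 2 + t) := by
          rw [Real.mul_rpow hs0.le (Real.exp_nonneg _), ← Real.exp_mul,
            div_mul_cancel₀ _ hs0.ne']
  calc Real.exp (-t) * t ^ (s - 1) * σ⁻¹ ^ m
      ≤ Real.exp (-t) * t ^ (s - 1) * ((s ^ s * Real.exp (1 / 2 + t)) * t ^ (-s)) := by
        gcongr
        exact h6.trans (by gcongr)
    _ = (s ^ s * (Real.exp (-t) * Real.exp (1 / 2 + t))) * (t ^ (s - 1) * t ^ (-s)) := by ring
    _ = _ := by
        rw [← Real.exp_add, ← Real.rpow_add ht, ← Real.rpow_neg_one]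
        congr 2
        · congr 2
          ring
        · ring

theorem rpow_neg_half_mul {t : ℝ} (ht : 0 < t) : t⁻¹ * √(2 * t) = √2 * t ^ (-(1 / 2) : ℝ) := by
  rw [Real.sqrt_mul (by norm_num), Real.sqrt_eq_rpow t, ← Real.rpow_neg_one, mul_left_comm,
    ← Real.rpow_add ht]
  norm_num

theorem rpow_neg_three_halves_mul {t : ℝ} (ht : 0 < t) :
    t⁻¹ * (1 / √(2 * t)) = (√2)⁻¹ * t ^ (-(3 / 2) : ℝ) := by
  rw [Real.sqrt_mul (by norm_num), Real.sqrt_eq_rpow t, one_div, mul_inv, ← Real.rpow_neg ht.le,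
    ← Real.rpow_neg_one, mul_left_comm, ← Real.rpow_add ht]
  norm_num

theorem integral_Ioc_rpow_neg_half {T : ℝ} (hT : 0 < T) :
    IntegrableOn (fun t : ℝ => t ^ (-(1 / 2) : ℝ)) (Set.Ioc 0 T) ∧
      ∫ t in Set.Ioc 0 T, t ^ (-(1 / 2) : ℝ) = 2 * √T := by
  refine ⟨(intervalIntegrable_iff_integrableOn_Ioc_of_le hT.le).1
    (intervalIntegral.intervalIntegrable_rpow' (by norm_num)), ?_⟩
  rw [← intervalIntegral.integral_of_le hT.le, integral_rpow (Or.inl (by norm_num)),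
    Real.sqrt_eq_rpow]
  norm_num
  ring

theorem integral_Ioi_rpow_neg_three_halves {T : ℝ} (hT : 0 < T) :
    IntegrableOn (fun t : ℝ => t ^ (-(3 / 2) : ℝ)) (Set.Ioi T) ∧
      ∫ t in Set.Ioi T, t ^ (-(3 / 2) : ℝ) = 2 * (√T)⁻¹ := by
  refine ⟨integrableOn_Ioi_rpow_of_lt (by norm_num) hT, ?_⟩
  rw [integral_Ioi_rpow_of_lt (by norm_num) hT, Real.sqrt_eq_rpow, ← Real.rpow_neg hT.le]
  norm_num
  ring

/-- If `φ` vanishes near the ball `B(c, R)`, with `R (1 + |c|) ≤ κ`, then the function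
`(𝓛 + I)^{-|α|/2} D^α φ` has bounded oscillation on that ball. -/
theorem exists_abs_resolventPower_sub_le (α : Fin n → ℕ) (hα : ∑ i, α i ≠ 0) {κ : ℝ}
    (hκ : 0 < κ) :
    ∃ K, 0 ≤ K ∧ ∀ (c : EuclideanSpace ℝ (Fin n)) (R : ℝ) (φ : EuclideanSpace ℝ (Fin n) → ℝ),
      0 < R → R * (1 + ‖c‖) ≤ κ → IsTest φ → (∀ x, |φ x| ≤ 1) →
      (∀ x, ‖x - c‖ < 2 * R → φ x = 0) → ∀ y, ‖y - c‖ ≤ R →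
      |resolventPower (((∑ i, α i : ℕ) : ℝ) / 2) (deltaPow α φ) y -
        resolventPower (((∑ i, α i : ℕ) : ℝ) / 2) (deltaPow α φ) c| ≤ K := by
  set m := ∑ i, α i with hm
  set s : ℝ := (m : ℝ) / 2 with hs
  have hs0 : 0 < s := by positivity
  have hG := Real.Gamma_pos_of_pos hs0
  obtain ⟨A₂, hA₂, htr⟩ := exists_integral_abs_gaussHermite_translate_le α
  obtain ⟨A₃, hA₃, hexp⟩ := exists_exp_mul_rpow_mul_le hα
  set A₁ := ∫ z : EuclideanSpace ℝ (Fin n), ‖z‖ * |gaussHermite α z| with hA₁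
  have p1 : 0 ≤ A₁ := integral_nonneg fun z => by positivity
  set P : ℝ := Real.pi ^ (-(n : ℝ) / 2) with hP
  have hP0 : 0 < P := by positivity
  set q : ℝ := √(2 * (κ + κ ^ 2)) with hq
  have hq0 : 0 < q := by positivity
  set K₁ : ℝ := A₃ * P * 4 * A₁ * √2 with hK₁
  set K₂ : ℝ := A₃ * P * A₂ * (√2)⁻¹ with hK₂
  refine ⟨(Real.Gamma s)⁻¹ * (K₁ * 2 / q + K₂ * 2 * q), by positivity, ?_⟩
  intro c R φ hR hRc hφ hφ1 hφ0 y hy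
  -- up to time `T` the moment bound is integrable at `0`, afterwards the translation bound is
  -- integrable at `∞`
  set T : ℝ := R ^ 2 / (2 * (κ + κ ^ 2)) with hT
  have hT0 : 0 < T := by positivity
  have hsT : √T = R / q := by
    rw [hT, hq, Real.sqrt_div (by positivity), Real.sqrt_sq hR.le]
  obtain ⟨D, _, hD⟩ := (hφ.deltaPow α).exists_bound
  have hηc := (hφ.deltaPow α).continuous
  set F : ℝ → ℝ := fun t => Real.exp (-t) * t ^ (s - 1) * mehler (deltaPow α φ) t y -
    Real.exp (-t) * t ^ (s - 1) * mehler (deltaPow α φ) t c with hF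
  have hFi : IntegrableOn F (Set.Ioi 0) :=
    (integrableOn_mehler hs0 hηc hD y).sub (integrableOn_mehler hs0 hηc hD c)
  have eF : ∀ t, 0 < t → |F t| = (Real.exp (-t) * t ^ (s - 1) *
      (√(1 - Real.exp (-t) ^ 2))⁻¹ ^ m) * (P *
      |(∫ z, gaussHermite α z * φ (Real.exp (-t) • y + √(1 - Real.exp (-t) ^ 2) • z)) -
        ∫ z, gaussHermite α z * φ (Real.exp (-t) • c + √(1 - Real.exp (-t) ^ 2) • z)|) := by
    intro t ht
    have hσ := one_sub_exp_sq_pos ht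
    rw [hF]
    simp only
    have e0 : ∀ E σ' I J : ℝ, E * (P * (σ' * I)) - E * (P * (σ' * J)) = E * σ' * (P * (I - J)) := by
      intros; ring
    rw [mehler_deltaPow α hφ ht, mehler_deltaPow α hφ ht, e0, abs_mul, abs_mul P, abs_of_pos hP0,
      abs_of_nonneg (by positivity)]
  have near : ∀ t ∈ Set.Ioc 0 T, ‖F t‖ ≤ K₁ / R * t ^ (-(1 / 2) : ℝ) := by
    intro t ht
    have h1 := abs_integral_gaussHermite_mul_le_of_small α hR hRc hφ1 hφ0 hy ht.1 ht.2
    have h2 := abs_integral_gaussHermite_mul_le_of_small α hR hRc hφ1 hφ0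
      (y := c) (by simpa using hR.le) ht.1 ht.2
    rw [← hA₁] at h1 h2
    have h3 := one_sub_exp_sq_le (t := t)
    rw [Real.norm_eq_abs, eF t ht.1]
    have hσ := one_sub_exp_sq_pos ht.1
    have ht0 := ht.1
    calc _ ≤ (A₃ * t⁻¹) * (P * (2 * (2 * √(2 * t) / R * A₁))) := by
          refine mul_le_mul (hexp t ht.1) (mul_le_mul_of_nonneg_left ?_ hP0.le) (by positivity)
            (by positivity)
          refine (abs_sub _ _).trans ((add_le_add h1 h2).trans ?_)
          rw [← two_mul]
          gcongr
      _ = A₃ * P * 4 * A₁ / R * (t⁻¹ * √(2 * t)) := by ring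
      _ = _ := by rw [rpow_neg_half_mul ht.1, hK₁]; ring
  have far : ∀ t ∈ Set.Ioi T, ‖F t‖ ≤ K₂ * R * t ^ (-(3 / 2) : ℝ) := by
    intro t ht
    have ht0 : 0 < t := hT0.trans ht
    have hσ := one_sub_exp_sq_pos ht0
    have h1 := abs_integral_gaussHermite_mul_sub_le htr hφ.continuous hφ1
      (Real.exp_pos (-t)) hσ y c
    rw [Real.norm_eq_abs, eF t ht0]
    calc _ ≤ (A₃ * t⁻¹) * (P * (A₂ * (1 / √(2 * t) * R))) := by
          refine mul_le_mul (hexp t ht0) (mul_le_mul_of_nonneg_left ?_ hP0.le) (by positivity)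
            (by positivity)
          exact h1.trans (mul_le_mul_of_nonneg_left (mul_le_mul (exp_div_one_sub_exp_sq_le ht0) hy
            (norm_nonneg _) (by positivity)) hA₂)
      _ = A₃ * P * A₂ * R * (t⁻¹ * (1 / √(2 * t))) := by ring
      _ = _ := by rw [rpow_neg_three_halves_mul ht0, hK₂]; ring
  have hsplit : ∫ t in Set.Ioi (0 : ℝ), F t =
      (∫ t in Set.Ioc 0 T, F t) + ∫ t in Set.Ioi T, F t := by
    rw [← setIntegral_union (Set.Ioc_disjoint_Ioi le_rfl) measurableSet_Ioi
      (hFi.mono_set Set.Ioc_subset_Ioi_self) (hFi.mono_set (Set.Ioi_subset_Ioi hT0.le)),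
      Set.Ioc_union_Ioi_eq_Ioi hT0.le]
  have b1 : |∫ t in Set.Ioc 0 T, F t| ≤ K₁ / R * (2 * √T) := by
    rw [← (integral_Ioc_rpow_neg_half hT0).2, ← integral_const_mul]
    exact norm_integral_le_of_norm_le (Integrable.const_mul (integral_Ioc_rpow_neg_half hT0).1 _)
      ((ae_restrict_mem measurableSet_Ioc).mono near)
  have b2 : |∫ t in Set.Ioi T, F t| ≤ K₂ * R * (2 * (√T)⁻¹) := by
    rw [← (integral_Ioi_rpow_neg_three_halves hT0).2, ← integral_const_mul]
    exact norm_integral_le_of_norm_le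
      (Integrable.const_mul (integral_Ioi_rpow_neg_three_halves hT0).1 _)
      ((ae_restrict_mem measurableSet_Ioi).mono far)
  have efin : resolventPower s (deltaPow α φ) y - resolventPower s (deltaPow α φ) c =
      (Real.Gamma s)⁻¹ * ∫ t in Set.Ioi (0 : ℝ), F t := by
    rw [resolventPower, resolventPower, ← mul_sub, hF, integral_sub
      (integrableOn_mehler hs0 hηc hD y) (integrableOn_mehler hs0 hηc hD c)]
  rw [efin, abs_mul, abs_of_pos (inv_pos.2 hG), hsplit]
  gcongr
  refine (abs_add_le _ _).trans (add_le_add (b1.trans (le_of_eq ?_)) (b2.trans (le_of_eq ?_)))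
  · rw [hsT]
    field_simp
  · rw [hsT]
    field_simp

end GaussianHardy

/-! ### The Riesz transform on `L²(γ)` -/

namespace GaussianHardy

variable {n : ℕ}

theorem memLp_ofReal {ψ : EuclideanSpace ℝ (Fin n) → ℝ} (hψ : Continuous ψ) {C : ℝ}
    (hC : ∀ x, |ψ x| ≤ C) (p : ℝ≥0∞) :
    MemLp (fun x => (ψ x : ℂ)) p (gaussMeasure n) :=
  MemLp.of_bound (Complex.continuous_ofReal.comp hψ).aestronglyMeasurable C
    (Filter.Eventually.of_forall fun x => by simpa using hC x)

theorem inner_toLp_ofReal {ψ : EuclideanSpace ℝ (Fin n) → ℝ}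
    (h : MemLp (fun x => (ψ x : ℂ)) 2 (gaussMeasure n)) (f : Lp ℂ 2 (gaussMeasure n)) :
    (inner ℂ (h.toLp _) f : ℂ) = ∫ x, f x * (ψ x : ℂ) ∂(gaussMeasure n) := by
  rw [L2.inner_def]
  refine integral_congr_ae ?_
  filter_upwards [h.coeFn_toLp] with x hx
  rw [hx]
  simp

theorem inner_toLp_hermiteL2 {ψ : EuclideanSpace ℝ (Fin n) → ℝ}
    (h : MemLp (fun x => (ψ x : ℂ)) 2 (gaussMeasure n)) (β : Fin n → ℕ) :
    (inner ℂ (h.toLp _) (hermiteL2 β) : ℂ) =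
      ((∫ x, hermiteFn β x * ψ x ∂(gaussMeasure n) : ℝ) : ℂ) := by
  rw [inner_toLp_ofReal, ← integral_complex_ofReal]
  refine integral_congr_ae ?_
  filter_upwards [coeFn_hermiteL2 β] with x hx
  rw [hx]
  simp

/-- The Riesz-Fischer theorem for an orthonormal family, with the norm bound. -/
theorem Orthonormal.exists_hasSum_smul {H : Type*} [NormedAddCommGroup H] [InnerProductSpace ℂ H]
    [CompleteSpace H] {ι : Type*} {v : ι → H} (hv : Orthonormal ℂ v) {a : ι → ℂ} {M : ℝ}
    (hM : 0 ≤ M) (ha : ∀ s : Finset ι, ∑ i ∈ s, ‖a i‖ ^ 2 ≤ M ^ 2) :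
    ∃ g, HasSum (fun i => a i • v i) g ∧ ‖g‖ ≤ M := by
  have hs : Summable fun i => ‖a i‖ ^ 2 := summable_of_sum_le (fun i => by positivity) ha
  have hs' : Summable fun i => a i • v i := by
    simpa [LinearIsometry.toSpanSingleton_apply] using
      (hv.orthogonalFamily.summable_iff_norm_sq_summable a).2 hs
  obtain ⟨g, hg⟩ := hs'
  refine ⟨g, hg, le_of_tendsto hg.norm (Filter.Eventually.of_forall fun s => ?_)⟩
  refine abs_le_of_sq_le_sq' ?_ hM |>.2
  have h1 := hv.inner_sum a a s
  have h2 := @inner_self_eq_norm_sq_to_K ℂ H _ _ _ (∑ i ∈ s, a i • v i)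
  rw [h1] at h2
  have h3 : ∑ i ∈ s, (starRingEnd ℂ) (a i) * a i = ((∑ i ∈ s, ‖a i‖ ^ 2 : ℝ) : ℂ) := by
    push_cast
    exact Finset.sum_congr rfl fun i _ => by rw [mul_comm, Complex.mul_conj']
  rw [h3] at h2
  have h4 : ∑ i ∈ s, ‖a i‖ ^ 2 = ‖∑ i ∈ s, a i • v i‖ ^ 2 := by
    have h5 := congrArg Complex.re h2
    rw [Complex.ofReal_re] at h5
    rw [h5]
    simp [← Complex.ofReal_pow]
  rw [← h4]
  exact ha s

/-- A bounded multiplier along a shift of the Hermite basis. -/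
theorem exists_hasSum_multiplier (α : Fin n → ℕ) {w : (Fin n → ℕ) → ℝ} {K : ℝ} (hK : 0 ≤ K)
    (hw : ∀ β, |w β| ≤ K) (f : Lp ℂ 2 (gaussMeasure n)) :
    ∃ g, HasSum (fun β => ((w β : ℂ) * inner ℂ (hermiteL2 β) f) • hermiteL2 (β + α)) g ∧
      ‖g‖ ≤ K * ‖f‖ := by
  have hv : Orthonormal ℂ fun β : Fin n → ℕ => (hermiteL2 (β + α) : Lp ℂ 2 (gaussMeasure n)) :=
    orthonormal_hermiteL2.comp _ (add_left_injective α)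
  refine Orthonormal.exists_hasSum_smul hv (by positivity) fun s => ?_
  have h := orthonormal_hermiteL2.sum_inner_products_le f (s := s)
  calc ∑ β ∈ s, ‖(w β : ℂ) * inner ℂ (hermiteL2 β) f‖ ^ 2
      ≤ ∑ β ∈ s, K ^ 2 * ‖(inner ℂ (hermiteL2 β) f : ℂ)‖ ^ 2 := by
        refine Finset.sum_le_sum fun β _ => ?_
        rw [norm_mul, mul_pow, Complex.norm_real, Real.norm_eq_abs]
        gcongr
        exact hw β
    _ = K ^ 2 * ∑ β ∈ s, ‖(inner ℂ (hermiteL2 β) f : ℂ)‖ ^ 2 := by rw [Finset.mul_sum]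
    _ ≤ (K * ‖f‖) ^ 2 := by rw [mul_pow]; gcongr

/-- The eigenvalue of `(𝓛 + I)^{-s}` on `h_β`. -/
noncomputable def resolventWeight (s : ℝ) (β : Fin n → ℕ) : ℝ :=
  (((∑ i, β i : ℕ) : ℝ) + 1) ^ (-s)

theorem resolventWeight_nonneg (s : ℝ) (β : Fin n → ℕ) : 0 ≤ resolventWeight s β :=
  Real.rpow_nonneg (by positivity) _

theorem inner_hermiteL2_chaosProj (j : ℕ) (f : Lp ℂ 2 (gaussMeasure n)) (β : Fin n → ℕ) :
    (inner ℂ (hermiteL2 β) (chaosProj j f) : ℂ) =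
      if ∑ i, β i = j then inner ℂ (hermiteL2 β) f else 0 := by
  have h := orthonormal_iff_ite.1 (orthonormal_hermiteL2 (n := n)) β
  rw [chaosProj, inner_sum]
  simp_rw [inner_smul_right, h, mul_ite, mul_one, mul_zero]
  rw [Finset.sum_ite_eq]
  simp [Finset.mem_piAntidiag]

theorem IsResolventPower.inner_hermiteL2 {s : ℝ} {f u : Lp ℂ 2 (gaussMeasure n)}
    (h : IsResolventPower s f u) (β : Fin n → ℕ) :
    (inner ℂ (hermiteL2 β) u : ℂ) = (resolventWeight s β : ℂ) * inner ℂ (hermiteL2 β) f := by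
  have h1 := h.mapL (innerSL ℂ (hermiteL2 β))
  simp only [innerSL_apply_apply, inner_smul_right, inner_hermiteL2_chaosProj] at h1
  have h2 := hasSum_ite_eq (∑ i, β i)
    ((resolventWeight s β : ℂ) * (inner ℂ (hermiteL2 β) f : ℂ))
  refine h1.unique (h2.congr_fun fun j => ?_)
  by_cases hj : j = ∑ i, β i
  · subst hj
    simp [resolventWeight]
  · rw [if_neg hj, if_neg (Ne.symm hj), mul_zero]

theorem hasSum_sum_piAntidiag {H : Type*} [NormedAddCommGroup H] {F : (Fin n → ℕ) → H} {u : H}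
    (hu : HasSum F u) :
    HasSum (fun j : ℕ => ∑ β ∈ Finset.piAntidiag (Finset.univ : Finset (Fin n)) j, F β) u := by
  have h1 := (Equiv.sigmaFiberEquiv fun β : Fin n → ℕ => ∑ i, β i).hasSum_iff.2 hu
  refine h1.sigma fun j => ?_
  have h2 := Finset.hasSum (Finset.piAntidiag (Finset.univ : Finset (Fin n)) j) F
  let e : {β : Fin n → ℕ // ∑ i, β i = j} ≃
      {β // β ∈ Finset.piAntidiag (Finset.univ : Finset (Fin n)) j} :=
    Equiv.subtypeEquivRight fun β => by simp [Finset.mem_piAntidiag]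
  exact (e.hasSum_iff (f := F ∘ Subtype.val)).2 h2

theorem hasSum_resolventWeight {s : ℝ} (hs : 0 ≤ s) (f : Lp ℂ 2 (gaussMeasure n)) :
    ∃ u, IsResolventPower s f u ∧
      HasSum (fun β => ((resolventWeight s β : ℂ) * inner ℂ (hermiteL2 β) f) • hermiteL2 β) u := by
  obtain ⟨u, hu, -⟩ := exists_hasSum_multiplier (n := n) 0 (w := resolventWeight s) zero_le_one
    (fun β => by
      rw [abs_of_nonneg (resolventWeight_nonneg s β)]
      exact Real.rpow_le_one_of_one_le_of_nonpos
        (by linarith [Nat.cast_nonneg (α := ℝ) (∑ i, β i)]) (by linarith)) f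
  simp only [add_zero] at hu
  refine ⟨u, ?_, hu⟩
  refine (hasSum_sum_piAntidiag hu).congr_fun fun j => ?_
  rw [chaosProj, Finset.smul_sum]
  refine Finset.sum_congr rfl fun β hβ => ?_
  rw [Finset.mem_piAntidiag] at hβ
  have : ∑ i, β i = j := hβ.1
  rw [smul_smul, resolventWeight, this]

theorem IsResolventPower.unique {s : ℝ} {f u u' : Lp ℂ 2 (gaussMeasure n)}
    (h : IsResolventPower s f u) (h' : IsResolventPower s f u') : u = u' :=
  HasSum.unique h h'

/-! #### The adjoint derivatives -/

theorem integral_hermiteFn_mul_eq (β : Fin n → ℕ) (ψ : EuclideanSpace ℝ (Fin n) → ℝ) :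
    ∫ x, hermiteFn β x * ψ x ∂(gaussMeasure n) =
      (Real.pi ^ (-(n : ℝ) / 2) * (sqrtFactorial β)⁻¹) * ∫ x, gaussHermite β x * ψ x := by
  rw [integral_gaussMeasure, ← integral_const_mul]
  refine integral_congr_ae (Filter.Eventually.of_forall fun x => ?_)
  simp only [hermiteFn_eq, gaussHermite, smul_eq_mul]
  ring

/-- `D^{*α} h_β = √((β + α)! / β!) h_{β + α}`, tested against `φ`. -/
theorem integral_hermiteFn_mul_deltaPow (β α : Fin n → ℕ) {φ : EuclideanSpace ℝ (Fin n) → ℝ}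
    (hφ : IsTest φ) :
    ∫ x, hermiteFn β x * deltaPow α φ x ∂(gaussMeasure n) =
      (sqrtFactorial (β + α) / sqrtFactorial β) *
        ∫ x, hermiteFn (β + α) x * φ x ∂(gaussMeasure n) := by
  have h := integral_gaussHermite_mul_deltaPow β α hφ 0 one_ne_zero
  simp only [inv_one, one_pow, one_mul, zero_add, one_smul] at h
  rw [integral_hermiteFn_mul_eq, integral_hermiteFn_mul_eq, h]
  have := (sqrtFactorial_pos β).ne'
  have := (sqrtFactorial_pos (β + α)).ne'
  field_simp

theorem factorial_add_le (b a N : ℕ) (hb : b ≤ N) (hab : a ≤ N) :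
    ((b + a).factorial : ℝ) ≤ b.factorial * (2 * N) ^ a := by
  have h1 := Nat.factorial_mul_ascFactorial b a
  have h2 := Nat.ascFactorial_le_pow_add b a
  have h3 : (b + a) ^ a ≤ (2 * N) ^ a := Nat.pow_le_pow_left (by omega) a
  rw [← h1]
  have h4 : b.factorial * (b + 1).ascFactorial a ≤ b.factorial * (2 * N) ^ a :=
    Nat.mul_le_mul_left _ (h2.trans h3)
  exact_mod_cast h4

/-- The order of `D^{*α}` is exactly compensated by `(𝓛 + I)^{-|α|/2}`. -/
theorem resolventWeight_mul_le (β α : Fin n → ℕ) :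
    resolventWeight (((∑ i, α i : ℕ) : ℝ) / 2) β * (sqrtFactorial (β + α) / sqrtFactorial β) ≤
      √((2 * ((∑ i, α i : ℕ) + 1 : ℝ)) ^ (∑ i, α i)) := by
  set m := ∑ i, α i with hm
  set N := ∑ i, β i with hN
  have h1 : sqrtFactorial (β + α) ≤
      sqrtFactorial β * √((2 * (((m + 1) * (N + 1) : ℕ) : ℝ)) ^ m) := by
    have e : √((2 * (((m + 1) * (N + 1) : ℕ) : ℝ)) ^ m) =
        ∏ i, √((2 * (((m + 1) * (N + 1) : ℕ) : ℝ)) ^ (α i)) := by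
      rw [hm, ← Finset.prod_pow_eq_pow_sum, Real.sqrt_prod _ fun i _ => by positivity]
    rw [e, sqrtFactorial, sqrtFactorial, ← Finset.prod_mul_distrib]
    refine Finset.prod_le_prod (fun i _ => Real.sqrt_nonneg _) fun i _ => ?_
    rw [← Real.sqrt_mul (by positivity)]
    refine Real.sqrt_le_sqrt (factorial_add_le _ _ _ ?_ ?_)
    · have : β i ≤ N := Finset.single_le_sum (f := β) (fun _ _ => Nat.zero_le _) (Finset.mem_univ i)
      nlinarith
    · have : α i ≤ m := Finset.single_le_sum (f := α) (fun _ _ => Nat.zero_le _) (Finset.mem_univ i)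
      nlinarith
  have h2 : sqrtFactorial (β + α) / sqrtFactorial β ≤
      √((2 * (((m + 1) * (N + 1) : ℕ) : ℝ)) ^ m) := by
    rw [div_le_iff₀ (sqrtFactorial_pos β), mul_comm]
    exact h1
  have h3 : √((2 * (((m + 1) * (N + 1) : ℕ) : ℝ)) ^ m) =
      √((2 * ((m : ℝ) + 1)) ^ m) * ((N : ℝ) + 1) ^ ((m : ℝ) / 2) := by
    have : (2 * (((m + 1) * (N + 1) : ℕ) : ℝ)) ^ m =
        (2 * ((m : ℝ) + 1)) ^ m * ((N : ℝ) + 1) ^ m := by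
      push_cast
      rw [← mul_pow]
      ring
    rw [this, Real.sqrt_mul (by positivity)]
    congr 1
    rw [Real.sqrt_eq_rpow, ← Real.rpow_natCast, ← Real.rpow_mul (by positivity)]
    congr 1
    ring
  rw [h3] at h2
  calc _ ≤ resolventWeight ((m : ℝ) / 2) β *
        (√((2 * ((m : ℝ) + 1)) ^ m) * ((N : ℝ) + 1) ^ ((m : ℝ) / 2)) := by
        gcongr
        exact resolventWeight_nonneg _ _
    _ = √((2 * ((m : ℝ) + 1)) ^ m) * (((N : ℝ) + 1) ^ (-((m : ℝ) / 2)) *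
        ((N : ℝ) + 1) ^ ((m : ℝ) / 2)) := by rw [resolventWeight]; ring
    _ = _ := by rw [← Real.rpow_add (by positivity), neg_add_cancel, Real.rpow_zero, mul_one]

theorem IsWeakDeltaStar.unique {α : Fin n → ℕ} {u g g' : Lp ℂ 2 (gaussMeasure n)}
    (h : IsWeakDeltaStar α u g) (h' : IsWeakDeltaStar α u g') : g = g' := by
  have hi : ∀ f : Lp ℂ 2 (gaussMeasure n), LocallyIntegrable f (gaussMeasure n) := fun f =>
    ((Lp.memLp f).integrable (by norm_num)).locallyIntegrable
  refine Lp.ext (ae_eq_of_integral_contDiff_smul_eq (hi g) (hi g') fun φ hφ hc => ?_)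
  have h1 := (h φ hφ hc).trans (h' φ hφ hc).symm
  simpa only [Complex.real_smul, mul_comm] using h1

/-- `R*_α` is everywhere defined and bounded on `L²(γ)`. -/
theorem exists_isNewRiesz (α : Fin n → ℕ) (f : Lp ℂ 2 (gaussMeasure n)) :
    ∃ g, IsNewRiesz α f g ∧
      ‖g‖ ≤ √((2 * ((∑ i, α i : ℕ) + 1 : ℝ)) ^ (∑ i, α i)) * ‖f‖ := by
  set s : ℝ := ((∑ i, α i : ℕ) : ℝ) / 2 with hs
  obtain ⟨u, hu, hus⟩ := hasSum_resolventWeight (s := s) (by positivity) f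
  have hk : ∀ β : Fin n → ℕ, 0 ≤ sqrtFactorial (β + α) / sqrtFactorial β := fun β =>
    div_nonneg (sqrtFactorial_pos _).le (sqrtFactorial_pos _).le
  obtain ⟨g, hg, hgn⟩ := exists_hasSum_multiplier α
    (w := fun β => resolventWeight s β * (sqrtFactorial (β + α) / sqrtFactorial β))
    (Real.sqrt_nonneg _) (fun β => by
      rw [abs_of_nonneg (mul_nonneg (resolventWeight_nonneg _ _) (hk β))]
      exact resolventWeight_mul_le β α) f
  refine ⟨g, ⟨u, hu, fun φ hφ hc => ?_⟩, hgn⟩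
  have ht : IsTest φ := ⟨hφ, hc⟩
  obtain ⟨C, _, hC⟩ := ht.exists_bound
  obtain ⟨D, _, hD⟩ := (ht.deltaPow α).exists_bound
  have m1 := memLp_ofReal ht.continuous hC 2
  have m2 := memLp_ofReal (ht.deltaPow α).continuous hD 2
  rw [← inner_toLp_ofReal m1, ← inner_toLp_ofReal m2]
  have h1 := hg.mapL (innerSL ℂ (m1.toLp _))
  have h2 := hus.mapL (innerSL ℂ (m2.toLp _))
  refine h1.unique (h2.congr_fun fun β => ?_)
  simp only [innerSL_apply_apply, inner_smul_right, inner_toLp_hermiteL2,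
    integral_hermiteFn_mul_deltaPow β α ht]
  push_cast
  ring

theorem IsNewRiesz.unique {α : Fin n → ℕ} {f g g' : Lp ℂ 2 (gaussMeasure n)}
    (h : IsNewRiesz α f g) (h' : IsNewRiesz α f g') : g = g' := by
  obtain ⟨u, hu, hg⟩ := h
  obtain ⟨u', hu', hg'⟩ := h'
  rw [← hu.unique hu'] at hg'
  exact hg.unique hg'

/-! ### The dual function of a test function -/

/-- The bounded function `(𝓛 + I)^{-|α|/2} D^α φ`, which represents `f ↦ ∫ (R*_α f) φ dγ`. The
integral formula for the resolvent power needs `|α| > 0`. -/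
noncomputable def rieszDual (α : Fin n → ℕ) (φ : EuclideanSpace ℝ (Fin n) → ℝ) :
    EuclideanSpace ℝ (Fin n) → ℝ :=
  if ∑ i, α i = 0 then deltaPow α φ
  else resolventPower (((∑ i, α i : ℕ) : ℝ) / 2) (deltaPow α φ)

theorem continuous_rieszDual (α : Fin n → ℕ) {φ : EuclideanSpace ℝ (Fin n) → ℝ}
    (hφ : IsTest φ) : Continuous (rieszDual α φ) := by
  obtain ⟨D, _, hD⟩ := (hφ.deltaPow α).exists_bound
  unfold rieszDual
  split_ifs with h
  · exact (hφ.deltaPow α).continuous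
  · exact continuous_resolventPower (by positivity) (hφ.deltaPow α).continuous hD

theorem exists_abs_rieszDual_le (α : Fin n → ℕ) {φ : EuclideanSpace ℝ (Fin n) → ℝ}
    (hφ : IsTest φ) : ∃ C, 0 ≤ C ∧ ∀ x, |rieszDual α φ x| ≤ C := by
  obtain ⟨D, hD0, hD⟩ := (hφ.deltaPow α).exists_bound
  refine ⟨D, hD0, ?_⟩
  unfold rieszDual
  split_ifs with h
  · exact hD
  · exact fun x => abs_resolventPower_le (by positivity) hD x

theorem integral_hermiteFn_mul_rieszDual (α : Fin n → ℕ) {φ : EuclideanSpace ℝ (Fin n) → ℝ}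
    (hφ : IsTest φ) (β : Fin n → ℕ) :
    ∫ y, hermiteFn β y * rieszDual α φ y ∂(gaussMeasure n) =
      resolventWeight (((∑ i, α i : ℕ) : ℝ) / 2) β *
        ∫ y, hermiteFn β y * deltaPow α φ y ∂(gaussMeasure n) := by
  obtain ⟨D, _, hD⟩ := (hφ.deltaPow α).exists_bound
  unfold rieszDual
  split_ifs with h
  · simp [resolventWeight, h]
  · exact integral_hermiteFn_mul_resolventPower (by positivity) (hφ.deltaPow α).continuous hD β

/-- `∫ (R*_α f) φ dγ = ∫ f (𝓛 + I)^{-|α|/2} D^α φ dγ`. -/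
theorem IsNewRiesz.integral_mul_eq {α : Fin n → ℕ} {f g : Lp ℂ 2 (gaussMeasure n)}
    (h : IsNewRiesz α f g) {φ : EuclideanSpace ℝ (Fin n) → ℝ} (hφ : IsTest φ) :
    ∫ x, g x * (φ x : ℂ) ∂(gaussMeasure n) =
      ∫ x, f x * (rieszDual α φ x : ℂ) ∂(gaussMeasure n) := by
  obtain ⟨u, hu, hg⟩ := h
  obtain ⟨D, _, hD⟩ := (hφ.deltaPow α).exists_bound
  obtain ⟨C, _, hC⟩ := exists_abs_rieszDual_le α hφ
  have m1 := memLp_ofReal (hφ.deltaPow α).continuous hD 2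
  have m2 := memLp_ofReal (continuous_rieszDual α hφ) hC 2
  rw [hg φ hφ.1 hφ.2, ← inner_toLp_ofReal m1, ← inner_toLp_ofReal m2]
  have h1 := (hermiteBasis n).hasSum_inner_mul_inner (m1.toLp _) u
  have h2 := (hermiteBasis n).hasSum_inner_mul_inner (m2.toLp _) f
  refine h1.unique (h2.congr_fun fun β => ?_)
  rw [hermiteBasis_apply, inner_toLp_hermiteL2, inner_toLp_hermiteL2, hu.inner_hermiteL2,
    integral_hermiteFn_mul_rieszDual α hφ]
  push_cast
  ring

theorem deltaPow_of_sum_eq_zero {α : Fin n → ℕ} (h : ∑ i, α i = 0)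
    (φ : EuclideanSpace ℝ (Fin n) → ℝ) : deltaPow α φ = φ := by
  have h0 : ∀ i, α i = 0 := fun i => Finset.sum_eq_zero_iff.1 h i (Finset.mem_univ i)
  have : ∀ l : List (Fin n), l.foldr (fun i ψ => (delta i)^[α i] ψ) φ = φ := by
    intro l
    induction l with
    | nil => rfl
    | cons i l ih => rw [List.foldr_cons, ih, h0, Function.iterate_zero, id]
  exact this _

/-- The kernel estimate: `Ψ_φ` has bounded oscillation on the ball `B(c, R)`, `R ≲ 1/(1 + |c|)`, if
`φ` vanishes on its double. For `α = 0` the operator is the identity, and `Ψ_φ = 0` there. -/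
theorem exists_abs_rieszDual_sub_le (α : Fin n → ℕ) {κ : ℝ} (hκ : 0 < κ) :
    ∃ K, 0 ≤ K ∧ ∀ (c : EuclideanSpace ℝ (Fin n)) (R : ℝ) (φ : EuclideanSpace ℝ (Fin n) → ℝ),
      0 < R → R * (1 + ‖c‖) ≤ κ → IsTest φ → (∀ x, |φ x| ≤ 1) →
      (∀ x, ‖x - c‖ < 2 * R → φ x = 0) → ∀ y, ‖y - c‖ ≤ R →
      |rieszDual α φ y - rieszDual α φ c| ≤ K := by
  by_cases h : ∑ i, α i = 0
  · refine ⟨0, le_rfl, fun c R φ hR _ _ _ h0 y hy => ?_⟩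
    rw [rieszDual, if_pos h, deltaPow_of_sum_eq_zero h, h0 y (by linarith),
      h0 c (by simpa using hR)]
    simp
  · simp only [rieszDual, if_neg h]
    exact exists_abs_resolventPower_sub_le α h hκ

end GaussianHardy

/-! ### A Calderón-Zygmund argument on trees of cells -/

namespace GaussianHardy

/-- A tree of nested cells: each cell is the disjoint union of finitely many children, each of
which carries a fixed proportion of its measure. Only the cells satisfying `good` matter. -/
structure CellTree {E : Type*} [MeasurableSpace E] (μ : Measure E) (ι : Type*) (D : ℝ) where
  cell : ℕ → ι → Set E
  children : ι → Finset ι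
  good : ℕ → ι → Prop
  one_le : 1 ≤ D
  measurableSet_cell : ∀ k m, MeasurableSet (cell k m)
  mem_cell_iff : ∀ k m x, x ∈ cell k m ↔ ∃ m' ∈ children m, x ∈ cell (k + 1) m'
  disjoint_cell : ∀ k m m', m ≠ m' → Disjoint (cell k m) (cell k m')
  good_children : ∀ k m, good k m → ∀ m' ∈ children m, good (k + 1) m'
  measure_le : ∀ k m, good k m → ∀ m' ∈ children m,
    μ.real (cell k m) ≤ D * μ.real (cell (k + 1) m')
  measure_pos : ∀ k m, good k m → 0 < μ.real (cell k m)

/-- `f` is supported in `s` and `∫ |f|^p ≤ L^p μ(s)`. -/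
structure HasMeanBound {E : Type*} [MeasurableSpace E] (μ : Measure E) (p : ℝ) (s : Set E) (L : ℝ)
    (f : E → ℝ) : Prop where
  integrable : Integrable f μ
  integrable_rpow : Integrable (fun x => |f x| ^ p) μ
  eq_zero : ∀ x ∉ s, f x = 0
  integral_le : ∫ x, |f x| ^ p ∂μ ≤ L ^ p * μ.real s

section

variable {E : Type*} [MeasurableSpace E] {μ : Measure E} {ι : Type*} {D p : ℝ}

theorem abs_sub_rpow_le (hp : 1 < p) (a b : ℝ) :
    |a - b| ^ p ≤ 2 ^ p * (|a| ^ p + |b| ^ p) := by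
  have hp0 : 0 ≤ p := by linarith
  have h1 : |a - b| ≤ 2 * max |a| |b| := by
    refine (abs_sub a b).trans ?_
    linarith [le_max_left |a| |b|, le_max_right |a| |b|]
  have h0 : 0 ≤ max |a| |b| := (abs_nonneg a).trans (le_max_left _ _)
  calc |a - b| ^ p ≤ (2 * max |a| |b|) ^ p := Real.rpow_le_rpow (abs_nonneg _) h1 hp0
    _ = 2 ^ p * (max |a| |b|) ^ p := Real.mul_rpow (by norm_num) h0
    _ ≤ _ := by
      gcongr
      rcases le_total |a| |b| with h | h
      · rw [max_eq_right h]
        linarith [Real.rpow_nonneg (abs_nonneg a) p]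
      · rw [max_eq_left h]
        linarith [Real.rpow_nonneg (abs_nonneg b) p]

theorem HasMeanBound.integral_abs_le [IsFiniteMeasure μ] {s : Set E} {L : ℝ} {f : E → ℝ}
    (hp : 1 < p) (hL : 0 < L) (hs : MeasurableSet s) (h : HasMeanBound μ p s L f) :
    ∫ x, |f x| ∂μ ≤ 2 * L * μ.real s := by
  have hLp : 0 < L ^ p := Real.rpow_pos_of_pos hL p
  have hpt : ∀ x, |f x| ≤ s.indicator (fun _ => L) x + L * (L ^ p)⁻¹ * |f x| ^ p := by
    intro x
    by_cases hx : x ∈ s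
    · rw [Set.indicator_of_mem hx]
      rcases le_total |f x| L with h1 | h1
      · have : 0 ≤ L * (L ^ p)⁻¹ * |f x| ^ p := by positivity
        linarith
      · have h2 : 1 ≤ |f x| / L := (one_le_div hL).2 h1
        have h3 : |f x| / L ≤ (|f x| / L) ^ p := Real.self_le_rpow_of_one_le h2 hp.le
        rw [Real.div_rpow (abs_nonneg _) hL.le, div_le_iff₀ hL] at h3
        have e : |f x| ^ p / L ^ p * L = L * (L ^ p)⁻¹ * |f x| ^ p := by
          rw [div_eq_mul_inv]
          ring
        linarith
    · rw [Set.indicator_of_notMem hx, h.eq_zero x hx, abs_zero]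
      positivity
  have hi : Integrable (s.indicator fun _ => L) μ := (integrable_const L).indicator hs
  calc ∫ x, |f x| ∂μ ≤ ∫ x, (s.indicator (fun _ => L) x + L * (L ^ p)⁻¹ * |f x| ^ p) ∂μ :=
        integral_mono h.integrable.abs (hi.add (h.integrable_rpow.const_mul _)) hpt
    _ = L * μ.real s + L * (L ^ p)⁻¹ * ∫ x, |f x| ^ p ∂μ := by
        rw [integral_add hi (h.integrable_rpow.const_mul _), integral_const_mul,
          integral_indicator_const _ hs, smul_eq_mul]
        ring
    _ ≤ L * μ.real s + L * (L ^ p)⁻¹ * (L ^ p * μ.real s) := by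
        gcongr
        exact h.integral_le
    _ = 2 * L * μ.real s := by
        field_simp
        ring

/-- The mean value of `f` on `s`, extended by zero. -/
noncomputable def meanOn (μ : Measure E) (s : Set E) (f : E → ℝ) : E → ℝ :=
  s.indicator fun _ => (∫ x, f x ∂μ) / μ.real s

theorem measurable_meanOn {s : Set E} (hs : MeasurableSet s) (f : E → ℝ) :
    Measurable (meanOn μ s f) := measurable_const.indicator hs

theorem meanOn_of_notMem {s : Set E} {f : E → ℝ} {x : E} (hx : x ∉ s) : meanOn μ s f x = 0 :=
  Set.indicator_of_notMem hx _

theorem integrable_meanOn [IsFiniteMeasure μ] {s : Set E} (hs : MeasurableSet s) (f : E → ℝ) :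
    Integrable (meanOn μ s f) μ := (integrable_const _).indicator hs

theorem integral_meanOn {s : Set E} (hs : MeasurableSet s) (h0 : 0 < μ.real s) (f : E → ℝ) :
    ∫ x, meanOn μ s f x ∂μ = ∫ x, f x ∂μ := by
  simp only [meanOn]
  rw [integral_indicator_const _ hs, smul_eq_mul, mul_div_cancel₀ _ h0.ne']

theorem abs_meanOn_le {s : Set E} {f : E → ℝ} {L : ℝ} (h0 : 0 < μ.real s)
    (h : ∫ x, |f x| ∂μ ≤ L * μ.real s) (x : E) : |meanOn μ s f x| ≤ L := by
  have h1 : |(∫ x, f x ∂μ) / μ.real s| ≤ L := by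
    rw [abs_div, abs_of_pos h0, div_le_iff₀ h0]
    exact (abs_integral_le_integral_abs).trans h
  by_cases hx : x ∈ s
  · rwa [meanOn, Set.indicator_of_mem hx]
  · rw [meanOn, Set.indicator_of_notMem hx, abs_zero]
    exact (abs_nonneg _).trans h1

theorem integral_abs_meanOn_le {s : Set E} (hs : MeasurableSet s) (h0 : 0 < μ.real s)
    (f : E → ℝ) : ∫ x, |meanOn μ s f x| ∂μ ≤ ∫ x, |f x| ∂μ := by
  have e : ∀ x, |meanOn μ s f x| = s.indicator (fun _ => |(∫ x, f x ∂μ) / μ.real s|) x := by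
    intro x
    by_cases hx : x ∈ s
    · rw [meanOn, Set.indicator_of_mem hx, Set.indicator_of_mem hx]
    · rw [meanOn, Set.indicator_of_notMem hx, Set.indicator_of_notMem hx, abs_zero]
  simp_rw [e]
  rw [integral_indicator_const _ hs, smul_eq_mul, abs_div, abs_of_pos h0, mul_div_cancel₀ _ h0.ne']
  exact abs_integral_le_integral_abs

/-- Subtracting the mean value keeps an `L^p` bound. -/
theorem HasMeanBound.sub_meanOn [IsFiniteMeasure μ] {s : Set E} {L : ℝ} {f : E → ℝ}
    (hp : 1 < p) (hL : 0 < L)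
    (hs : MeasurableSet s) (h0 : 0 < μ.real s) (h : HasMeanBound μ p s L f) :
    HasMeanBound μ p s (8 * L) fun x => f x - meanOn μ s f x := by
  have hp0 : 0 ≤ p := by linarith
  have hb := abs_meanOn_le h0 (h.integral_abs_le hp hL hs)
  have hpt : ∀ x, |f x - meanOn μ s f x| ^ p ≤
      2 ^ p * (|f x| ^ p + s.indicator (fun _ => (2 * L) ^ p) x) := by
    intro x
    refine (abs_sub_rpow_le hp _ _).trans ?_
    gcongr
    by_cases hx : x ∈ s
    · rw [Set.indicator_of_mem hx]
      exact Real.rpow_le_rpow (abs_nonneg _) (hb x) hp0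
    · rw [Set.indicator_of_notMem hx, meanOn_of_notMem hx, abs_zero,
        Real.zero_rpow (by linarith)]
  have hi : Integrable (s.indicator fun _ => (2 * L) ^ p) μ := (integrable_const _).indicator hs
  have hI := (h.integrable_rpow.add hi).const_mul (2 ^ p)
  have hd : Integrable (fun x => f x - meanOn μ s f x) μ :=
    h.integrable.sub (integrable_meanOn hs f)
  refine ⟨hd, hI.mono' ?_ (Filter.Eventually.of_forall fun x => ?_), fun x hx => ?_, ?_⟩
  · exact (hd.1.aemeasurable.abs.pow_const p).aestronglyMeasurable
  · rw [Real.norm_of_nonneg (Real.rpow_nonneg (abs_nonneg _) _)]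
    exact hpt x
  · rw [h.eq_zero x hx, meanOn_of_notMem hx, sub_zero]
  · have h2 : (2 : ℝ) ≤ 2 ^ p := Real.self_le_rpow_of_one_le (by norm_num) hp.le
    have hL0 : 0 ≤ L ^ p * μ.real s := by positivity
    calc ∫ x, |f x - meanOn μ s f x| ^ p ∂μ
        ≤ ∫ x, 2 ^ p * (|f x| ^ p + s.indicator (fun _ => (2 * L) ^ p) x) ∂μ :=
          integral_mono_of_nonneg (Filter.Eventually.of_forall fun _ =>
            Real.rpow_nonneg (abs_nonneg _) _) hI (Filter.Eventually.of_forall hpt)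
      _ = 2 ^ p * (∫ x, |f x| ^ p ∂μ + (2 * L) ^ p * μ.real s) := by
          rw [integral_const_mul, integral_add h.integrable_rpow hi,
            integral_indicator_const _ hs, smul_eq_mul, mul_comm (μ.real s)]
      _ ≤ 2 ^ p * (L ^ p * μ.real s + (2 * L) ^ p * μ.real s) := by
          gcongr
          exact h.integral_le
      _ = 2 ^ p * (1 + 2 ^ p) * (L ^ p * μ.real s) := by
          rw [Real.mul_rpow (by norm_num) hL.le]
          ring
      _ ≤ 2 ^ p * (2 ^ p * 2 ^ p) * (L ^ p * μ.real s) := by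
          gcongr
          nlinarith
      _ = (8 * L) ^ p * μ.real s := by
          rw [Real.mul_rpow (by norm_num) hL.le, ← Real.mul_rpow (by norm_num) (by norm_num),
            ← Real.mul_rpow (by norm_num) (by norm_num)]
          norm_num
          ring

/-- The hypotheses on the function `Ψ` tested against: it is bounded, it has mean oscillation at
most `C₀` on all good cells, and its oscillation is at most `C₀` on good cells of generation
`N`. -/
structure HasOscillation (T : CellTree μ ι D) (C₀ : ℝ) (N : ℕ) (Ψ : E → ℝ) : Prop where
  measurable : Measurable Ψ
  bounded : ∃ B, ∀ x, |Ψ x| ≤ B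
  mean : ∀ k m, T.good k m → ∀ (g : E → ℝ) (L : ℝ), 0 ≤ L → Measurable g → (∀ x, |g x| ≤ L) →
    (∀ x ∉ T.cell k m, g x = 0) → ∫ x, g x ∂μ = 0 →
    |∫ x, g x * Ψ x ∂μ| ≤ C₀ * L * μ.real (T.cell k m)
  fine : ∀ m, T.good N m → ∀ x ∈ T.cell N m, ∀ y ∈ T.cell N m, |Ψ x - Ψ y| ≤ C₀

/-- `Ψ` acts with norm `A` on the functions of mean zero on `s`, normalized in `L^p`. -/
def MeanZeroBound (μ : Measure E) (p A : ℝ) (Ψ : E → ℝ) (s : Set E) : Prop :=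
  ∀ (f : E → ℝ) (F : ℝ), 0 < F → HasMeanBound μ p s F f → ∫ x, f x ∂μ = 0 →
    |∫ x, f x * Ψ x ∂μ| ≤ A * F * μ.real s

/-- The Calderón-Zygmund decomposition `f = g + (f - g)` on the cell `s` at height `L`, with the
bad part `f - g` measured by testing against `Ψ`. -/
def CalderonZygmundBound (μ : Measure E) (p A C₀ D : ℝ) (Ψ : E → ℝ) (s : Set E) : Prop :=
  ∀ (f : E → ℝ) (L : ℝ), 0 < L → HasMeanBound μ p s L f →
    ∃ g : E → ℝ, Measurable g ∧ (∀ x, |g x| ≤ 2 * D * L) ∧ (∀ x ∉ s, g x = 0) ∧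
      ∫ x, g x ∂μ = ∫ x, f x ∂μ ∧
      |∫ x, (f x - g x) * Ψ x ∂μ| ≤
        8 * D * A * (L * (L ^ p)⁻¹) * ∫ x, |f x| ^ p ∂μ + 2 * C₀ * ∫ x, |f x| ∂μ

theorem integrable_mul_of_bounded {f Ψ : E → ℝ} (hf : Integrable f μ) (hΨ : Measurable Ψ)
    (hb : ∃ B, ∀ x, |Ψ x| ≤ B) : Integrable (fun x => f x * Ψ x) μ := by
  obtain ⟨B, hB⟩ := hb
  exact hf.mul_bdd hΨ.aestronglyMeasurable (Filter.Eventually.of_forall hB)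

theorem integrable_of_bounded [IsFiniteMeasure μ] {g : E → ℝ} {L : ℝ} (hg : Measurable g)
    (hL : ∀ x, |g x| ≤ L) :
    Integrable g μ :=
  (integrable_const L).mono' hg.aestronglyMeasurable (Filter.Eventually.of_forall hL)

/-- On the finest cells the decomposition is the mean value. -/
theorem calderonZygmundBound_fine [IsFiniteMeasure μ] {T : CellTree μ ι D} {C₀ : ℝ} {N : ℕ}
    {Ψ : E → ℝ} (hΨ : HasOscillation T C₀ N Ψ) (hp : 1 < p)
    {A : ℝ} (hA : 0 ≤ A) {m : ι} (hm : T.good N m) :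
    CalderonZygmundBound μ p A C₀ D Ψ (T.cell N m) := by
  intro f L hL hf
  have hs := T.measurableSet_cell N m
  have h0 := T.measure_pos N m hm
  have hD : 0 ≤ D := zero_le_one.trans T.one_le
  obtain ⟨x₀, hx₀⟩ : (T.cell N m).Nonempty := by
    by_contra h
    rw [Set.not_nonempty_iff_eq_empty] at h
    simp [h] at h0
  have hi1 := hf.integrable
  have hi2 := integrable_meanOn (μ := μ) hs f
  refine ⟨meanOn μ (T.cell N m) f, measurable_meanOn hs f, fun x => ?_,
    fun x hx => meanOn_of_notMem hx, integral_meanOn hs h0 f, ?_⟩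
  · refine (abs_meanOn_le h0 (hf.integral_abs_le hp hL hs) x).trans ?_
    nlinarith [T.one_le]
  · have hz : ∫ x, (f x - meanOn μ (T.cell N m) f x) ∂μ = 0 := by
      rw [integral_sub hi1 hi2, integral_meanOn hs h0, sub_self]
    have hi3 : Integrable (fun x => (f x - meanOn μ (T.cell N m) f x) * Ψ x) μ :=
      integrable_mul_of_bounded (hi1.sub hi2) hΨ.measurable hΨ.bounded
    have hi4 : Integrable (fun x => (f x - meanOn μ (T.cell N m) f x)) μ := hi1.sub hi2
    have e : ∫ x, (f x - meanOn μ (T.cell N m) f x) * Ψ x ∂μ =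
        ∫ x, (f x - meanOn μ (T.cell N m) f x) * (Ψ x - Ψ x₀) ∂μ := by
      simp_rw [mul_sub]
      rw [integral_sub hi3 (hi4.mul_const _), integral_mul_const, hz, zero_mul, sub_zero]
    rw [e]
    have hpt : ∀ x, ‖(f x - meanOn μ (T.cell N m) f x) * (Ψ x - Ψ x₀)‖ ≤
        C₀ * (|f x| + |meanOn μ (T.cell N m) f x|) := by
      intro x
      rw [norm_mul, Real.norm_eq_abs, Real.norm_eq_abs]
      by_cases hx : x ∈ T.cell N m
      · rw [mul_comm]
        have h1 := hΨ.fine m hm x hx x₀ hx₀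
        exact mul_le_mul h1 (abs_sub _ _) (abs_nonneg _) ((abs_nonneg _).trans h1)
      · rw [hf.eq_zero x hx, meanOn_of_notMem hx]
        simp
    have h1 := norm_integral_le_of_norm_le ((hi1.abs.add hi2.abs).const_mul C₀)
      (Filter.Eventually.of_forall hpt)
    simp only [Pi.add_apply] at h1
    rw [integral_const_mul, integral_add hi1.abs hi2.abs, Real.norm_eq_abs] at h1
    have hC : 0 ≤ C₀ := (abs_nonneg _).trans (hΨ.fine m hm x₀ hx₀ x₀ hx₀)
    have h2 := integral_abs_meanOn_le hs h0 f
    have h3 : 0 ≤ 8 * D * A * (L * (L ^ p)⁻¹) * ∫ x, |f x| ^ p ∂μ := by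
      have : 0 ≤ ∫ x, |f x| ^ p ∂μ := integral_nonneg fun x => Real.rpow_nonneg (abs_nonneg _) _
      positivity
    nlinarith

/-- The decomposition on one child: either the mean of `|f|^p` is still small and one recurses, or
the child is a stopping cell, where `f` is replaced by its mean. -/
theorem exists_good_part_of_child [IsFiniteMeasure μ] {C₀ A : ℝ} {Ψ : E → ℝ}
    (hp : 1 < p) (hC : 0 ≤ C₀) (hA : 0 ≤ A) (hD : 1 ≤ D)
    {s : Set E} (hs : MeasurableSet s) (h0 : 0 < μ.real s) (hM : MeanZeroBound μ p A Ψ s)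
    (hS : CalderonZygmundBound μ p A C₀ D Ψ s) {f : E → ℝ} {L : ℝ}
    (hL : 0 < L) (hf : HasMeanBound μ p s (D * L) f) :
    ∃ g : E → ℝ, Measurable g ∧ (∀ x, |g x| ≤ 2 * D * L) ∧ (∀ x ∉ s, g x = 0) ∧
      ∫ x, g x ∂μ = ∫ x, f x ∂μ ∧
      |∫ x, (f x - g x) * Ψ x ∂μ| ≤
        8 * D * A * (L * (L ^ p)⁻¹) * ∫ x, |f x| ^ p ∂μ + 2 * C₀ * ∫ x, |f x| ∂μ := by
  have hLp : 0 < L ^ p := Real.rpow_pos_of_pos hL p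
  by_cases hsmall : ∫ x, |f x| ^ p ∂μ ≤ L ^ p * μ.real s
  · exact hS f L hL ⟨hf.integrable, hf.integrable_rpow, hf.eq_zero, hsmall⟩
  · push Not at hsmall
    have hDL : 0 < D * L := by positivity
    have hb := hf.sub_meanOn hp hDL hs h0
    refine ⟨meanOn μ s f, measurable_meanOn hs f, fun x => ?_, fun x hx => meanOn_of_notMem hx,
      integral_meanOn hs h0 f, ?_⟩
    · rw [mul_assoc]
      exact abs_meanOn_le h0 (hf.integral_abs_le hp hDL hs) x
    · have h1 := hM _ _ (by positivity) hb (by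
        rw [integral_sub hf.integrable (integrable_meanOn hs f), integral_meanOn hs h0, sub_self])
      have h2 : μ.real s ≤ (L ^ p)⁻¹ * ∫ x, |f x| ^ p ∂μ := by
        rw [inv_mul_eq_div, le_div_iff₀ hLp, mul_comm]
        exact hsmall.le
      have h3 : 0 ≤ 2 * C₀ * ∫ x, |f x| ∂μ :=
        mul_nonneg (by positivity) (integral_nonneg fun x => abs_nonneg _)
      calc _ ≤ A * (8 * (D * L)) * μ.real s := h1
        _ ≤ A * (8 * (D * L)) * ((L ^ p)⁻¹ * ∫ x, |f x| ^ p ∂μ) := by gcongr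
        _ = 8 * D * A * (L * (L ^ p)⁻¹) * ∫ x, |f x| ^ p ∂μ := by ring
        _ ≤ _ := le_add_of_nonneg_right h3

theorem CellTree.eq_sum_indicator (T : CellTree μ ι D) (k : ℕ) (m : ι) {f : E → ℝ}
    (hf : ∀ x ∉ T.cell k m, f x = 0) (x : E) :
    f x = ∑ m' ∈ T.children m, (T.cell (k + 1) m').indicator f x := by
  by_cases hx : x ∈ T.cell k m
  · obtain ⟨m₀, hm₀, hx₀⟩ := (T.mem_cell_iff k m x).1 hx
    rw [Finset.sum_eq_single_of_mem m₀ hm₀, Set.indicator_of_mem hx₀]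
    intro m' _ hne
    exact Set.indicator_of_notMem (fun h =>
      Set.disjoint_left.1 (T.disjoint_cell (k + 1) m' m₀ hne) h hx₀) _
  · rw [hf x hx, Finset.sum_eq_zero]
    intro m' hm'
    exact Set.indicator_of_notMem (fun h => hx ((T.mem_cell_iff k m x).2 ⟨m', hm', h⟩)) _

/-- One step of the Calderón-Zygmund decomposition. -/
theorem calderonZygmundBound_succ [IsFiniteMeasure μ] {T : CellTree μ ι D} {C₀ A : ℝ}
    {Ψ : E → ℝ} (hp : 1 < p) (hC : 0 ≤ C₀) (hA : 0 ≤ A)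
    (hΨm : Measurable Ψ) (hΨb : ∃ B, ∀ x, |Ψ x| ≤ B) {k : ℕ} {m : ι}
    (hm : T.good k m)
    (hM : ∀ m' ∈ T.children m, MeanZeroBound μ p A Ψ (T.cell (k + 1) m'))
    (hS : ∀ m' ∈ T.children m, CalderonZygmundBound μ p A C₀ D Ψ (T.cell (k + 1) m')) :
    CalderonZygmundBound μ p A C₀ D Ψ (T.cell k m) := by
  intro f L hL hf
  have hD1 := T.one_le
  have hD0 : 0 < D := zero_lt_one.trans_le hD1
  have hp0 : 0 < p := by linarith
  set c : ι → Set E := fun m' => T.cell (k + 1) m' with hc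
  have hcm : ∀ m', MeasurableSet (c m') := fun m' => T.measurableSet_cell _ _
  have habs : ∀ m' x, |(c m').indicator f x| = (c m').indicator (fun x => |f x|) x := by
    intro m' x
    by_cases hx : x ∈ c m'
    · rw [Set.indicator_of_mem hx, Set.indicator_of_mem hx]
    · rw [Set.indicator_of_notMem hx, Set.indicator_of_notMem hx, abs_zero]
  have hrpow : ∀ m' x, |(c m').indicator f x| ^ p = (c m').indicator (fun x => |f x| ^ p) x := by
    intro m' x
    by_cases hx : x ∈ c m'
    · rw [Set.indicator_of_mem hx, Set.indicator_of_mem hx]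
    · rw [Set.indicator_of_notMem hx, Set.indicator_of_notMem hx, abs_zero,
        Real.zero_rpow hp0.ne']
  have hfi : ∀ m', Integrable ((c m').indicator f) μ := fun m' => hf.integrable.indicator (hcm m')
  have hchild : ∀ m' ∈ T.children m, HasMeanBound μ p (c m') (D * L) ((c m').indicator f) := by
    intro m' hm'
    have hi : Integrable (fun x => |(c m').indicator f x| ^ p) μ := by
      simp_rw [hrpow]
      exact hf.integrable_rpow.indicator (hcm m')
    refine ⟨hfi m', hi, fun x hx => Set.indicator_of_notMem hx _, ?_⟩
    calc ∫ x, |(c m').indicator f x| ^ p ∂μ ≤ ∫ x, |f x| ^ p ∂μ := by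
          refine integral_mono hi hf.integrable_rpow fun x => ?_
          simp only [hrpow]
          exact Set.indicator_le_self' (fun _ _ => Real.rpow_nonneg (abs_nonneg _) _) x
      _ ≤ L ^ p * μ.real (T.cell k m) := hf.integral_le
      _ ≤ L ^ p * (D * μ.real (c m')) := by
          gcongr
          exact T.measure_le k m hm m' hm'
      _ ≤ L ^ p * (D ^ p * μ.real (c m')) := by
          gcongr
          exact Real.self_le_rpow_of_one_le hD1 hp.le
      _ = (D * L) ^ p * μ.real (c m') := by
          rw [Real.mul_rpow hD0.le hL.le]
          ring
  have hex : ∀ m', ∃ g : E → ℝ, m' ∈ T.children m → (Measurable g ∧ (∀ x, |g x| ≤ 2 * D * L) ∧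
      (∀ x ∉ c m', g x = 0) ∧ ∫ x, g x ∂μ = ∫ x, (c m').indicator f x ∂μ ∧
      |∫ x, ((c m').indicator f x - g x) * Ψ x ∂μ| ≤
        8 * D * A * (L * (L ^ p)⁻¹) * ∫ x, |(c m').indicator f x| ^ p ∂μ +
          2 * C₀ * ∫ x, |(c m').indicator f x| ∂μ) := by
    intro m'
    by_cases hm' : m' ∈ T.children m
    · obtain ⟨g, hg⟩ := exists_good_part_of_child hp hC hA hD1 (hcm m')
        (T.measure_pos _ _ (T.good_children k m hm m' hm')) (hM m' hm') (hS m' hm') hL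
        (hchild m' hm')
      exact ⟨g, fun _ => hg⟩
    · exact ⟨0, fun h => absurd h hm'⟩
  choose g hg using hex
  have hgi : ∀ m' ∈ T.children m, Integrable (g m') μ := fun m' hm' =>
    integrable_of_bounded (hg m' hm').1 (hg m' hm').2.1
  refine ⟨fun x => ∑ m' ∈ T.children m, g m' x,
    Finset.measurable_sum _ fun m' hm' => (hg m' hm').1, fun x => ?_, fun x hx => ?_, ?_, ?_⟩
  · beta_reduce
    by_cases hx : x ∈ T.cell k m
    · obtain ⟨m₀, hm₀, hx₀⟩ := (T.mem_cell_iff k m x).1 hx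
      rw [Finset.sum_eq_single_of_mem m₀ hm₀ fun m' hm' hne => (hg m' hm').2.2.1 x fun h =>
        Set.disjoint_left.1 (T.disjoint_cell (k + 1) m' m₀ hne) h hx₀]
      exact (hg m₀ hm₀).2.1 x
    · rw [Finset.sum_eq_zero fun m' hm' => (hg m' hm').2.2.1 x fun h =>
        hx ((T.mem_cell_iff k m x).2 ⟨m', hm', h⟩), abs_zero]
      positivity
  · exact Finset.sum_eq_zero fun m' hm' => (hg m' hm').2.2.1 x fun h =>
      hx ((T.mem_cell_iff k m x).2 ⟨m', hm', h⟩)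
  · rw [integral_finsetSum _ hgi, integral_congr_ae (Filter.Eventually.of_forall
      (T.eq_sum_indicator k m hf.eq_zero)), integral_finsetSum _ fun m' _ => hfi m']
    exact Finset.sum_congr rfl fun m' hm' => (hg m' hm').2.2.2.1
  · have e1 : ∀ x, (f x - ∑ m' ∈ T.children m, g m' x) * Ψ x =
        ∑ m' ∈ T.children m, ((c m').indicator f x - g m' x) * Ψ x := by
      intro x
      rw [T.eq_sum_indicator k m hf.eq_zero x, ← Finset.sum_sub_distrib, Finset.sum_mul]
    have e2 : ∫ x, |f x| ^ p ∂μ = ∑ m' ∈ T.children m, ∫ x, |(c m').indicator f x| ^ p ∂μ := by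
      rw [← integral_finsetSum _ fun m' hm' => (hchild m' hm').integrable_rpow]
      refine integral_congr_ae (Filter.Eventually.of_forall fun x => ?_)
      simp only [hrpow]
      exact T.eq_sum_indicator k m (f := fun x => |f x| ^ p) (fun x hx => by
        simp only [hf.eq_zero x hx, abs_zero, Real.zero_rpow hp0.ne']) x
    have e3 : ∫ x, |f x| ∂μ = ∑ m' ∈ T.children m, ∫ x, |(c m').indicator f x| ∂μ := by
      rw [← integral_finsetSum _ fun m' _ => (hfi m').abs]
      refine integral_congr_ae (Filter.Eventually.of_forall fun x => ?_)
      simp only [habs]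
      exact T.eq_sum_indicator k m (f := fun x => |f x|) (fun x hx => by
        simp only [hf.eq_zero x hx, abs_zero]) x
    simp_rw [e1]
    have hi : ∀ m' ∈ T.children m,
        Integrable (fun x => ((c m').indicator f x - g m' x) * Ψ x) μ := fun m' hm' =>
      integrable_mul_of_bounded ((hfi m').sub (hgi m' hm')) hΨm hΨb
    rw [integral_finsetSum _ hi, e2, e3, Finset.mul_sum,
      Finset.mul_sum, ← Finset.sum_add_distrib]
    exact (Finset.abs_sum_le_sum_abs _ _).trans
      (Finset.sum_le_sum fun m' hm' => (hg m' hm').2.2.2.2)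

/-- Applying the decomposition at a large multiple `Λ` of the mean gains the factor `Λ^{1-p}` on the
bad part, which is then absorbed. -/
theorem meanZeroBound_of_calderonZygmundBound [IsFiniteMeasure μ] {T : CellTree μ ι D} {C₀ : ℝ}
    {N : ℕ} {Ψ : E → ℝ} (hΨ : HasOscillation T C₀ N Ψ) (hp : 1 < p) (hC : 0 ≤ C₀)
    {Λ A : ℝ} (hΛ : 1 ≤ Λ)
    (hΛp : 16 * D * (Λ * (Λ ^ p)⁻¹) ≤ 1) (hA : A = 2 * (2 * C₀ * D * Λ + 4 * C₀)) {k : ℕ} {m : ι}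
    (hm : T.good k m) (hS : CalderonZygmundBound μ p A C₀ D Ψ (T.cell k m)) :
    MeanZeroBound μ p A Ψ (T.cell k m) := by
  intro f F hF hf hf0
  have hD1 := T.one_le
  have hD0 : 0 < D := zero_lt_one.trans_le hD1
  have hΛ0 : 0 < Λ := by linarith
  have hA0 : 0 ≤ A := by rw [hA]; positivity
  have hs := T.measurableSet_cell k m
  have hΛF : HasMeanBound μ p (T.cell k m) (Λ * F) f := by
    refine ⟨hf.integrable, hf.integrable_rpow, hf.eq_zero, hf.integral_le.trans ?_⟩
    gcongr
    nlinarith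
  obtain ⟨g, hgm, hgb, hg0, hgi, hb⟩ := hS f (Λ * F) (by positivity) hΛF
  have h1 := hΨ.mean k m hm g (2 * D * (Λ * F)) (by positivity) hgm hgb hg0 (hgi.trans hf0)
  have h2 := hf.integral_abs_le hp hF hs
  have hi := hf.integrable
  have hgI : Integrable g μ := integrable_of_bounded hgm hgb
  have e : ∫ x, f x * Ψ x ∂μ = ∫ x, g x * Ψ x ∂μ + ∫ x, (f x - g x) * Ψ x ∂μ := by
    have hd : Integrable (fun x => (f x - g x) * Ψ x) μ :=
      integrable_mul_of_bounded (hi.sub hgI) hΨ.measurable hΨ.bounded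
    rw [← integral_add (integrable_mul_of_bounded hgI hΨ.measurable hΨ.bounded) hd]
    refine integral_congr_ae (Filter.Eventually.of_forall fun x => ?_)
    simp only
    ring
  set M := μ.real (T.cell k m) with hMdef
  have hM0 : 0 ≤ M := measureReal_nonneg
  have hFp : 0 < F ^ p := Real.rpow_pos_of_pos hF p
  have h3 : 8 * D * A * (Λ * F * ((Λ * F) ^ p)⁻¹) * ∫ x, |f x| ^ p ∂μ ≤ 1 / 2 * A * F * M := by
    calc _ ≤ 8 * D * A * (Λ * F * ((Λ * F) ^ p)⁻¹) * (F ^ p * M) := by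
          gcongr
          exact hf.integral_le
      _ = 1 / 2 * A * F * M * (16 * D * (Λ * (Λ ^ p)⁻¹)) := by
          rw [Real.mul_rpow hΛ0.le hF.le]
          field_simp
          ring
      _ ≤ 1 / 2 * A * F * M * 1 := by gcongr
      _ = _ := mul_one _
  have h4 : 2 * C₀ * ∫ x, |f x| ∂μ ≤ 2 * C₀ * (2 * F * M) := by gcongr
  rw [e]
  refine (abs_add_le _ _).trans ((add_le_add h1 (hb.trans (add_le_add h3 h4))).trans (le_of_eq ?_))
  rw [hA]
  ring

/-- A function whose mean oscillation on bounded functions is controlled by `C₀` on every good cell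
acts on mean-zero `L^p` functions, `p > 1`, with a constant depending only on `C₀`, `D` and `p`.
The bounds on `Ψ` and on the number `N` of generations enter only qualitatively. -/
theorem exists_meanZeroBound (hp : 1 < p) (hD : 1 ≤ D) {C₀ : ℝ} (hC : 0 ≤ C₀) :
    ∃ A, 0 ≤ A ∧ ∀ {E : Type*} [MeasurableSpace E] {μ : Measure E} [IsFiniteMeasure μ] {ι : Type*}
      (T : CellTree μ ι D) (N : ℕ) (Ψ : E → ℝ), HasOscillation T C₀ N Ψ → ∀ m, T.good 0 m →
        MeanZeroBound μ p A Ψ (T.cell 0 m) := by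
  have hD0 : 0 < D := zero_lt_one.trans_le hD
  -- the least `Λ` for which the bad part is at most half of the bound to be proved
  set Λ : ℝ := (16 * D) ^ (1 / (p - 1)) with hΛdef
  have hp1 : 0 < p - 1 := by linarith
  have hΛ : 1 ≤ Λ := Real.one_le_rpow (by linarith) (by positivity)
  have hΛ0 : 0 < Λ := by linarith
  have hΛp : 16 * D * (Λ * (Λ ^ p)⁻¹) ≤ 1 := by
    have h1 : Λ ^ p = Λ ^ (p - 1) * Λ := by
      rw [← Real.rpow_add_one hΛ0.ne']
      congr 1
      ring
    have h2 : Λ ^ (p - 1) = 16 * D := by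
      rw [hΛdef, ← Real.rpow_mul (by positivity), one_div_mul_cancel hp1.ne', Real.rpow_one]
    rw [h1, h2]
    apply le_of_eq
    field_simp
  refine ⟨2 * (2 * C₀ * D * Λ + 4 * C₀), by positivity, ?_⟩
  intro E _ μ _ ι T N Ψ hΨ
  -- from the finest generation to the root; both bounds on the children enter the decomposition
  have key : ∀ j k, k + j = N → ∀ m, T.good k m →
      CalderonZygmundBound μ p (2 * (2 * C₀ * D * Λ + 4 * C₀)) C₀ D Ψ (T.cell k m) ∧
      MeanZeroBound μ p (2 * (2 * C₀ * D * Λ + 4 * C₀)) Ψ (T.cell k m) := by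
    intro j
    induction j with
    | zero =>
      rintro k rfl m hm
      have hS := calderonZygmundBound_fine hΨ hp (A := 2 * (2 * C₀ * D * Λ + 4 * C₀))
        (by positivity) hm
      exact ⟨hS, meanZeroBound_of_calderonZygmundBound hΨ hp hC hΛ hΛp rfl hm hS⟩
    | succ j ih =>
      intro k hk m hm
      have hS := calderonZygmundBound_succ (T := T) hp hC
        (A := 2 * (2 * C₀ * D * Λ + 4 * C₀)) (by positivity) hΨ.measurable hΨ.bounded hm
        (fun m' hm' => (ih (k + 1) (by omega) m' (T.good_children k m hm m' hm')).2)
        (fun m' hm' => (ih (k + 1) (by omega) m' (T.good_children k m hm m' hm')).1)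
      exact ⟨hS, meanZeroBound_of_calderonZygmundBound hΨ hp hC hΛ hΛp rfl hm hS⟩
  exact fun m hm => (key N 0 (zero_add N) m hm).2

end

end GaussianHardy

/-! ### Mean oscillation of the dual operator on admissible sets -/

namespace GaussianHardy

variable {n : ℕ}

/-- The density of the Gaussian measure. -/
noncomputable def gaussDensity (x : EuclideanSpace ℝ (Fin n)) : ℝ :=
  Real.pi ^ (-(n : ℝ) / 2) * Real.exp (-‖x‖ ^ 2)

theorem gaussDensity_pos (x : EuclideanSpace ℝ (Fin n)) : 0 < gaussDensity x := by
  unfold gaussDensity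
  positivity

theorem continuous_gaussDensity : Continuous (gaussDensity (n := n)) := by
  unfold gaussDensity
  fun_prop

theorem gaussMeasure_real_eq {s : Set (EuclideanSpace ℝ (Fin n))} (hs : MeasurableSet s) :
    (gaussMeasure n).real s = ∫ x in s, gaussDensity x := by
  have h := integral_gaussMeasure (s.indicator fun _ : EuclideanSpace ℝ (Fin n) => (1 : ℝ))
  rw [integral_indicator_const _ hs, smul_eq_mul, mul_one] at h
  rw [h, ← integral_indicator hs]
  refine integral_congr_ae (Filter.Eventually.of_forall fun x => ?_)
  by_cases hx : x ∈ s
  · simp [hx, gaussDensity]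
  · simp [hx]

theorem abs_norm_sq_sub_le {κ R : ℝ} {c x : EuclideanSpace ℝ (Fin n)} (hR : R * (1 + ‖c‖) ≤ κ)
    (hx : ‖x - c‖ ≤ R) : |‖x‖ ^ 2 - ‖c‖ ^ 2| ≤ 2 * κ + κ ^ 2 := by
  have h0 : 0 ≤ R := (norm_nonneg _).trans hx
  have hRκ : R ≤ κ := by nlinarith [norm_nonneg c]
  have h1 : |‖x‖ - ‖c‖| ≤ R := (abs_norm_sub_norm_le x c).trans hx
  have h2 : ‖x‖ + ‖c‖ ≤ R + 2 * ‖c‖ := by linarith [(abs_le.1 h1).2]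
  have e : ‖x‖ ^ 2 - ‖c‖ ^ 2 = (‖x‖ - ‖c‖) * (‖x‖ + ‖c‖) := by ring
  rw [e, abs_mul, abs_of_nonneg (by positivity : 0 ≤ ‖x‖ + ‖c‖)]
  calc |‖x‖ - ‖c‖| * (‖x‖ + ‖c‖) ≤ R * (R + 2 * ‖c‖) := by gcongr
    _ ≤ _ := by nlinarith [norm_nonneg c]

/-- On a set of diameter `R ≲ 1/(1 + |c|)` near `c` the Gaussian measure is comparable with the
Lebesgue measure times the density at `c`. -/
theorem gaussMeasure_real_comparison {κ R : ℝ} {c : EuclideanSpace ℝ (Fin n)}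
    (hR : R * (1 + ‖c‖) ≤ κ) {s : Set (EuclideanSpace ℝ (Fin n))} (hs : MeasurableSet s)
    (hsR : s ⊆ Metric.closedBall c R) :
    Real.exp (-(2 * κ + κ ^ 2)) * gaussDensity c * volume.real s ≤ (gaussMeasure n).real s ∧
    (gaussMeasure n).real s ≤ Real.exp (2 * κ + κ ^ 2) * gaussDensity c * volume.real s := by
  have hfin : volume s ≠ ⊤ := measure_ne_top_of_subset hsR (isCompact_closedBall c R).measure_ne_top
  have hi : IntegrableOn (fun x => gaussDensity x) s :=
    (continuous_gaussDensity.continuousOn.integrableOn_compact (isCompact_closedBall c R)).mono_set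
      hsR
  have hb : ∀ x ∈ s, Real.exp (-(2 * κ + κ ^ 2)) * gaussDensity c ≤ gaussDensity x ∧
      gaussDensity x ≤ Real.exp (2 * κ + κ ^ 2) * gaussDensity c := by
    intro x hx
    have h := abs_le.1 (abs_norm_sq_sub_le hR (mem_closedBall_iff_norm.1 (hsR hx)))
    unfold gaussDensity
    rw [mul_left_comm, mul_left_comm (Real.exp (2 * κ + κ ^ 2)), ← Real.exp_add, ← Real.exp_add]
    constructor
    · gcongr
      linarith [h.2]
    · gcongr
      linarith [h.1]
  have hc : ∀ a : ℝ, IntegrableOn (fun _ : EuclideanSpace ℝ (Fin n) => a) s := fun a =>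
    integrableOn_const hfin
  rw [gaussMeasure_real_eq hs]
  constructor
  · have h := setIntegral_mono_on (hc _) hi hs fun x hx => (hb x hx).1
    rw [setIntegral_const, smul_eq_mul] at h
    linarith
  · have h := setIntegral_mono_on hi (hc _) hs fun x hx => (hb x hx).2
    rw [setIntegral_const, smul_eq_mul] at h
    linarith

theorem volume_real_ball (c : EuclideanSpace ℝ (Fin n)) {R : ℝ} (hR : 0 < R) :
    volume.real (Metric.ball c R) =
      R ^ n * volume.real (Metric.ball (0 : EuclideanSpace ℝ (Fin n)) 1) := by
  rw [Measure.real, Measure.addHaar_ball_of_pos _ _ hR, ENNReal.toReal_mul,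
    ENNReal.toReal_ofReal (by positivity), finrank_euclideanSpace_fin]
  rfl

theorem volume_real_ball_pos (c : EuclideanSpace ℝ (Fin n)) {R : ℝ} (hR : 0 < R) :
    0 < volume.real (Metric.ball c R) :=
  ENNReal.toReal_pos (Metric.measure_ball_pos _ _ hR).ne' measure_ball_lt_top.ne

theorem gaussMeasure_real_ball_pos (c : EuclideanSpace ℝ (Fin n)) {R : ℝ} (hR : 0 < R) :
    0 < (gaussMeasure n).real (Metric.ball c R) :=
  lt_of_lt_of_le (mul_pos (mul_pos (Real.exp_pos _) (gaussDensity_pos c))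
    (volume_real_ball_pos c hR))
    (gaussMeasure_real_comparison le_rfl measurableSet_ball Metric.ball_subset_closedBall).1

theorem norm_toLp_le_of_bounded {f : EuclideanSpace ℝ (Fin n) → ℂ}
    {s : Set (EuclideanSpace ℝ (Fin n))} {L : ℝ} (hf : MemLp f 2 (gaussMeasure n)) (hL : 0 ≤ L)
    (hb : ∀ x, ‖f x‖ ≤ L) (h0 : ∀ x ∉ s, f x = 0) :
    ‖hf.toLp f‖ ≤ L * √((gaussMeasure n).real s) := by
  rw [Lp.norm_toLp]
  have h1 : eLpNorm f 2 (gaussMeasure n) ≤ ENNReal.ofReal L * (gaussMeasure n s) ^ (1 / 2 : ℝ) := by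
    have h2 : eLpNorm f 2 (gaussMeasure n) ≤
        eLpNorm (s.indicator fun _ => L) 2 (gaussMeasure n) := by
      refine eLpNorm_mono fun x => ?_
      by_cases hx : x ∈ s
      · rw [Set.indicator_of_mem hx, Real.norm_of_nonneg hL]
        exact hb x
      · rw [h0 x hx, norm_zero]
        exact norm_nonneg _
    refine h2.trans ((eLpNorm_indicator_const_le _ _).trans (le_of_eq ?_))
    rw [Real.enorm_of_nonneg hL]
    norm_num
  refine (ENNReal.toReal_mono (ENNReal.mul_ne_top ENNReal.ofReal_ne_top
    (ENNReal.rpow_ne_top_of_nonneg (by norm_num) (measure_ne_top _ _))) h1).trans (le_of_eq ?_)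
  rw [ENNReal.toReal_mul, ENNReal.toReal_ofReal hL, ← ENNReal.toReal_rpow, Real.sqrt_eq_rpow]
  rfl

/-- The dual operator `Ψ_φ`, `|φ| ≤ 1`, has bounded mean oscillation on admissible sets. The part of
`φ` close to `c` is controlled by the `L²` theory, the remaining part by the kernel estimate. -/
theorem exists_abs_integral_mul_rieszDual_le (α : Fin n → ℕ) {κ : ℝ} (hκ : 0 < κ) {K' : ℝ} :
    ∃ C₀, 0 < C₀ ∧ ∀ (Q : Set (EuclideanSpace ℝ (Fin n))) (c : EuclideanSpace ℝ (Fin n)) (R : ℝ)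
      (φ g : EuclideanSpace ℝ (Fin n) → ℝ) (L : ℝ), 0 < R → R * (1 + ‖c‖) ≤ κ →
      MeasurableSet Q → Q ⊆ Metric.closedBall c R →
      (gaussMeasure n).real (Metric.ball c (3 * R)) ≤ K' * (gaussMeasure n).real Q →
      IsTest φ → (∀ x, |φ x| ≤ 1) → 0 ≤ L → Measurable g → (∀ x, |g x| ≤ L) →
      (∀ x ∉ Q, g x = 0) → ∫ x, g x ∂(gaussMeasure n) = 0 →
      |∫ x, g x * rieszDual α φ x ∂(gaussMeasure n)| ≤ C₀ * L * (gaussMeasure n).real Q := by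
  obtain ⟨K₂, hK₂, hfar⟩ := exists_abs_rieszDual_sub_le α hκ
  set K₁ : ℝ := √((2 * ((∑ i, α i : ℕ) + 1 : ℝ)) ^ (∑ i, α i)) with hK₁
  have hK₁0 : 0 ≤ K₁ := Real.sqrt_nonneg _
  refine ⟨K₁ * √K' + K₂ + 1, by positivity, ?_⟩
  intro Q c R φ g L hR hRc hQ hQR hQK hφ hφ1 hL hg hgL hg0 hgi
  set γ := gaussMeasure n with hγ
  have hgm : MemLp (fun x => (g x : ℂ)) 2 γ :=
    MemLp.of_bound (Complex.measurable_ofReal.comp hg).aestronglyMeasurable L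
      (Filter.Eventually.of_forall fun x => by simpa using hgL x)
  set f : Lp ℂ 2 γ := hgm.toLp _ with hf
  obtain ⟨G, hG, hGn⟩ := exists_isNewRiesz α f
  have hfn : ‖f‖ ≤ L * √(γ.real Q) := norm_toLp_le_of_bounded hgm hL
    (fun x => by simpa using hgL x) (fun x hx => by simp [hg0 x hx])
  have hfe : ∀ ψ : EuclideanSpace ℝ (Fin n) → ℝ,
      ∫ x, f x * (ψ x : ℂ) ∂γ = ((∫ x, g x * ψ x ∂γ : ℝ) : ℂ) := by
    intro ψ
    rw [← integral_complex_ofReal]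
    refine integral_congr_ae ?_
    filter_upwards [hgm.coeFn_toLp] with x hx
    rw [hf, hx]
    push_cast
    rfl
  -- `χ = 1` on `B(c, 2R)`, as the kernel estimate for `φ (1 - χ)` requires
  let χ : ContDiffBump c := ⟨2 * R, 3 * R, by positivity, by linarith⟩
  have hχ : IsTest (χ : EuclideanSpace ℝ (Fin n) → ℝ) := ⟨χ.contDiff, χ.hasCompactSupport⟩
  have hφ1' : IsTest (fun x => φ x * χ x) := ⟨hφ.1.mul hχ.1, hφ.2.mul_right⟩
  have hφ2' : IsTest (fun x => φ x * (1 - χ x)) :=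
    ⟨hφ.1.mul (contDiff_const.sub hχ.1), hφ.2.mul_right⟩
  have hb1 : ∀ x, |φ x * χ x| ≤ 1 := by
    intro x
    rw [abs_mul, abs_of_nonneg χ.nonneg]
    exact mul_le_one₀ (hφ1 x) χ.nonneg χ.le_one
  have hb2 : ∀ x, |φ x * (1 - χ x)| ≤ 1 := by
    intro x
    rw [abs_mul, abs_of_nonneg (a := 1 - χ x) (by linarith [χ.le_one (x := x)])]
    exact mul_le_one₀ (hφ1 x) (by linarith [χ.le_one (x := x)])
      (by linarith [χ.nonneg (x := x)])
  have m := memLp_ofReal hφ.continuous hφ1 2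
  have m1 := memLp_ofReal hφ1'.continuous hb1 2
  have m2 := memLp_ofReal hφ2'.continuous hb2 2
  have hsplit : ∫ x, G x * (φ x : ℂ) ∂γ =
      ∫ x, G x * ((φ x * χ x : ℝ) : ℂ) ∂γ + ∫ x, G x * ((φ x * (1 - χ x) : ℝ) : ℂ) ∂γ := by
    rw [← inner_toLp_ofReal m1, ← inner_toLp_ofReal m2, ← inner_toLp_ofReal m,
      ← inner_add_left, ← MemLp.toLp_add]
    congr 1
    refine MemLp.toLp_congr _ _ (Filter.Eventually.of_forall fun x => ?_)
    simp only [Pi.add_apply]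
    push_cast
    ring
  have hnear : ‖∫ x, G x * ((φ x * χ x : ℝ) : ℂ) ∂γ‖ ≤ K₁ * √K' * L * γ.real Q := by
    rw [← inner_toLp_ofReal m1]
    have h1 : ‖m1.toLp _‖ ≤ 1 * √(γ.real (Metric.ball c (3 * R))) :=
      norm_toLp_le_of_bounded m1 zero_le_one
        (fun x => by simpa only [Complex.norm_real, Real.norm_eq_abs] using hb1 x) (fun x hx => by
          have : χ x = 0 := by
            by_contra h
            have h' : x ∈ Function.support χ := h
            rw [χ.support_eq] at h'
            exact hx h'
          simp [this])
    have h2 : √(γ.real (Metric.ball c (3 * R))) ≤ √K' * √(γ.real Q) := by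
      rw [← Real.sqrt_mul' _ measureReal_nonneg]
      exact Real.sqrt_le_sqrt hQK
    calc _ ≤ ‖m1.toLp _‖ * ‖G‖ := norm_inner_le_norm _ _
      _ ≤ (√K' * √(γ.real Q)) * (K₁ * (L * √(γ.real Q))) := by
          gcongr
          · linarith
          · exact hGn.trans (by gcongr)
      _ = K₁ * √K' * L * (√(γ.real Q) * √(γ.real Q)) := by ring
      _ = _ := by rw [Real.mul_self_sqrt measureReal_nonneg]
  have hfarI : |∫ x, g x * rieszDual α (fun x => φ x * (1 - χ x)) x ∂γ| ≤ K₂ * L * γ.real Q := by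
    set Ψ := rieszDual α (fun x => φ x * (1 - χ x)) with hΨ
    obtain ⟨B, -, hB⟩ := exists_abs_rieszDual_le α hφ2'
    have hgI : Integrable g γ := integrable_of_bounded hg hgL
    have hgΨ : Integrable (fun x => g x * Ψ x) γ :=
      integrable_mul_of_bounded hgI (continuous_rieszDual α hφ2').measurable ⟨B, hB⟩
    have e : ∫ x, g x * Ψ x ∂γ = ∫ x, g x * (Ψ x - Ψ c) ∂γ := by
      simp_rw [mul_sub]
      rw [integral_sub hgΨ (hgI.mul_const _), integral_mul_const, hgi, zero_mul, sub_zero]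
    rw [e, ← Real.norm_eq_abs]
    refine (norm_integral_le_of_norm_le (g := Q.indicator fun _ => L * K₂)
      ((integrable_const _).indicator hQ) (Filter.Eventually.of_forall fun x => ?_)).trans
      (le_of_eq ?_)
    · by_cases hx : x ∈ Q
      · rw [Set.indicator_of_mem hx, norm_mul]
        refine mul_le_mul (hgL x) ?_ (norm_nonneg _) hL
        refine hfar c R _ hR hRc hφ2' hb2 (fun y hy => ?_) x (mem_closedBall_iff_norm.1 (hQR hx))
        have : χ y = 1 := χ.one_of_mem_closedBall (mem_closedBall_iff_norm.2 hy.le)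
        rw [this, sub_self, mul_zero]
      · rw [Set.indicator_of_notMem hx, hg0 x hx, zero_mul, norm_zero]
    · rw [integral_indicator_const _ hQ, smul_eq_mul]
      ring
  have hmain : ((∫ x, g x * rieszDual α φ x ∂γ : ℝ) : ℂ) =
      ∫ x, G x * ((φ x * χ x : ℝ) : ℂ) ∂γ +
        ((∫ x, g x * rieszDual α (fun x => φ x * (1 - χ x)) x ∂γ : ℝ) : ℂ) := by
    rw [← hfe, ← hfe, ← hG.integral_mul_eq hφ, hsplit, hG.integral_mul_eq hφ2']
  have h := congrArg norm hmain
  rw [Complex.norm_real, Real.norm_eq_abs] at h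
  rw [h]
  refine (norm_add_le _ _).trans ?_
  rw [Complex.norm_real, Real.norm_eq_abs]
  have : 0 ≤ L * γ.real Q := by positivity
  nlinarith

end GaussianHardy

/-! ### Dyadic cells -/

namespace GaussianHardy

variable {n : ℕ}

/-- The dyadic cell of generation `k` and index `m` in the grid with origin `o` and initial side
length `ℓ`: a half-open cube of side length `ℓ / 2^k`. -/
def dyadicCell (o : EuclideanSpace ℝ (Fin n)) (ℓ : ℝ) (k : ℕ) (m : Fin n → ℤ) :
    Set (EuclideanSpace ℝ (Fin n)) :=
  {x | ∀ i, ⌊2 ^ k * ((x i - o i) / ℓ)⌋ = m i}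

/-- The indices of the `2^n` cells into which a dyadic cell splits. -/
def dyadicChildren (m : Fin n → ℤ) : Finset (Fin n → ℤ) :=
  Fintype.piFinset fun i => {2 * m i, 2 * m i + 1}

variable {o : EuclideanSpace ℝ (Fin n)} {ℓ : ℝ}

theorem measurableSet_dyadicCell (k : ℕ) (m : Fin n → ℤ) :
    MeasurableSet (dyadicCell o ℓ k m) := by
  have : dyadicCell o ℓ k m = ⋂ i, {x | ⌊2 ^ k * ((x i - o i) / ℓ)⌋ = m i} := by
    ext x
    simp [dyadicCell]
  rw [this]
  refine MeasurableSet.iInter fun i => ?_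
  exact measurableSet_eq_fun (Int.measurable_floor.comp (by fun_prop)) measurable_const

theorem floor_eq_iff_floor_two_mul (t : ℝ) (j : ℤ) :
    ⌊t⌋ = j ↔ ⌊2 * t⌋ = 2 * j ∨ ⌊2 * t⌋ = 2 * j + 1 := by
  have h1 := Int.floor_le t
  have h2 := Int.lt_floor_add_one t
  have h3 := Int.floor_le (2 * t)
  have h4 := Int.lt_floor_add_one (2 * t)
  set a := ⌊t⌋
  set b := ⌊2 * t⌋
  have h5 : (b : ℝ) < ((2 * a + 2 : ℤ) : ℝ) := by push_cast; linarith
  have h6 : ((2 * a : ℤ) : ℝ) < ((b + 1 : ℤ) : ℝ) := by push_cast; linarith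
  have h7 := Int.cast_lt.1 h5
  have h8 := Int.cast_lt.1 h6
  omega

theorem mem_dyadicCell_iff (k : ℕ) (m : Fin n → ℤ) (x : EuclideanSpace ℝ (Fin n)) :
    x ∈ dyadicCell o ℓ k m ↔ ∃ m' ∈ dyadicChildren m, x ∈ dyadicCell o ℓ (k + 1) m' := by
  have e : ∀ i, 2 ^ (k + 1) * ((x i - o i) / ℓ) = 2 * (2 ^ k * ((x i - o i) / ℓ)) := fun i => by
    rw [pow_succ]
    ring
  simp only [dyadicCell, Set.mem_ofPred_eq, dyadicChildren, Fintype.mem_piFinset,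
    Finset.mem_insert, Finset.mem_singleton, e]
  constructor
  · intro h
    exact ⟨fun i => ⌊2 * (2 ^ k * ((x i - o i) / ℓ))⌋,
      fun i => (floor_eq_iff_floor_two_mul _ _).1 (h i), fun i => rfl⟩
  · rintro ⟨m', hm', h⟩ i
    rw [floor_eq_iff_floor_two_mul, h i]
    exact hm' i

theorem dyadicCell_succ_subset {k : ℕ} {m m' : Fin n → ℤ} (h : m' ∈ dyadicChildren m) :
    dyadicCell o ℓ (k + 1) m' ⊆ dyadicCell o ℓ k m := fun x hx =>
  (mem_dyadicCell_iff k m x).2 ⟨m', h, hx⟩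

theorem disjoint_dyadicCell (k : ℕ) (m m' : Fin n → ℤ) (h : m ≠ m') :
    Disjoint (dyadicCell o ℓ k m) (dyadicCell o ℓ k m') := by
  rw [Set.disjoint_left]
  intro x hx hx'
  exact h (funext fun i => (hx i).symm.trans (hx' i))

theorem mem_dyadicCell_iff_Ico (hℓ : 0 < ℓ) (k : ℕ) (m : Fin n → ℤ)
    (x : EuclideanSpace ℝ (Fin n)) :
    x ∈ dyadicCell o ℓ k m ↔
      ∀ i, x i ∈ Set.Ico (o i + m i * (ℓ / 2 ^ k)) (o i + m i * (ℓ / 2 ^ k) + ℓ / 2 ^ k) := by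
  have hk : (0 : ℝ) < 2 ^ k := by positivity
  refine forall_congr' fun i => ?_
  have e : x i = o i + (2 ^ k * ((x i - o i) / ℓ)) * (ℓ / 2 ^ k) := by
    field_simp
    ring
  have hs : 0 < ℓ / 2 ^ k := by positivity
  rw [Int.floor_eq_iff, Set.mem_Ico]
  set t := 2 ^ k * ((x i - o i) / ℓ)
  rw [e]
  constructor
  · rintro ⟨h1, h2⟩
    constructor <;> nlinarith
  · rintro ⟨h1, h2⟩
    constructor
    · exact le_of_mul_le_mul_right (by linarith) hs
    · exact lt_of_mul_lt_mul_right (by linarith) hs.le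

theorem volume_real_dyadicCell (hℓ : 0 < ℓ) (k : ℕ) (m : Fin n → ℤ) :
    volume.real (dyadicCell o ℓ k m) = (ℓ / 2 ^ k) ^ n := by
  have hs : 0 < ℓ / 2 ^ k := by positivity
  have e : dyadicCell o ℓ k m = (MeasurableEquiv.toLp 2 (Fin n → ℝ)).symm ⁻¹'
      (Set.univ.pi fun i => Set.Ico (o i + m i * (ℓ / 2 ^ k))
        (o i + m i * (ℓ / 2 ^ k) + ℓ / 2 ^ k)) := by
    ext x
    rw [mem_dyadicCell_iff_Ico hℓ, Set.mem_preimage, Set.mem_univ_pi]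
    rfl
  rw [Measure.real, e,
    (EuclideanSpace.volume_preserving_symm_measurableEquiv_toLp (Fin n)).measure_preimage_equiv,
    Real.volume_pi_Ico, ENNReal.toReal_prod]
  simp [ENNReal.toReal_ofReal hs.le, div_pow]

theorem norm_sub_le_of_forall_abs_sub_le {x y : EuclideanSpace ℝ (Fin n)} {s : ℝ} (hs : 0 ≤ s)
    (h : ∀ i, |x i - y i| ≤ s) : ‖x - y‖ ≤ (n + 1) * s := by
  rw [EuclideanSpace.norm_eq]
  refine Real.sqrt_le_iff.2 ⟨by positivity, ?_⟩
  calc ∑ i, ‖(x - y) i‖ ^ 2 ≤ ∑ _i : Fin n, s ^ 2 :=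
        Finset.sum_le_sum fun i _ => by
          have := h i
          rw [Real.norm_eq_abs, PiLp.sub_apply]
          gcongr
    _ = n * s ^ 2 := by simp
    _ ≤ ((n + 1) * s) ^ 2 := by
        have : (0 : ℝ) ≤ n := n.cast_nonneg
        have h2 : 0 ≤ (n * n + n + 1) * s ^ 2 := by positivity
        nlinarith

theorem norm_sub_le_of_mem_dyadicCell (hℓ : 0 < ℓ) {k : ℕ} {m : Fin n → ℤ}
    {x y : EuclideanSpace ℝ (Fin n)} (hx : x ∈ dyadicCell o ℓ k m) (hy : y ∈ dyadicCell o ℓ k m) :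
    ‖x - y‖ ≤ (n + 1) * (ℓ / 2 ^ k) := by
  rw [mem_dyadicCell_iff_Ico hℓ] at hx hy
  refine norm_sub_le_of_forall_abs_sub_le (by positivity) fun i => ?_
  have h1 := hx i
  have h2 := hy i
  rw [Set.mem_Ico] at h1 h2
  rw [abs_le]
  constructor <;> linarith

theorem dyadicCell_nonempty (hℓ : 0 < ℓ) (k : ℕ) (m : Fin n → ℤ) :
    (dyadicCell o ℓ k m).Nonempty := by
  have hs : 0 < ℓ / 2 ^ k := by positivity
  refine ⟨WithLp.toLp 2 fun i => o i + m i * (ℓ / 2 ^ k), ?_⟩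
  rw [mem_dyadicCell_iff_Ico hℓ]
  intro i
  simp [hℓ]

/-- The cells relevant to the estimate on the cell `m₀` of generation zero: they lie in that cell,
and their size is at most of order `1/(1 + |x|)`. -/
def IsAdmissibleCell (o : EuclideanSpace ℝ (Fin n)) (ℓ κ : ℝ) (m₀ : Fin n → ℤ) (k : ℕ)
    (m : Fin n → ℤ) : Prop :=
  dyadicCell o ℓ k m ⊆ dyadicCell o ℓ 0 m₀ ∧
    ∀ x ∈ dyadicCell o ℓ k m, ℓ / 2 ^ k * (1 + ‖x‖) ≤ κ

theorem IsAdmissibleCell.exists_center {κ : ℝ} {m₀ : Fin n → ℤ} {k : ℕ} {m : Fin n → ℤ}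
    (hℓ : 0 < ℓ) (h : IsAdmissibleCell o ℓ κ m₀ k m) :
    ∃ c, dyadicCell o ℓ k m ⊆ Metric.closedBall c ((n + 1) * (ℓ / 2 ^ k)) ∧
      (n + 1) * (ℓ / 2 ^ k) * (1 + ‖c‖) ≤ (n + 1) * κ := by
  obtain ⟨c, hc⟩ := dyadicCell_nonempty (o := o) hℓ k m
  refine ⟨c, fun x hx => mem_closedBall_iff_norm.2 (norm_sub_le_of_mem_dyadicCell hℓ hx hc), ?_⟩
  rw [mul_assoc]
  have := h.2 c hc
  gcongr

/-- The doubling constant of admissible dyadic cells. -/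
noncomputable def dyadicDoubling (n : ℕ) (κ : ℝ) : ℝ :=
  Real.exp (2 * (2 * ((n + 1) * κ) + ((n + 1) * κ) ^ 2)) * 2 ^ n

theorem gaussMeasure_real_dyadicCell_pos {κ : ℝ} {m₀ : Fin n → ℤ} {k : ℕ} {m : Fin n → ℤ}
    (hℓ : 0 < ℓ) (h : IsAdmissibleCell o ℓ κ m₀ k m) :
    0 < (gaussMeasure n).real (dyadicCell o ℓ k m) := by
  obtain ⟨c, hc, hκ⟩ := h.exists_center hℓ
  have h1 := (gaussMeasure_real_comparison hκ (measurableSet_dyadicCell k m) hc).1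
  rw [volume_real_dyadicCell hℓ] at h1
  have := gaussDensity_pos c
  exact lt_of_lt_of_le (by positivity) h1

theorem gaussMeasure_real_dyadicCell_le {κ : ℝ} {m₀ : Fin n → ℤ} {k : ℕ} {m m' : Fin n → ℤ}
    (hℓ : 0 < ℓ) (h : IsAdmissibleCell o ℓ κ m₀ k m) (hm' : m' ∈ dyadicChildren m) :
    (gaussMeasure n).real (dyadicCell o ℓ k m) ≤
      dyadicDoubling n κ * (gaussMeasure n).real (dyadicCell o ℓ (k + 1) m') := by
  obtain ⟨c, hc, hκ⟩ := h.exists_center hℓ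
  have h1 := (gaussMeasure_real_comparison hκ (measurableSet_dyadicCell k m) hc).2
  have h2 := (gaussMeasure_real_comparison hκ (measurableSet_dyadicCell (k + 1) m')
    ((dyadicCell_succ_subset hm').trans hc)).1
  rw [volume_real_dyadicCell hℓ] at h1 h2
  set M := 2 * ((n + 1) * κ) + ((n + 1) * κ) ^ 2
  refine h1.trans (le_trans (le_of_eq ?_) (mul_le_mul_of_nonneg_left h2
    (by unfold dyadicDoubling; positivity)))
  have e : dyadicDoubling n κ * Real.exp (-M) = Real.exp M * 2 ^ n := by
    unfold dyadicDoubling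
    rw [mul_right_comm, ← Real.exp_add]
    congr 2
    ring
  calc _ = Real.exp M * 2 ^ n * (gaussDensity c * (ℓ / 2 ^ (k + 1)) ^ n) := by
        have : ℓ / 2 ^ k = 2 * (ℓ / 2 ^ (k + 1)) := by
          rw [pow_succ]
          field_simp
        rw [this, mul_pow]
        ring
    _ = _ := by
        rw [← e]
        ring

/-- The tree of admissible dyadic cells contained in a fixed cell of generation zero. -/
noncomputable def dyadicTree (o : EuclideanSpace ℝ (Fin n)) (hℓ : 0 < ℓ) {κ : ℝ} (hκ : 0 < κ)
    (m₀ : Fin n → ℤ) : CellTree (gaussMeasure n) (Fin n → ℤ) (dyadicDoubling n κ) where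
  cell := dyadicCell o ℓ
  children := dyadicChildren
  good := IsAdmissibleCell o ℓ κ m₀
  one_le := one_le_mul_of_one_le_of_one_le (Real.one_le_exp (by positivity))
    (one_le_pow₀ one_le_two)
  measurableSet_cell := measurableSet_dyadicCell
  mem_cell_iff := mem_dyadicCell_iff
  disjoint_cell := disjoint_dyadicCell
  good_children k m h m' hm' := by
    refine ⟨(dyadicCell_succ_subset hm').trans h.1, fun x hx => ?_⟩
    refine le_trans ?_ (h.2 x (dyadicCell_succ_subset hm' hx))
    gcongr
    · exact one_le_two
    · omega
  measure_le k m h m' hm' := gaussMeasure_real_dyadicCell_le hℓ h hm'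
  measure_pos k m h := gaussMeasure_real_dyadicCell_pos hℓ h

/-- Balls with the size of an admissible cell have measure comparable to that of the cell. -/
theorem exists_gaussMeasure_real_ball_le (n : ℕ) (κ : ℝ) :
    ∃ K' : ℝ, ∀ (o : EuclideanSpace ℝ (Fin n)) (ℓ : ℝ) (k : ℕ) (m : Fin n → ℤ)
      (c : EuclideanSpace ℝ (Fin n)), 0 < ℓ →
      dyadicCell o ℓ k m ⊆ Metric.closedBall c ((n + 1) * (ℓ / 2 ^ k)) →
      (n + 1) * (ℓ / 2 ^ k) * (1 + ‖c‖) ≤ κ →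
      (gaussMeasure n).real (Metric.ball c (3 * ((n + 1) * (ℓ / 2 ^ k)))) ≤
        K' * (gaussMeasure n).real (dyadicCell o ℓ k m) := by
  set M := 2 * κ + κ ^ 2 with hM
  set M' := 2 * (3 * κ) + (3 * κ) ^ 2 with hM'
  set V := volume.real (Metric.ball (0 : EuclideanSpace ℝ (Fin n)) 1) with hV
  have hV0 : 0 ≤ V := measureReal_nonneg
  refine ⟨Real.exp (M + M') * (3 * (n + 1)) ^ n * V, fun o ℓ k m c hℓ hc hκ => ?_⟩
  have h1 := (gaussMeasure_real_comparison hκ (measurableSet_dyadicCell k m) hc).1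
  have h2 := (gaussMeasure_real_comparison (κ := 3 * κ) (c := c)
    (R := 3 * ((n + 1) * (ℓ / 2 ^ k))) (by linarith) measurableSet_ball
    Metric.ball_subset_closedBall).2
  rw [volume_real_dyadicCell hℓ] at h1
  rw [volume_real_ball _ (by positivity)] at h2
  refine h2.trans (le_trans (le_of_eq ?_) (mul_le_mul_of_nonneg_left h1 (by positivity)))
  rw [← hM, ← hM', ← hV, Real.exp_add M M', Real.exp_neg, ← mul_assoc 3, mul_pow _ (ℓ / 2 ^ k)]
  generalize M = a
  generalize M' = b
  field_simp

theorem dyadicCell_zero_zero_subset {c : EuclideanSpace ℝ (Fin n)} {ρ : ℝ} (hρ : 0 < ρ) :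
    dyadicCell (WithLp.toLp 2 fun i => c i - ρ) (2 * ρ) 0 0 ⊆
      Metric.closedBall c ((n + 1) * ρ) := by
  intro x hx
  rw [mem_dyadicCell_iff_Ico (by positivity)] at hx
  refine mem_closedBall_iff_norm.2 (norm_sub_le_of_forall_abs_sub_le hρ.le fun i => ?_)
  have h := hx i
  simp only [Set.mem_Ico, Pi.zero_apply, Int.cast_zero, zero_mul, add_zero, pow_zero,
    div_one] at h
  rw [abs_le]
  constructor <;> linarith

theorem ball_subset_dyadicCell_zero_zero {c : EuclideanSpace ℝ (Fin n)} {ρ : ℝ} (hρ : 0 < ρ) :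
    Metric.ball c ρ ⊆ dyadicCell (WithLp.toLp 2 fun i => c i - ρ) (2 * ρ) 0 0 := by
  intro x hx
  rw [mem_dyadicCell_iff_Ico (by positivity)]
  intro i
  have h : |x i - c i| < ρ :=
    (PiLp.norm_apply_le (x - c) i).trans_lt (mem_ball_iff_norm.1 hx)
  rw [abs_lt] at h
  simp only [Set.mem_Ico, Pi.zero_apply, Int.cast_zero, zero_mul, add_zero, pow_zero,
    div_one]
  constructor <;> linarith

theorem radius_mul_le {c : EuclideanSpace ℝ (Fin n)} {ρ : ℝ} (h0 : 0 < ρ)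
    (h : ρ ≤ admissibleRadius ‖c‖) : ρ ≤ 1 ∧ ρ * (1 + ‖c‖) ≤ 2 := by
  unfold admissibleRadius at h
  split_ifs at h with hc
  · exact ⟨h, by nlinarith [norm_nonneg c]⟩
  · push Not at hc
    have h1 : ρ * ‖c‖ ≤ 1 := by
      rwa [le_div_iff₀ (by linarith)] at h
    have h2 : ρ ≤ 1 := h.trans (by rw [div_le_one (by linarith)]; exact hc.le)
    exact ⟨h2, by linarith⟩

/-- The main estimate, in its dual form: functions of mean zero supported in an admissible ball and
normalized in `L^p`, `p > 1`, act boundedly on `Ψ_φ`, `|φ| ≤ 1`. -/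
theorem exists_meanZeroBound_rieszDual (α : Fin n → ℕ) {p : ℝ} (hp : 1 < p) :
    ∃ A, 0 ≤ A ∧ ∀ (c : EuclideanSpace ℝ (Fin n)) (ρ : ℝ) (φ : EuclideanSpace ℝ (Fin n) → ℝ),
      0 < ρ → ρ ≤ admissibleRadius ‖c‖ → IsTest φ → (∀ x, |φ x| ≤ 1) →
      MeanZeroBound (gaussMeasure n) p A (rieszDual α φ) (Metric.ball c ρ) := by
  -- the root cell has side `2ρ`, and `2ρ (1 + |x|) ≤ κ` on it since `ρ ≤ 1` and `ρ (1 + |c|) ≤ 2`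
  set κ : ℝ := 2 * n + 6 with hκ
  have hκ0 : 0 < κ := by positivity
  obtain ⟨K', hK'⟩ := exists_gaussMeasure_real_ball_le n ((n + 1) * κ)
  obtain ⟨C₀, hC₀, hosc⟩ := exists_abs_integral_mul_rieszDual_le α (κ := (n + 1) * κ)
    (by positivity) (K' := K')
  have hD : 1 ≤ dyadicDoubling n κ := one_le_mul_of_one_le_of_one_le
    (Real.one_le_exp (by positivity)) (one_le_pow₀ one_le_two)
  obtain ⟨A, hA, hmain⟩ := exists_meanZeroBound hp hD hC₀.le
  set τ : ℝ := (n + 1) * 2 with hτ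
  set V := volume.real (Metric.ball (0 : EuclideanSpace ℝ (Fin n)) 1) with hV
  have hV0 : 0 < V := volume_real_ball_pos _ one_pos
  set K₃ : ℝ := Real.exp (2 * (2 * τ + τ ^ 2)) * 2 ^ n * V⁻¹ with hK₃
  have hK₃0 : 0 ≤ K₃ := by positivity
  refine ⟨A * K₃, by positivity, fun c ρ φ hρ hρc hφ hφ1 f F hF hf hf0 => ?_⟩
  obtain ⟨hρ1, hρ2⟩ := radius_mul_le hρ hρc
  set o : EuclideanSpace ℝ (Fin n) := WithLp.toLp 2 fun i => c i - ρ with ho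
  have hℓ : 0 < 2 * ρ := by positivity
  set T := dyadicTree o hℓ hκ0 0 with hT
  have hQc : dyadicCell o (2 * ρ) 0 0 ⊆ Metric.closedBall c ((n + 1) * ρ) :=
    dyadicCell_zero_zero_subset hρ
  have hBQ : Metric.ball c ρ ⊆ dyadicCell o (2 * ρ) 0 0 := ball_subset_dyadicCell_zero_zero hρ
  have hroot : T.good 0 0 := by
    refine ⟨subset_rfl, fun x hx => ?_⟩
    have h1 := mem_closedBall_iff_norm.1 (hQc hx)
    have h2 : ‖x‖ ≤ ‖c‖ + (n + 1) * ρ := by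
      have := norm_sub_norm_le x c
      linarith
    rw [pow_zero, div_one]
    calc 2 * ρ * (1 + ‖x‖) ≤ 2 * ρ * (1 + (‖c‖ + (n + 1) * ρ)) := by gcongr
      _ = 2 * (ρ * (1 + ‖c‖)) + 2 * (n + 1) * (ρ * ρ) := by ring
      _ ≤ 2 * 2 + 2 * (n + 1) * (1 * 1) := by gcongr
      _ = κ := by rw [hκ]; ring
  -- `Ψ_φ` is uniformly continuous on the root cell, hence almost constant on very small cells
  have huc := (isCompact_closedBall c ((n + 1) * ρ)).uniformContinuousOn_of_continuous
    (continuous_rieszDual α hφ).continuousOn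
  obtain ⟨δ, hδ, hδ'⟩ := Metric.uniformContinuousOn_iff_le.1 huc C₀ hC₀
  obtain ⟨N, hN⟩ := exists_pow_lt_of_lt_one (show 0 < δ / ((n + 1) * (2 * ρ)) by positivity)
    (show (1 / 2 : ℝ) < 1 by norm_num)
  have hN' : (n + 1) * (2 * ρ / 2 ^ N) ≤ δ := by
    rw [lt_div_iff₀ (by positivity), one_div, inv_pow] at hN
    calc (n + 1) * (2 * ρ / 2 ^ N) = (2 ^ N)⁻¹ * ((n + 1) * (2 * ρ)) := by
          rw [div_eq_mul_inv]
          ring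
      _ ≤ δ := hN.le
  have hΨ : HasOscillation T C₀ N (rieszDual α φ) := by
    obtain ⟨B, -, hB⟩ := exists_abs_rieszDual_le α hφ
    refine ⟨(continuous_rieszDual α hφ).measurable, ⟨B, hB⟩, ?_, ?_⟩
    · intro k m hm g L hL hg hgL hg0 hgi
      obtain ⟨c', hc', hκ'⟩ := IsAdmissibleCell.exists_center hℓ hm
      exact hosc _ c' _ φ g L (by positivity) hκ' (measurableSet_dyadicCell k m) hc'
        (hK' o (2 * ρ) k m c' hℓ hc' hκ') hφ hφ1 hL hg hgL hg0 hgi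
    · intro m hm x hx y hy
      refine hδ' x (hQc (hm.1 hx)) y (hQc (hm.1 hy)) ?_
      rw [dist_eq_norm]
      exact (norm_sub_le_of_mem_dyadicCell hℓ hx hy).trans hN'
  have hmeas : (gaussMeasure n).real (dyadicCell o (2 * ρ) 0 0) ≤
      K₃ * (gaussMeasure n).real (Metric.ball c ρ) := by
    have hτ' : (n + 1) * ρ * (1 + ‖c‖) ≤ τ := by
      rw [mul_assoc, hτ]
      gcongr
    have h1 := (gaussMeasure_real_comparison hτ' (measurableSet_dyadicCell 0 0) hQc).2
    have h2 := (gaussMeasure_real_comparison hτ' measurableSet_ball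
      (Metric.ball_subset_closedBall.trans (Metric.closedBall_subset_closedBall (x := c)
        (show ρ ≤ (n + 1) * ρ by nlinarith [n.cast_nonneg (α := ℝ)])))).1
    rw [volume_real_dyadicCell hℓ] at h1
    rw [volume_real_ball _ hρ] at h2
    refine h1.trans (le_trans (le_of_eq ?_) (mul_le_mul_of_nonneg_left h2 hK₃0))
    rw [hK₃, ← hV, two_mul (2 * τ + τ ^ 2)]
    generalize 2 * τ + τ ^ 2 = a
    rw [Real.exp_add, Real.exp_neg, pow_zero, div_one, mul_pow]
    field_simp
  have h := hmain T N _ hΨ 0 hroot f F hF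
    ⟨hf.integrable, hf.integrable_rpow, fun x hx => hf.eq_zero x fun h => hx (hBQ h),
      hf.integral_le.trans (mul_le_mul_of_nonneg_left
        (measureReal_mono hBQ (measure_ne_top _ _)) (by positivity))⟩ hf0
  refine h.trans ?_
  calc A * F * (gaussMeasure n).real (dyadicCell o (2 * ρ) 0 0)
      ≤ A * F * (K₃ * (gaussMeasure n).real (Metric.ball c ρ)) := by gcongr
    _ = _ := by ring

end GaussianHardy

/-! ### Duality with test functions -/

namespace GaussianHardy

variable {n : ℕ}

theorem exists_isTest_one_zero {K K' : Set (EuclideanSpace ℝ (Fin n))} (hK : IsCompact K)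
    (hK' : IsCompact K') (h : Disjoint K K') :
    ∃ φ : EuclideanSpace ℝ (Fin n) → ℝ, IsTest φ ∧ (∀ x, 0 ≤ φ x) ∧ (∀ x, φ x ≤ 1) ∧
      (∀ x ∈ K, φ x = 1) ∧ ∀ x ∈ K', φ x = 0 := by
  obtain ⟨R, hR⟩ := hK.isBounded.subset_ball 0
  have hs : IsClosed (K' ∪ (Metric.ball (0 : EuclideanSpace ℝ (Fin n)) R)ᶜ) :=
    hK'.isClosed.union Metric.isOpen_ball.isClosed_compl
  obtain ⟨f, h0, h1, h01⟩ := exists_contMDiffMap_zero_one_of_isClosed (n := ⊤)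
    (modelWithCornersSelf ℝ (EuclideanSpace ℝ (Fin n))) hs hK.isClosed (by
      rw [Set.disjoint_union_left]
      exact ⟨h.symm, Set.disjoint_left.2 fun x hx hx' => hx (hR hx')⟩)
  refine ⟨f, ⟨contMDiff_iff_contDiff.1 f.contMDiff, ?_⟩, fun x => (h01 x).1, fun x => (h01 x).2,
    fun x hx => h1 hx, fun x hx => h0 (Or.inl hx)⟩
  refine HasCompactSupport.of_support_subset_isCompact
    (isCompact_closedBall (0 : EuclideanSpace ℝ (Fin n)) R) fun x hx => ?_
  by_contra hxR
  exact hx (h0 (Or.inr fun h => hxR (Metric.ball_subset_closedBall h)))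

theorem integrable_mul_isTest {h φ : EuclideanSpace ℝ (Fin n) → ℝ}
    (hh : Integrable h (gaussMeasure n)) (hφ : IsTest φ) :
    Integrable (fun x => h x * φ x) (gaussMeasure n) := by
  obtain ⟨C, -, hC⟩ := hφ.exists_bound
  exact integrable_mul_of_bounded hh hφ.continuous.measurable ⟨C, hC⟩

/-- The sign of `h` is approximated by the difference of two cutoff functions of disjoint compact
sets, on which `h` is positive and negative, respectively. -/
theorem integral_abs_le_of_forall_isTest {h : EuclideanSpace ℝ (Fin n) → ℝ}
    (hm : Measurable h) (hh : Integrable h (gaussMeasure n)) {K : ℝ}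
    (hK : ∀ φ, IsTest φ → (∀ x, |φ x| ≤ 1) → |∫ x, h x * φ x ∂(gaussMeasure n)| ≤ K) :
    ∫ x, |h x| ∂(gaussMeasure n) ≤ K := by
  set γ := gaussMeasure n with hγ
  refine le_of_forall_pos_le_add fun ε hε => ?_
  -- sets of small measure for `|h| dγ` carry a small part of the integral
  set ν : Measure (EuclideanSpace ℝ (Fin n)) := γ.withDensity fun x => ‖h x‖ₑ with hν
  have : IsFiniteMeasure ν := isFiniteMeasure_withDensity hh.2.ne
  have hνε : ∀ s, MeasurableSet s → ν s < ENNReal.ofReal (ε / 4) →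
      ∫ x, s.indicator (fun x => |h x|) x ∂γ ≤ ε / 4 := by
    intro s hs hsε
    rw [integral_indicator hs]
    have e := integral_norm_eq_lintegral_enorm (μ := γ.restrict s) hh.1.restrict
    simp only [Real.norm_eq_abs] at e
    rw [e, ← withDensity_apply _ hs]
    exact (ENNReal.toReal_le_of_le_ofReal (by positivity) hsε.le)
  have hε0 : ENNReal.ofReal (ε / 4) ≠ 0 := by
    rw [ne_eq, ENNReal.ofReal_eq_zero, not_le]
    positivity
  have hP : MeasurableSet {x | 0 < h x} := measurableSet_lt measurable_const hm
  have hN : MeasurableSet {x | h x < 0} := measurableSet_lt hm measurable_const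
  obtain ⟨K₁, hK₁, hK₁c, hK₁ε⟩ := hP.exists_isCompact_sdiff_lt (measure_ne_top ν _) hε0
  obtain ⟨K₂, hK₂, hK₂c, hK₂ε⟩ := hN.exists_isCompact_sdiff_lt (measure_ne_top ν _) hε0
  have hd : Disjoint K₁ K₂ := Set.disjoint_left.2 fun x h1 h2 =>
    lt_asymm (show 0 < h x from hK₁ h1) (hK₂ h2)
  obtain ⟨φ₁, t1, n1, l1, o1, z1⟩ := exists_isTest_one_zero hK₁c hK₂c hd
  obtain ⟨φ₂, t2, n2, l2, o2, z2⟩ := exists_isTest_one_zero hK₂c hK₁c hd.symm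
  have ht : IsTest (fun x => φ₁ x - φ₂ x) := ⟨t1.1.sub t2.1, t1.2.sub t2.2⟩
  have hb : ∀ x, |φ₁ x - φ₂ x| ≤ 1 := fun x => by
    rw [abs_le]
    constructor <;> linarith [n1 x, n2 x, l1 x, l2 x]
  set A₁ := {x | 0 < h x} \ K₁ with hA₁
  set A₂ := {x | h x < 0} \ K₂ with hA₂
  have hA₁m : MeasurableSet A₁ := hP.diff hK₁c.measurableSet
  have hA₂m : MeasurableSet A₂ := hN.diff hK₂c.measurableSet
  have i1 : Integrable (A₁.indicator fun x => |h x|) γ := hh.abs.indicator hA₁m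
  have i2 : Integrable (A₂.indicator fun x => |h x|) γ := hh.abs.indicator hA₂m
  have i3 : Integrable (fun x => h x * (φ₁ x - φ₂ x)) γ := integrable_mul_isTest hh ht
  have hpt : ∀ x, |h x| ≤ h x * (φ₁ x - φ₂ x) + (2 * A₁.indicator (fun x => |h x|) x +
      2 * A₂.indicator (fun x => |h x|) x) := by
    intro x
    have g1 : 0 ≤ A₁.indicator (fun x => |h x|) x :=
      Set.indicator_nonneg (fun _ _ => abs_nonneg _) x
    have g2 : 0 ≤ A₂.indicator (fun x => |h x|) x :=
      Set.indicator_nonneg (fun _ _ => abs_nonneg _) x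
    have g3 : -|h x| ≤ h x * (φ₁ x - φ₂ x) := by
      refine neg_le_of_abs_le ?_
      rw [abs_mul]
      exact mul_le_of_le_one_right (abs_nonneg _) (hb x)
    rcases lt_trichotomy (h x) 0 with hx | hx | hx
    · by_cases hx2 : x ∈ K₂
      · rw [z1 x hx2, o2 x hx2, abs_of_neg hx]
        linarith
      · rw [Set.indicator_of_mem (show x ∈ A₂ from ⟨hx, hx2⟩)]
        linarith
    · rw [hx, abs_zero, zero_mul]
      linarith
    · by_cases hx1 : x ∈ K₁
      · rw [o1 x hx1, z2 x hx1, abs_of_pos hx]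
        linarith
      · rw [Set.indicator_of_mem (show x ∈ A₁ from ⟨hx, hx1⟩)]
        linarith
  have i4 : Integrable (fun x => 2 * A₁.indicator (fun x => |h x|) x +
      2 * A₂.indicator (fun x => |h x|) x) γ := (i1.const_mul 2).add (i2.const_mul 2)
  have hI := integral_mono hh.abs (i3.add i4) hpt
  simp only [Pi.add_apply] at hI
  rw [integral_add i3 i4,
    integral_add (i1.const_mul 2) (i2.const_mul 2), integral_const_mul, integral_const_mul] at hI
  have := le_abs_self (∫ x, h x * (φ₁ x - φ₂ x) ∂γ)
  linarith [hK _ ht hb, hνε A₁ hA₁m hK₁ε, hνε A₂ hA₂m hK₂ε]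

theorem integrable_mul_ofReal_of_bounded {h : EuclideanSpace ℝ (Fin n) → ℂ}
    (hh : Integrable h (gaussMeasure n)) {ψ : EuclideanSpace ℝ (Fin n) → ℝ} (hψ : Continuous ψ)
    {C : ℝ} (hC : ∀ x, |ψ x| ≤ C) :
    Integrable (fun x => h x * (ψ x : ℂ)) (gaussMeasure n) :=
  hh.mul_bdd (Complex.continuous_ofReal.comp hψ).aestronglyMeasurable
    (Filter.Eventually.of_forall fun x => by simpa using hC x)

/-- A real-linear functional on `ℂ` commutes with testing. -/
theorem integral_clm_mul {h : EuclideanSpace ℝ (Fin n) → ℂ} (hh : Integrable h (gaussMeasure n))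
    {ψ : EuclideanSpace ℝ (Fin n) → ℝ} (hψ : Continuous ψ) {C : ℝ} (hC : ∀ x, |ψ x| ≤ C)
    (π : ℂ →L[ℝ] ℝ) :
    ∫ x, π (h x) * ψ x ∂(gaussMeasure n) = π (∫ x, h x * (ψ x : ℂ) ∂(gaussMeasure n)) := by
  rw [← π.integral_comp_comm (integrable_mul_ofReal_of_bounded hh hψ hC)]
  refine integral_congr_ae (Filter.Eventually.of_forall fun x => ?_)
  simp only
  rw [mul_comm (h x), ← Complex.real_smul, map_smul, smul_eq_mul, mul_comm]

/-- The norm of `L¹(γ)` is, up to a factor two, the norm as a functional on test functions. -/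
theorem norm_le_of_forall_isTest (g : Lp ℂ 1 (gaussMeasure n)) {K : ℝ}
    (hK : ∀ φ, IsTest φ → (∀ x, |φ x| ≤ 1) →
      ‖∫ x, g x * (φ x : ℂ) ∂(gaussMeasure n)‖ ≤ K) : ‖g‖ ≤ 2 * K := by
  have hg : Integrable g (gaussMeasure n) := L1.integrable_coeFn g
  have key : ∀ π : ℂ →L[ℝ] ℝ, (∀ z, |π z| ≤ ‖z‖) →
      ∫ x, |π (g x)| ∂(gaussMeasure n) ≤ K := by
    intro π hπ
    refine integral_abs_le_of_forall_isTest
      (π.continuous.measurable.comp (Lp.stronglyMeasurable g).measurable)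
      (π.integrable_comp hg) fun φ hφ hφ1 => ?_
    simp only [Function.comp_apply]
    rw [integral_clm_mul hg hφ.continuous hφ1]
    exact (hπ _).trans (hK φ hφ hφ1)
  have h1 := key Complex.reCLM Complex.abs_re_le_norm
  have h2 := key Complex.imCLM Complex.abs_im_le_norm
  have i1 := (Complex.reCLM.integrable_comp hg).abs
  have i2 := (Complex.imCLM.integrable_comp hg).abs
  rw [L1.norm_eq_integral_norm]
  calc ∫ x, ‖g x‖ ∂(gaussMeasure n)
      ≤ ∫ x, (|Complex.reCLM (g x)| + |Complex.imCLM (g x)|) ∂(gaussMeasure n) :=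
        integral_mono hg.norm (i1.add i2) fun x => Complex.norm_le_abs_re_add_abs_im _
    _ ≤ 2 * K := by
        rw [integral_add i1 i2]
        linarith

/-- The inclusion of `L²(γ)` into `L¹(γ)`. -/
noncomputable def toL1 : Lp ℂ 2 (gaussMeasure n) →ₗ[ℂ] Lp ℂ 1 (gaussMeasure n) where
  toFun f := ((Lp.memLp f).mono_exponent one_le_two).toLp f
  map_add' f g := by
    rw [← MemLp.toLp_add]
    exact MemLp.toLp_congr _ _ (Lp.coeFn_add f g)
  map_smul' a f := by
    rw [RingHom.id_apply, ← MemLp.toLp_const_smul]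
    exact MemLp.toLp_congr _ _ (Lp.coeFn_smul a f)

theorem coeFn_toL1 (f : Lp ℂ 2 (gaussMeasure n)) : toL1 f =ᵐ[gaussMeasure n] f :=
  MemLp.coeFn_toLp ((Lp.memLp f).mono_exponent one_le_two)

/-- Hölder's inequality: the normalization of Gaussian atoms for the exponent `q` implies the one
for smaller exponents. -/
theorem eLpNorm_le_of_exponent_le {f : EuclideanSpace ℝ (Fin n) → ℂ} {p q : ℝ≥0∞} (hpq : p ≤ q)
    (hf : AEStronglyMeasurable f (gaussMeasure n)) {c : EuclideanSpace ℝ (Fin n)} {ρ t : ℝ}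
    (hρ : 0 < ρ) (hf0 : ∀ᵐ x ∂(gaussMeasure n), x ∉ Metric.ball c ρ → f x = 0)
    (h : eLpNorm f q (gaussMeasure n) ≤
      ENNReal.ofReal t * gaussMeasure n (Metric.ball c ρ) ^ ((1 / q).toReal - 1)) :
    eLpNorm f p (gaussMeasure n) ≤
      ENNReal.ofReal t * gaussMeasure n (Metric.ball c ρ) ^ ((1 / p).toReal - 1) := by
  set B := Metric.ball c ρ with hB
  have hBm : MeasurableSet B := measurableSet_ball
  have hbf : f =ᵐ[gaussMeasure n] B.indicator f := by
    filter_upwards [hf0] with x hx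
    by_cases hxB : x ∈ B
    · rw [Set.indicator_of_mem hxB]
    · rw [Set.indicator_of_notMem hxB, hx hxB]
  have hm : 0 < (gaussMeasure n).real B := gaussMeasure_real_ball_pos c hρ
  have hBr : gaussMeasure n B = ENNReal.ofReal ((gaussMeasure n).real B) :=
    (ofReal_measureReal (measure_ne_top _ _)).symm
  calc eLpNorm f p (gaussMeasure n) = eLpNorm f p ((gaussMeasure n).restrict B) := by
        rw [eLpNorm_congr_ae hbf, eLpNorm_indicator_eq_eLpNorm_restrict hBm]
    _ ≤ eLpNorm f q ((gaussMeasure n).restrict B) *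
        ((gaussMeasure n).restrict B) Set.univ ^ (1 / p.toReal - 1 / q.toReal) :=
      eLpNorm_le_eLpNorm_mul_rpow_measure_univ hpq hf.restrict
    _ ≤ eLpNorm f q (gaussMeasure n) * gaussMeasure n B ^ (1 / p.toReal - 1 / q.toReal) := by
      rw [Measure.restrict_apply_univ]
      gcongr
      exact Measure.restrict_le_self
    _ ≤ (ENNReal.ofReal t * gaussMeasure n B ^ ((1 / q).toReal - 1)) *
        gaussMeasure n B ^ (1 / p.toReal - 1 / q.toReal) := by gcongr
    _ = _ := by
      have e : (1 / q).toReal - 1 + (1 / p.toReal - 1 / q.toReal) = (1 / p).toReal - 1 := by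
        rw [ENNReal.toReal_div, ENNReal.toReal_div, ENNReal.toReal_one]
        ring
      rw [hBr, mul_assoc, ENNReal.ofReal_rpow_of_pos hm, ENNReal.ofReal_rpow_of_pos hm,
        ENNReal.ofReal_rpow_of_pos hm, ← ENNReal.ofReal_mul (by positivity), ← Real.rpow_add hm, e]

/-- The main estimate: on `L²` functions that are multiples of Gaussian `(1,r)`-atoms, the `L¹` norm
of `R*_α` is bounded by the multiple. For `r > 2` the exponent `2` is used instead of `r`. -/
theorem exists_norm_le_of_isNewRiesz (α : Fin n → ℕ) {r : ℝ≥0∞} (hr : 1 < r) :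
    ∃ A, 0 ≤ A ∧ ∀ (c : EuclideanSpace ℝ (Fin n)) (ρ t : ℝ) (f g : Lp ℂ 2 (gaussMeasure n)),
      0 < ρ → ρ ≤ admissibleRadius ‖c‖ → 0 < t →
      (∀ᵐ x ∂(gaussMeasure n), x ∉ Metric.ball c ρ → f x = 0) →
      ∫ x, f x ∂(gaussMeasure n) = 0 →
      eLpNorm f r (gaussMeasure n) ≤
        ENNReal.ofReal t * gaussMeasure n (Metric.ball c ρ) ^ ((1 / r).toReal - 1) →
      IsNewRiesz α f g → ‖toL1 g‖ ≤ A * t := by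
  set p : ℝ≥0∞ := min r 2 with hpdef
  have hp2 : p ≤ 2 := min_le_right _ _
  have hpr : p ≤ r := min_le_left _ _
  have hptop : p ≠ ⊤ := ne_top_of_le_ne_top (by norm_num) hp2
  have hp1 : 1 < p := lt_min hr (by norm_num)
  have hp0 : p ≠ 0 := (zero_lt_one.trans hp1).ne'
  have hpR : 1 < p.toReal := by
    rw [← ENNReal.toReal_one]
    exact (ENNReal.toReal_lt_toReal (by norm_num) hptop).2 hp1
  have hpR0 : 0 < p.toReal := by linarith
  obtain ⟨A, hA, hmain⟩ := exists_meanZeroBound_rieszDual α hpR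
  refine ⟨4 * A, by positivity, ?_⟩
  intro c ρ t f g hρ hρc ht hf0 hfi hfn hg
  set B := Metric.ball c ρ with hB
  have hBm : MeasurableSet B := measurableSet_ball
  set b : EuclideanSpace ℝ (Fin n) → ℂ := B.indicator f with hb
  have hbf : f =ᵐ[gaussMeasure n] b := by
    filter_upwards [hf0] with x hx
    by_cases hxB : x ∈ B
    · rw [hb, Set.indicator_of_mem hxB]
    · rw [hb, Set.indicator_of_notMem hxB, hx hxB]
  have hb2 : MemLp b 2 (gaussMeasure n) := (memLp_congr_ae hbf).1 (Lp.memLp f)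
  have hbp : MemLp b p (gaussMeasure n) := hb2.mono_exponent hp2
  have hb1 : Integrable b (gaussMeasure n) := hb2.integrable one_le_two
  have hm : 0 < (gaussMeasure n).real B := gaussMeasure_real_ball_pos c hρ
  have hBr : gaussMeasure n B = ENNReal.ofReal ((gaussMeasure n).real B) :=
    (ofReal_measureReal (measure_ne_top _ _)).symm
  set F := t / (gaussMeasure n).real B with hF
  have hF0 : 0 < F := by positivity
  -- Hölder's inequality lowers the exponent from `r` to `p`
  have hnorm : ∫ x, ‖b x‖ ^ p.toReal ∂(gaussMeasure n) ≤
      F ^ p.toReal * (gaussMeasure n).real B := by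
    have h1 : eLpNorm b p (gaussMeasure n) ≤
        ENNReal.ofReal (F * ((gaussMeasure n).real B) ^ (1 / p.toReal)) := by
      rw [← eLpNorm_congr_ae hbf]
      refine (eLpNorm_le_of_exponent_le hpr (Lp.aestronglyMeasurable f) hρ hf0 hfn).trans
        (le_of_eq ?_)
      rw [hBr, ENNReal.ofReal_rpow_of_pos hm, ← ENNReal.ofReal_mul ht.le, ENNReal.toReal_div,
        ENNReal.toReal_one, Real.rpow_sub hm, Real.rpow_one, hF]
      congr 1
      ring
    rw [hbp.eLpNorm_eq_integral_rpow_norm hp0 hptop,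
      ENNReal.ofReal_le_ofReal_iff (by positivity)] at h1
    have h2 : 0 ≤ ∫ x, ‖b x‖ ^ p.toReal ∂(gaussMeasure n) := integral_nonneg fun x => by positivity
    have h3 := Real.rpow_le_rpow (by positivity) h1 hpR0.le
    rwa [Real.rpow_inv_rpow h2 hpR0.ne', Real.mul_rpow hF0.le (by positivity),
      ← Real.rpow_mul hm.le, one_div_mul_cancel hpR0.ne', Real.rpow_one] at h3
  have key : ∀ π : ℂ →L[ℝ] ℝ, (∀ z, |π z| ≤ ‖z‖) →
      HasMeanBound (gaussMeasure n) p.toReal B F fun x => π (b x) := by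
    intro π hπ
    have hi : Integrable (fun x => |π (b x)| ^ p.toReal) (gaussMeasure n) := by
      refine (hbp.integrable_norm_rpow hp0 hptop).mono' ?_ (Filter.Eventually.of_forall fun x => ?_)
      · exact ((π.continuous.comp_aestronglyMeasurable hbp.1).aemeasurable.abs.pow_const
          _).aestronglyMeasurable
      · rw [Real.norm_of_nonneg (by positivity)]
        exact Real.rpow_le_rpow (abs_nonneg _) (hπ _) hpR0.le
    refine ⟨π.integrable_comp hb1, hi, fun x hx => ?_, le_trans ?_ hnorm⟩
    · rw [hb, Set.indicator_of_notMem hx, map_zero]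
    · exact integral_mono hi (hbp.integrable_norm_rpow hp0 hptop) fun x =>
        Real.rpow_le_rpow (abs_nonneg _) (hπ _) hpR0.le
  have hbi : ∫ x, b x ∂(gaussMeasure n) = 0 := (integral_congr_ae hbf).symm.trans hfi
  refine (norm_le_of_forall_isTest (K := 2 * (A * t)) _ fun φ hφ hφ1 => ?_).trans
    (le_of_eq (by ring))
  have e : ∫ x, toL1 g x * (φ x : ℂ) ∂(gaussMeasure n) =
      ∫ x, b x * (rieszDual α φ x : ℂ) ∂(gaussMeasure n) := by
    rw [integral_congr_ae ((coeFn_toL1 g).mono fun x hx => by rw [hx]), hg.integral_mul_eq hφ]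
    exact integral_congr_ae (hbf.mono fun x hx => by simp only [hx])
  obtain ⟨D, -, hD⟩ := exists_abs_rieszDual_le α hφ
  have hpart : ∀ π : ℂ →L[ℝ] ℝ, (∀ z, |π z| ≤ ‖z‖) →
      |π (∫ x, b x * (rieszDual α φ x : ℂ) ∂(gaussMeasure n))| ≤ A * t := by
    intro π hπ
    rw [← integral_clm_mul hb1 (continuous_rieszDual α hφ) hD]
    refine (hmain c ρ φ hρ hρc hφ hφ1 _ F hF0 (key π hπ) ?_).trans (le_of_eq ?_)
    · rw [π.integral_comp_comm hb1, hbi, map_zero]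
    · rw [mul_assoc, hF, div_mul_cancel₀ _ hm.ne']
  rw [e]
  refine (Complex.norm_le_abs_re_add_abs_im _).trans ?_
  have h1 := hpart Complex.reCLM Complex.abs_re_le_norm
  have h2 := hpart Complex.imCLM Complex.abs_im_le_norm
  simp only [Complex.reCLM_apply, Complex.imCLM_apply] at h1 h2
  linarith

end GaussianHardy

/-! ### Atoms -/

namespace GaussianHardy

variable {n : ℕ} {r : ℝ≥0∞} {c : EuclideanSpace ℝ (Fin n)} {ρ s t : ℝ}
  {f g : EuclideanSpace ℝ (Fin n) → ℂ}

/-- `f` is `t` times a Gaussian `(1,r)`-atom supported in the admissible ball `B(c,ρ)`. -/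
structure IsBallAtom (r : ℝ≥0∞) (c : EuclideanSpace ℝ (Fin n)) (ρ t : ℝ)
    (f : EuclideanSpace ℝ (Fin n) → ℂ) : Prop where
  radius_pos : 0 < ρ
  radius_le : ρ ≤ admissibleRadius ‖c‖
  memLp : MemLp f r (gaussMeasure n)
  eq_zero : ∀ᵐ x ∂(gaussMeasure n), x ∉ Metric.ball c ρ → f x = 0
  integral_eq_zero : ∫ x, f x ∂(gaussMeasure n) = 0
  norm_le : eLpNorm f r (gaussMeasure n) ≤
    ENNReal.ofReal t * gaussMeasure n (Metric.ball c ρ) ^ ((1 / r).toReal - 1)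

namespace IsBallAtom

theorem congr_ae (h : IsBallAtom r c ρ t f) (hfg : f =ᵐ[gaussMeasure n] g) :
    IsBallAtom r c ρ t g where
  radius_pos := h.radius_pos
  radius_le := h.radius_le
  memLp := (memLp_congr_ae hfg).1 h.memLp
  eq_zero := by
    filter_upwards [h.eq_zero, hfg] with x hx hx' hxB
    rw [← hx', hx hxB]
  integral_eq_zero := by rw [← integral_congr_ae hfg, h.integral_eq_zero]
  norm_le := by
    rw [← eLpNorm_congr_ae hfg]
    exact h.norm_le

theorem zero (hρ : 0 < ρ) (hρc : ρ ≤ admissibleRadius ‖c‖) :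
    IsBallAtom r c ρ t (0 : EuclideanSpace ℝ (Fin n) → ℂ) where
  radius_pos := hρ
  radius_le := hρc
  memLp := MemLp.zero
  eq_zero := Filter.Eventually.of_forall fun _ _ => rfl
  integral_eq_zero := by simp
  norm_le := by simp

theorem sub (hr : 1 ≤ r) (hs : 0 ≤ s) (ht : 0 ≤ t) (hf : IsBallAtom r c ρ s f)
    (hg : IsBallAtom r c ρ t g) : IsBallAtom r c ρ (s + t) (f - g) where
  radius_pos := hf.radius_pos
  radius_le := hf.radius_le
  memLp := hf.memLp.sub hg.memLp
  eq_zero := by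
    filter_upwards [hf.eq_zero, hg.eq_zero] with x h1 h2 hx
    rw [Pi.sub_apply, h1 hx, h2 hx, sub_zero]
  integral_eq_zero := by
    rw [integral_sub' (hf.memLp.integrable hr) (hg.memLp.integrable hr), hf.integral_eq_zero,
      hg.integral_eq_zero, sub_zero]
  norm_le := by
    refine (eLpNorm_sub_le hf.memLp.1 hg.memLp.1 hr).trans ?_
    rw [ENNReal.ofReal_add hs ht, add_mul]
    exact add_le_add hf.norm_le hg.norm_le

theorem isAtom (h : IsBallAtom r c ρ 1 f) : IsAtom r f :=
  Or.inr ⟨c, ρ, h.radius_pos, h.radius_le, h.memLp, h.eq_zero, h.integral_eq_zero, by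
    simpa using h.norm_le⟩

theorem smul (h : IsBallAtom r c ρ t f) (ht : 0 < t) :
    IsBallAtom r c ρ 1 ((t⁻¹ : ℂ) • f) where
  radius_pos := h.radius_pos
  radius_le := h.radius_le
  memLp := h.memLp.const_smul _
  eq_zero := by
    filter_upwards [h.eq_zero] with x hx hxB
    rw [Pi.smul_apply, hx hxB, smul_zero]
  integral_eq_zero := by
    simp only [Pi.smul_apply]
    rw [integral_smul, h.integral_eq_zero, smul_zero]
  norm_le := by
    refine (eLpNorm_const_smul_le).trans ((mul_le_mul_right h.norm_le _).trans (le_of_eq ?_))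
    have e : ‖(t⁻¹ : ℂ)‖ₑ = ENNReal.ofReal t⁻¹ := by
      rw [← ofReal_norm, ← Complex.ofReal_inv, Complex.norm_real,
        Real.norm_of_nonneg (by positivity)]
    rw [e, ← mul_assoc, ← ENNReal.ofReal_mul (by positivity), inv_mul_cancel₀ ht.ne']

theorem norm_toLp_one_le {f : Lp ℂ 1 (gaussMeasure n)} (hr : 1 ≤ r) (ht : 0 ≤ t)
    (h : IsBallAtom r c ρ t f) : ‖f‖ ≤ t := by
  have h1 := eLpNorm_le_of_exponent_le hr (Lp.aestronglyMeasurable f) h.radius_pos h.eq_zero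
    h.norm_le
  rw [Lp.norm_def]
  refine ENNReal.toReal_le_of_le_ofReal ht (h1.trans (le_of_eq ?_))
  simp

/-- Bounded functions are dense among the multiples of atoms on a fixed ball. -/
theorem exists_approx (hr : 1 < r) (h : IsBallAtom r c ρ t f) {ε : ℝ} (hε : 0 < ε) :
    ∃ b : Lp ℂ 2 (gaussMeasure n), IsBallAtom r c ρ ε (f - b) := by
  set B := Metric.ball c ρ with hB
  have hBm : MeasurableSet B := measurableSet_ball
  rcases eq_or_ne r ⊤ with rfl | hrt
  · have h2 : MemLp f 2 (gaussMeasure n) := h.memLp.mono_exponent le_top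
    refine ⟨h2.toLp f, (zero h.radius_pos h.radius_le).congr_ae ?_⟩
    filter_upwards [h2.coeFn_toLp] with x hx
    rw [Pi.sub_apply, hx, sub_self, Pi.zero_apply]
  · have hm : 0 < (gaussMeasure n).real B := gaussMeasure_real_ball_pos c h.radius_pos
    have hm0 : gaussMeasure n B ≠ 0 := fun h0 => by simp [Measure.real, h0] at hm
    have hmt : gaussMeasure n B ≠ ⊤ := measure_ne_top _ _
    set η : ℝ≥0∞ := ENNReal.ofReal ε * gaussMeasure n B ^ ((1 / r).toReal - 1) with hη
    have hη0 : η ≠ 0 := mul_ne_zero (by simpa using hε)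
      (ENNReal.rpow_pos (pos_iff_ne_zero.2 hm0) hmt).ne'
    have hinv : (1 + (gaussMeasure n B)⁻¹) ≠ ⊤ := by simp [hm0]
    have hinv0 : (1 + (gaussMeasure n B)⁻¹) ≠ 0 := by simp
    set δ : ℝ≥0∞ := η * (1 + (gaussMeasure n B)⁻¹)⁻¹ with hδ
    have hδ0 : δ ≠ 0 := mul_ne_zero hη0 (ENNReal.inv_ne_zero.2 hinv)
    obtain ⟨S, hS, hSr⟩ := h.memLp.exists_simpleFunc_eLpNorm_sub_lt hrt hδ0
    have hS2 : MemLp S 2 (gaussMeasure n) := SimpleFunc.memLp_of_isFiniteMeasure S 2 _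
    set u : EuclideanSpace ℝ (Fin n) → ℂ := B.indicator S with hu
    have hur : MemLp u r (gaussMeasure n) := hSr.indicator hBm
    have hu2 : MemLp u 2 (gaussMeasure n) := hS2.indicator hBm
    have hu1 : Integrable u (gaussMeasure n) := hu2.integrable one_le_two
    have hf1 : Integrable f (gaussMeasure n) := h.memLp.integrable hr.le
    have hfu : f - u =ᵐ[gaussMeasure n] B.indicator (f - S) := by
      filter_upwards [h.eq_zero] with x hx
      by_cases hxB : x ∈ B
      · rw [Set.indicator_of_mem hxB, Pi.sub_apply, hu, Set.indicator_of_mem hxB, Pi.sub_apply]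
      · rw [Set.indicator_of_notMem hxB, Pi.sub_apply, hu, Set.indicator_of_notMem hxB, hx hxB,
          sub_zero]
    have hfuδ : eLpNorm (f - u) r (gaussMeasure n) ≤ δ := by
      rw [eLpNorm_congr_ae hfu]
      exact (eLpNorm_indicator_le _).trans hS.le
    -- subtract the mean value of `u`, which is small because `f` has mean zero
    set m : ℂ := (((gaussMeasure n).real B)⁻¹ : ℝ) • ∫ x, u x ∂(gaussMeasure n) with hmdef
    set v : EuclideanSpace ℝ (Fin n) → ℂ := B.indicator fun _ => m with hv
    have hvp : ∀ p, MemLp v p (gaussMeasure n) := fun p =>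
      memLp_indicator_const p hBm m (Or.inr hmt)
    have hvi : ∫ x, v x ∂(gaussMeasure n) = ∫ x, u x ∂(gaussMeasure n) := by
      rw [hv, integral_indicator_const _ hBm, hmdef, smul_smul, mul_inv_cancel₀ hm.ne', one_smul]
    have hmδ : ‖m‖ₑ ≤ (gaussMeasure n B)⁻¹ * δ := by
      have e : ∫ x, u x ∂(gaussMeasure n) = - ∫ x, (f - u) x ∂(gaussMeasure n) := by
        rw [integral_sub' hf1 hu1, h.integral_eq_zero, zero_sub, neg_neg]
      rw [hmdef, enorm_smul, e, enorm_neg]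
      have e2 : ‖((gaussMeasure n).real B)⁻¹‖ₑ = (gaussMeasure n B)⁻¹ := by
        rw [Real.enorm_of_nonneg (by positivity), ENNReal.ofReal_inv_of_pos hm,
          ofReal_measureReal hmt]
      rw [e2]
      gcongr
      refine (enorm_integral_le_lintegral_enorm _).trans ?_
      rw [← eLpNorm_one_eq_lintegral_enorm]
      exact (eLpNorm_le_eLpNorm_of_exponent_le hr.le (hf1.1.sub hu1.1)).trans hfuδ
    have hvδ : eLpNorm v r (gaussMeasure n) ≤ (gaussMeasure n B)⁻¹ * δ := by
      refine (eLpNorm_indicator_const_le _ _).trans (le_trans ?_ hmδ)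
      refine mul_le_of_le_one_right' (ENNReal.rpow_le_one prob_le_one (by positivity))
    have hb2 : MemLp (u - v) 2 (gaussMeasure n) := hu2.sub (hvp 2)
    refine ⟨hb2.toLp _, IsBallAtom.congr_ae (f := (f - u) + v) ?_ ?_⟩
    · refine ⟨h.radius_pos, h.radius_le, (h.memLp.sub hur).add (hvp r), ?_, ?_, ?_⟩
      · filter_upwards [hfu] with x hx hxB
        rw [Pi.add_apply, hx, hv, Set.indicator_of_notMem hxB, Set.indicator_of_notMem hxB,
          add_zero]
      · rw [integral_add' (hf1.sub hu1) ((hvp 1).integrable le_rfl), hvi, integral_sub' hf1 hu1,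
          h.integral_eq_zero]
        ring
      · refine (eLpNorm_add_le (hf1.1.sub hu1.1) (hvp r).1 hr.le).trans
          ((add_le_add hfuδ hvδ).trans (le_of_eq ?_))
        rw [← one_add_mul, hδ, mul_left_comm, ENNReal.mul_inv_cancel hinv0 hinv, mul_one]
    · filter_upwards [hb2.coeFn_toLp] with x hx
      rw [Pi.sub_apply, hx]
      simp only [Pi.add_apply, Pi.sub_apply]
      ring

end IsBallAtom

theorem IsAtom.const_or_isBallAtom (h : IsAtom r f) :
    (∀ᵐ x ∂(gaussMeasure n), f x = 1) ∨ ∃ c ρ, IsBallAtom r c ρ 1 f := by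
  rcases h with h | ⟨c, ρ, h1, h2, h3, h4, h5, h6⟩
  · exact Or.inl h
  · exact Or.inr ⟨c, ρ, h1, h2, h3, h4, h5, by simpa using h6⟩

theorem coeFn_sub_toL1 (a : Lp ℂ 1 (gaussMeasure n)) (b : Lp ℂ 2 (gaussMeasure n)) :
    (a : EuclideanSpace ℝ (Fin n) → ℂ) - (b : EuclideanSpace ℝ (Fin n) → ℂ) =ᵐ[gaussMeasure n]
      ((a - toL1 b : Lp ℂ 1 (gaussMeasure n)) : EuclideanSpace ℝ (Fin n) → ℂ) := by
  filter_upwards [Lp.coeFn_sub a (toL1 b), coeFn_toL1 b] with x h1 h2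
  rw [h1, Pi.sub_apply, Pi.sub_apply, h2]

theorem memLp_const_atom {f : EuclideanSpace ℝ (Fin n) → ℂ}
    (h : ∀ᵐ x ∂(gaussMeasure n), f x = 1) (p : ℝ≥0∞) : MemLp f p (gaussMeasure n) :=
  (memLp_congr_ae h).2 (memLp_const 1)

theorem toL1_toLp (a : Lp ℂ 1 (gaussMeasure n)) (h : MemLp a 2 (gaussMeasure n)) :
    toL1 (h.toLp a) = a :=
  Lp.ext ((coeFn_toL1 _).trans h.coeFn_toLp)

/-- Up to a small multiple of an atom, every atom belongs to `L²(γ)`. -/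
theorem IsAtom.exists_approx (hr : 1 < r) {a : Lp ℂ 1 (gaussMeasure n)} (h : IsAtom r a) {ε : ℝ}
    (hε : 0 < ε) : ∃ (b : Lp ℂ 2 (gaussMeasure n)) (a' : Lp ℂ 1 (gaussMeasure n)),
      IsAtom r a' ∧ a - toL1 b = (ε : ℂ) • a' := by
  obtain ⟨b, c, ρ, hb⟩ : ∃ (b : Lp ℂ 2 (gaussMeasure n)) (c : EuclideanSpace ℝ (Fin n)) (ρ : ℝ),
      IsBallAtom r c ρ ε (a - toL1 b : Lp ℂ 1 (gaussMeasure n)) := by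
    rcases h.const_or_isBallAtom with h1 | ⟨c, ρ, hc⟩
    · refine ⟨(memLp_const_atom h1 2).toLp a, 0, 1, ?_⟩
      rw [toL1_toLp, sub_self]
      exact (IsBallAtom.zero one_pos (by simp [admissibleRadius])).congr_ae
        (Lp.coeFn_zero ℂ 1 _).symm
    · obtain ⟨b, hb⟩ := hc.exists_approx hr hε
      exact ⟨b, c, ρ, hb.congr_ae (coeFn_sub_toL1 a b)⟩
  refine ⟨b, (ε⁻¹ : ℂ) • (a - toL1 b),
    ((hb.smul hε).congr_ae (Lp.coeFn_smul _ _).symm).isAtom, ?_⟩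
  rw [smul_smul, mul_inv_cancel₀ (by exact_mod_cast hε.ne'), one_smul]

end GaussianHardy

/-! ### The extension to the Hardy space -/

namespace GaussianHardy

variable {n : ℕ} {r : ℝ≥0∞}

/-- The bounded linear functional `f ↦ ∫ f ψ dγ` on `L¹(γ)`, for a bounded continuous function
`ψ`. -/
noncomputable def pairing {ψ : EuclideanSpace ℝ (Fin n) → ℝ} (hψ : Continuous ψ) {C : ℝ}
    (hC : ∀ x, |ψ x| ≤ C) : Lp ℂ 1 (gaussMeasure n) →L[ℂ] ℂ :=
  LinearMap.mkContinuous
    { toFun := fun f => ∫ x, f x * (ψ x : ℂ) ∂(gaussMeasure n)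
      map_add' := fun f g => by
        rw [← integral_add
          (integrable_mul_ofReal_of_bounded (L1.integrable_coeFn f) hψ hC)
          (integrable_mul_ofReal_of_bounded (L1.integrable_coeFn g) hψ hC)]
        refine integral_congr_ae ?_
        filter_upwards [Lp.coeFn_add f g] with x hx
        rw [hx, Pi.add_apply, add_mul]
      map_smul' := fun a f => by
        rw [RingHom.id_apply, smul_eq_mul, ← integral_const_mul]
        refine integral_congr_ae ?_
        filter_upwards [Lp.coeFn_smul a f] with x hx
        rw [hx, Pi.smul_apply, smul_eq_mul, mul_assoc] }
    C fun f => by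
      rw [L1.norm_eq_integral_norm, ← integral_const_mul]
      refine norm_integral_le_of_norm_le ((L1.integrable_coeFn f).norm.const_mul C)
        (Filter.Eventually.of_forall fun x => ?_)
      rw [norm_mul, Complex.norm_real, mul_comm, Real.norm_eq_abs]
      exact mul_le_mul_of_nonneg_right (hC x) (norm_nonneg _)

theorem pairing_apply {ψ : EuclideanSpace ℝ (Fin n) → ℝ} (hψ : Continuous ψ) {C : ℝ}
    (hC : ∀ x, |ψ x| ≤ C) (f : Lp ℂ 1 (gaussMeasure n)) :
    pairing hψ hC f = ∫ x, f x * (ψ x : ℂ) ∂(gaussMeasure n) := rfl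

/-- The pairs `(f, g)` in `L¹(γ) × L¹(γ)` with `g = R*_α f` in the sense of duality:
`∫ g φ dγ = ∫ f Ψ_φ dγ` for all test functions `φ`. -/
def rieszGraph (α : Fin n → ℕ) :
    Submodule ℂ (Lp ℂ 1 (gaussMeasure n) × Lp ℂ 1 (gaussMeasure n)) where
  carrier := {q | ∀ φ, IsTest φ → ∫ x, q.2 x * (φ x : ℂ) ∂(gaussMeasure n) =
    ∫ x, q.1 x * (rieszDual α φ x : ℂ) ∂(gaussMeasure n)}
  zero_mem' φ hφ := by
    obtain ⟨C, -, hC⟩ := hφ.exists_bound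
    obtain ⟨D, -, hD⟩ := exists_abs_rieszDual_le α hφ
    rw [← pairing_apply hφ.continuous hC, ← pairing_apply (continuous_rieszDual α hφ) hD]
    simp
  add_mem' {q q'} h h' φ hφ := by
    have e := h φ hφ
    have e' := h' φ hφ
    obtain ⟨C, -, hC⟩ := hφ.exists_bound
    obtain ⟨D, -, hD⟩ := exists_abs_rieszDual_le α hφ
    rw [← pairing_apply hφ.continuous hC, ← pairing_apply (continuous_rieszDual α hφ) hD]
      at e e' ⊢
    rw [Prod.snd_add, Prod.fst_add, map_add, map_add, e, e']
  smul_mem' a q h φ hφ := by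
    have e := h φ hφ
    obtain ⟨C, -, hC⟩ := hφ.exists_bound
    obtain ⟨D, -, hD⟩ := exists_abs_rieszDual_le α hφ
    rw [← pairing_apply hφ.continuous hC, ← pairing_apply (continuous_rieszDual α hφ) hD] at e ⊢
    rw [Prod.smul_snd, Prod.smul_fst, map_smul, map_smul, e]

variable {α : Fin n → ℕ}

theorem mem_rieszGraph {f g : Lp ℂ 1 (gaussMeasure n)} :
    (f, g) ∈ rieszGraph α ↔ ∀ φ, IsTest φ → ∫ x, g x * (φ x : ℂ) ∂(gaussMeasure n) =
      ∫ x, f x * (rieszDual α φ x : ℂ) ∂(gaussMeasure n) := Iff.rfl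

theorem isClosed_rieszGraph : IsClosed (rieszGraph α : Set (Lp ℂ 1 (gaussMeasure n) ×
    Lp ℂ 1 (gaussMeasure n))) := by
  have e : (rieszGraph α : Set (Lp ℂ 1 (gaussMeasure n) × Lp ℂ 1 (gaussMeasure n))) =
      ⋂ (φ) (_ : IsTest φ), {q | ∫ x, q.2 x * (φ x : ℂ) ∂(gaussMeasure n) =
        ∫ x, q.1 x * (rieszDual α φ x : ℂ) ∂(gaussMeasure n)} := by
    ext q
    simp only [Set.mem_iInter]
    rfl
  rw [e]
  refine isClosed_iInter fun φ => isClosed_iInter fun hφ => ?_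
  obtain ⟨C, -, hC⟩ := hφ.exists_bound
  obtain ⟨D, -, hD⟩ := exists_abs_rieszDual_le α hφ
  exact isClosed_eq ((pairing hφ.continuous hC).continuous.comp continuous_snd)
    ((pairing (continuous_rieszDual α hφ) hD).continuous.comp continuous_fst)

theorem eq_zero_of_mem_rieszGraph {g : Lp ℂ 1 (gaussMeasure n)} (h : (0, g) ∈ rieszGraph α) :
    g = 0 := by
  rw [← norm_le_zero_iff, ← mul_zero 2]
  refine norm_le_of_forall_isTest g fun φ hφ _ => le_of_eq ?_
  obtain ⟨D, -, hD⟩ := exists_abs_rieszDual_le α hφ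
  rw [mem_rieszGraph.1 h φ hφ, ← pairing_apply (continuous_rieszDual α hφ) hD, map_zero, norm_zero]

theorem eq_of_mem_rieszGraph {f g g' : Lp ℂ 1 (gaussMeasure n)} (h : (f, g) ∈ rieszGraph α)
    (h' : (f, g') ∈ rieszGraph α) : g = g' := by
  have := (rieszGraph α).sub_mem h h'
  rw [Prod.mk_sub_mk, sub_self] at this
  exact sub_eq_zero.1 (eq_zero_of_mem_rieszGraph this)

theorem IsNewRiesz.toL1_mem_rieszGraph {f g : Lp ℂ 2 (gaussMeasure n)} (h : IsNewRiesz α f g) :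
    (toL1 f, toL1 g) ∈ rieszGraph α := by
  intro φ hφ
  rw [integral_congr_ae ((coeFn_toL1 g).mono fun x hx => by rw [hx]), h.integral_mul_eq hφ]
  exact integral_congr_ae ((coeFn_toL1 f).mono fun x hx => by simp only [hx])

theorem exists_norm_le_of_isBallAtom (α : Fin n → ℕ) (hr : 1 < r) :
    ∃ A, 0 ≤ A ∧ ∀ (c : EuclideanSpace ℝ (Fin n)) (ρ t : ℝ) (b : Lp ℂ 2 (gaussMeasure n)),
      0 < t → IsBallAtom r c ρ t b →
      ∃ g, (toL1 b, g) ∈ rieszGraph α ∧ ‖g‖ ≤ A * t := by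
  obtain ⟨A, hA, h⟩ := exists_norm_le_of_isNewRiesz α hr
  refine ⟨A, hA, fun c ρ t b ht hb => ?_⟩
  obtain ⟨g, hg, -⟩ := exists_isNewRiesz α b
  exact ⟨toL1 g, hg.toL1_mem_rieszGraph, h c ρ t b g hb.radius_pos hb.radius_le ht hb.eq_zero
    hb.integral_eq_zero hb.norm_le hg⟩

/-- Atoms belong to the domain of the extended operator, which is bounded on them. An atom with
`r < 2` need not be in `L²(γ)`; it is the limit of a rapidly converging sequence of multiples of
atoms in `L²(γ)`. -/
theorem exists_rieszGraph_of_isAtom (α : Fin n → ℕ) (hr : 1 < r) :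
    ∃ C, 0 < C ∧ ∀ a : Lp ℂ 1 (gaussMeasure n), IsAtom r a →
      ∃ g, (a, g) ∈ rieszGraph α ∧ ‖g‖ ≤ C := by
  obtain ⟨A, hA, hball⟩ := exists_norm_le_of_isBallAtom (n := n) α hr
  have hone := memLp_const (μ := gaussMeasure n) (p := 2) (1 : ℂ)
  obtain ⟨g₁, hg₁, -⟩ := exists_isNewRiesz α (hone.toLp _)
  refine ⟨‖toL1 g₁‖ + A * 2 + 1, by positivity, fun a ha => ?_⟩
  rcases ha.const_or_isBallAtom with h1 | ⟨c, ρ, hc⟩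
  · have e : toL1 (hone.toLp _) = a := by
      refine Lp.ext ((coeFn_toL1 _).trans (hone.coeFn_toLp.trans ?_))
      filter_upwards [h1] with x hx using hx.symm
    refine ⟨toL1 g₁, e ▸ hg₁.toL1_mem_rieszGraph, ?_⟩
    have : 0 ≤ A * 2 := by positivity
    linarith
  · have hq : ∀ k : ℕ, (0 : ℝ) < (1 / 2) ^ k := fun k => by positivity
    choose b hb using fun k => hc.exists_approx hr (hq k)
    have hab : ∀ k, ‖a - toL1 (b k)‖ ≤ (1 / 2) ^ k := fun k =>
      IsBallAtom.norm_toLp_one_le hr.le (hq k).le ((hb k).congr_ae (coeFn_sub_toL1 a (b k)))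
    have hbk : ∀ k, IsBallAtom r c ρ 2 (b k) := by
      intro k
      have h1 := (hc.sub hr.le zero_le_one (hq k).le (hb k)).congr_ae (g := b k)
        (Filter.Eventually.of_forall fun x => by simp)
      refine ⟨h1.radius_pos, h1.radius_le, h1.memLp, h1.eq_zero, h1.integral_eq_zero,
        h1.norm_le.trans ?_⟩
      gcongr
      have := pow_le_one₀ (n := k) (show (0 : ℝ) ≤ 1 / 2 by norm_num) (by norm_num)
      linarith
    have hdiff : ∀ k, IsBallAtom r c ρ ((1 / 2) ^ k + (1 / 2) ^ (k + 1))
        (b (k + 1) - b k : Lp ℂ 2 (gaussMeasure n)) := by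
      intro k
      refine ((hb k).sub hr.le (hq k).le (hq (k + 1)).le (hb (k + 1))).congr_ae ?_
      filter_upwards [Lp.coeFn_sub (b (k + 1)) (b k)] with x hx
      rw [hx]
      simp
    choose G hG hGn using fun k => hball c ρ 2 (b k) two_pos (hbk k)
    have hGd : ∀ k, dist (G k) (G (k + 1)) ≤ (2 * A) * (1 / 2) ^ k := by
      intro k
      obtain ⟨g, hg, hgn⟩ := hball c ρ _ _ (add_pos (hq k) (hq (k + 1))) (hdiff k)
      have h2 := (rieszGraph α).sub_mem (hG (k + 1)) (hG k)
      rw [Prod.mk_sub_mk, ← map_sub] at h2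
      rw [dist_comm, dist_eq_norm, eq_of_mem_rieszGraph h2 hg]
      refine hgn.trans ?_
      have h3 : ((1 / 2 : ℝ)) ^ (k + 1) ≤ (1 / 2) ^ k :=
        pow_le_pow_of_le_one (by norm_num) (by norm_num) (Nat.le_succ k)
      nlinarith
    obtain ⟨g, hg⟩ := cauchySeq_tendsto_of_complete
      (cauchySeq_of_le_geometric (1 / 2) (2 * A) (by norm_num) hGd)
    have hba : Filter.Tendsto (fun k => toL1 (b k)) Filter.atTop (nhds a) := by
      rw [tendsto_iff_norm_sub_tendsto_zero]
      refine squeeze_zero (fun _ => norm_nonneg _) (fun k => ?_)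
        (tendsto_pow_atTop_nhds_zero_of_lt_one (by norm_num : (0 : ℝ) ≤ 1 / 2) (by norm_num))
      rw [norm_sub_rev]
      exact hab k
    refine ⟨g, isClosed_rieszGraph.mem_of_tendsto (hba.prodMk_nhds hg)
      (Filter.Eventually.of_forall hG), ?_⟩
    have h4 : ‖g‖ ≤ A * 2 := le_of_tendsto hg.norm (Filter.Eventually.of_forall hGn)
    linarith [norm_nonneg (toL1 g₁)]

theorem exists_rieszGraph_of_decomposition {C : ℝ}
    (hC : ∀ a : Lp ℂ 1 (gaussMeasure n), IsAtom r a → ∃ g, (a, g) ∈ rieszGraph α ∧ ‖g‖ ≤ C)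
    {f : Lp ℂ 1 (gaussMeasure n)} {l : ℕ → ℂ} {a : ℕ → Lp ℂ 1 (gaussMeasure n)}
    (h : IsAtomicDecomposition r f l a) :
    ∃ g, (f, g) ∈ rieszGraph α ∧ ‖g‖ ≤ C * ∑' j, ‖l j‖ := by
  obtain ⟨ha, hl, hf⟩ := h
  choose g hg hgC using fun j => hC (a j) (ha j)
  have hle : ∀ j, ‖l j • g j‖ ≤ C * ‖l j‖ := fun j => by
    rw [norm_smul, mul_comm]
    exact mul_le_mul_of_nonneg_right (hgC j) (norm_nonneg _)
  have hs : Summable fun j => ‖l j • g j‖ :=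
    Summable.of_nonneg_of_le (fun _ => norm_nonneg _) hle (hl.mul_left C)
  refine ⟨∑' j, l j • g j, ?_, ?_⟩
  · refine isClosed_rieszGraph.mem_of_tendsto (hf.prodMk hs.of_norm.hasSum)
      (Filter.Eventually.of_forall fun t => ?_)
    exact (rieszGraph α).sum_mem fun j _ => (rieszGraph α).smul_mem (l j) (hg j)
  · exact (norm_tsum_le_tsum_norm hs).trans ((hs.tsum_le_tsum hle (hl.mul_left C)).trans_eq
      tsum_mul_left)

theorem hardyNorm_le {f : hardySpace n r} {l : ℕ → ℂ} {a : ℕ → Lp ℂ 1 (gaussMeasure n)}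
    (h : IsAtomicDecomposition r (f : Lp ℂ 1 (gaussMeasure n)) l a) :
    hardyNorm f ≤ ∑' j, ‖l j‖ := by
  refine csInf_le ⟨0, ?_⟩ ⟨l, a, h, rfl⟩
  rintro _ ⟨l, a, -, rfl⟩
  exact tsum_nonneg fun _ => norm_nonneg _

theorem hardyNorm_nonneg (f : hardySpace n r) : 0 ≤ hardyNorm f := by
  refine Real.sInf_nonneg ?_
  rintro _ ⟨l, a, -, rfl⟩
  exact tsum_nonneg fun _ => norm_nonneg _

/-- The existence of the bounded extension. -/
theorem exists_extension (α : Fin n → ℕ) (hr : 1 < r) :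
    ∃ T : hardySpace n r →ₗ[ℂ] Lp ℂ 1 (gaussMeasure n),
      (∃ C : ℝ, ∀ f : hardySpace n r, ‖T f‖ ≤ C * hardyNorm f) ∧
      ∀ f : hardySpace n r, ((f : Lp ℂ 1 (gaussMeasure n)), T f) ∈ rieszGraph α := by
  obtain ⟨C, hC0, hC⟩ := exists_rieszGraph_of_isAtom (n := n) α hr
  have hex : ∀ f : hardySpace n r, ∃ g, ((f : Lp ℂ 1 (gaussMeasure n)), g) ∈ rieszGraph α := by
    rintro ⟨f, l, a, h⟩
    obtain ⟨g, hg, -⟩ := exists_rieszGraph_of_decomposition hC h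
    exact ⟨g, hg⟩
  choose T hT using hex
  refine ⟨⟨⟨T, fun f g => ?_⟩, fun c f => ?_⟩, ⟨C, fun f => ?_⟩, hT⟩
  · exact eq_of_mem_rieszGraph (hT (f + g)) ((rieszGraph α).add_mem (hT f) (hT g))
  · exact eq_of_mem_rieszGraph (hT (c • f)) ((rieszGraph α).smul_mem c (hT f))
  · show ‖T f‖ ≤ C * hardyNorm f
    rw [← div_le_iff₀' hC0]
    refine le_csInf ?_ ?_
    · obtain ⟨l, a, h⟩ := f.2
      exact ⟨_, l, a, h, rfl⟩
    · rintro _ ⟨l, a, h, rfl⟩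
      obtain ⟨g, hg, hgn⟩ := exists_rieszGraph_of_decomposition hC h
      rw [div_le_iff₀' hC0, eq_of_mem_rieszGraph (hT f) hg]
      exact hgn

/-- `L²(γ) ∩ 𝓗^{1,r}(γ)` is dense in `𝓗^{1,r}(γ)`: finitely many atoms of a decomposition are
replaced by elements of `L²(γ)`, and the error is again written as a sum of atoms. -/
theorem exists_hardyNorm_sub_lt (hr : 1 < r) (f : hardySpace n r) {ε : ℝ} (hε : 0 < ε) :
    ∃ f' : hardySpace n r, hardyNorm (f - f') < ε ∧
      ∃ f₂ : Lp ℂ 2 (gaussMeasure n), toL1 f₂ = (f' : Lp ℂ 1 (gaussMeasure n)) := by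
  obtain ⟨l, a, ha, hl, hf⟩ := f.2
  set S := ∑' j, ‖l j‖ with hS
  have hS0 : 0 ≤ S := tsum_nonneg fun _ => norm_nonneg _
  set δ := ε / (2 * (S + 1)) with hδ
  have hδ0 : 0 < δ := by positivity
  choose b a' ha' hba using fun j => (ha j).exists_approx hr hδ0
  obtain ⟨N, hN⟩ := ((tendsto_sum_nat_add fun j => ‖l j‖).eventually_lt_const
    (show (0 : ℝ) < ε / 2 by positivity)).exists
  set m : ℕ → ℂ := fun j => if j < N then l j * δ else l j with hm
  set d : ℕ → Lp ℂ 1 (gaussMeasure n) := fun j => if j < N then a' j else a j with hd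
  set s₂ : Lp ℂ 2 (gaussMeasure n) := ∑ j ∈ Finset.range N, l j • b j with hs₂
  have hmS : HasSum (fun j => ‖m j‖) (∑ j ∈ Finset.range N, ‖l j‖ * δ + ∑' j, ‖l (j + N)‖) := by
    rw [← hasSum_nat_add_iff' N]
    have e : ∑ j ∈ Finset.range N, ‖l j‖ * δ + ∑' j, ‖l (j + N)‖ - ∑ j ∈ Finset.range N, ‖m j‖ =
        ∑' j, ‖l (j + N)‖ := by
      have : ∑ j ∈ Finset.range N, ‖m j‖ = ∑ j ∈ Finset.range N, ‖l j‖ * δ := by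
        refine Finset.sum_congr rfl fun j hj => ?_
        simp only [hm, if_pos (Finset.mem_range.1 hj)]
        rw [norm_mul, Complex.norm_real, Real.norm_of_nonneg hδ0.le]
      rw [this]
      ring
    rw [e]
    have e2 : (fun j => ‖m (j + N)‖) = fun j => ‖l (j + N)‖ := by
      funext j
      simp only [hm, if_neg (show ¬ j + N < N by omega)]
    rw [e2]
    exact ((summable_nat_add_iff N).2 hl).hasSum
  have toL1_s₂ : toL1 s₂ = ∑ j ∈ Finset.range N, l j • toL1 (b j) := by
    simp only [hs₂, map_sum, map_smul]
  have hdec : IsAtomicDecomposition r (f - toL1 s₂ : Lp ℂ 1 (gaussMeasure n)) m d := by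
    refine ⟨fun j => ?_, hmS.summable, ?_⟩
    · simp only [hd]
      split_ifs
      exacts [ha' j, ha j]
    · have h1 : HasSum (fun j => if j < N then l j • toL1 (b j) else 0) (toL1 s₂) := by
        rw [toL1_s₂]
        have := hasSum_sum_of_ne_finset_zero (L := SummationFilter.unconditional ℕ)
          (s := Finset.range N) (f := fun j => if j < N then l j • toL1 (b j) else 0)
          fun j hj => if_neg (by simpa using hj)
        rwa [Finset.sum_congr rfl fun j hj => if_pos (Finset.mem_range.1 hj)] at this
      refine (hf.sub h1).congr_fun fun j => ?_
      simp only [hm, hd]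
      split_ifs
      · rw [← smul_sub, hba, smul_smul]
      · rw [sub_zero]
  have hmem : toL1 s₂ ∈ hardySpace n r := by
    have := (hardySpace n r).sub_mem f.2 (show _ ∈ hardySpace n r from ⟨m, d, hdec⟩)
    rwa [sub_sub_cancel] at this
  refine ⟨⟨toL1 s₂, hmem⟩, ?_, s₂, rfl⟩
  refine (hardyNorm_le (f := f - ⟨toL1 s₂, hmem⟩) hdec).trans_lt ?_
  rw [hmS.tsum_eq, ← Finset.sum_mul]
  have h1 : ∑ j ∈ Finset.range N, ‖l j‖ ≤ S := hl.sum_le_tsum _ fun _ _ => norm_nonneg _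
  have h2 : (∑ j ∈ Finset.range N, ‖l j‖) * δ ≤ ε / 2 := by
    calc _ ≤ (S + 1) * δ := by
          gcongr
          linarith
      _ = ε / 2 := by
          rw [hδ]
          field_simp
  linarith

end GaussianHardy

theorem theorem2 (n : ℕ) (α : Fin n → ℕ) :
    -- `R*_α` is a well-defined operator on `L²(γ)`
    (∀ f : Lp ℂ 2 (GaussianHardy.gaussMeasure n),
      ∃! g : Lp ℂ 2 (GaussianHardy.gaussMeasure n), GaussianHardy.IsNewRiesz α f g) ∧
    -- and it has exactly one extension to a bounded operator from `𝓗^{1,r}(γ)` to `L¹(γ)`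
    ∀ r : ℝ≥0∞, 1 < r →
      ∃! T : GaussianHardy.hardySpace n r →ₗ[ℂ] Lp ℂ 1 (GaussianHardy.gaussMeasure n),
        (∃ C : ℝ, ∀ f : GaussianHardy.hardySpace n r, ‖T f‖ ≤ C * GaussianHardy.hardyNorm f) ∧
        ∀ (f : GaussianHardy.hardySpace n r) (f₂ g : Lp ℂ 2 (GaussianHardy.gaussMeasure n)),
          (∀ᵐ x ∂(GaussianHardy.gaussMeasure n),
            (f : Lp ℂ 1 (GaussianHardy.gaussMeasure n)) x = f₂ x) →
          GaussianHardy.IsNewRiesz α f₂ g →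
          ∀ᵐ x ∂(GaussianHardy.gaussMeasure n), T f x = g x := by
  refine ⟨fun f => ?_, fun r hr => ?_⟩
  · obtain ⟨g, hg, -⟩ := GaussianHardy.exists_isNewRiesz α f
    exact ⟨g, hg, fun g' hg' => hg'.unique hg⟩
  · obtain ⟨T, ⟨C, hC⟩, hT⟩ := GaussianHardy.exists_extension α hr
    refine ⟨T, ⟨⟨C, hC⟩, fun f f₂ g hf hg => ?_⟩, ?_⟩
    · have e : GaussianHardy.toL1 f₂ = f := by
        refine Lp.ext ((GaussianHardy.coeFn_toL1 f₂).trans ?_)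
        filter_upwards [hf] with x hx using hx.symm
      have h := hg.toL1_mem_rieszGraph
      rw [e] at h
      rw [GaussianHardy.eq_of_mem_rieszGraph (hT f) h]
      exact GaussianHardy.coeFn_toL1 g
    · rintro T' ⟨⟨C', hC'⟩, hT'⟩
      -- both extensions agree on the dense subspace `L²(γ) ∩ 𝓗^{1,r}(γ)`
      have hagree : ∀ f : GaussianHardy.hardySpace n r,
          (∃ f₂, GaussianHardy.toL1 f₂ = (f : Lp ℂ 1 (GaussianHardy.gaussMeasure n))) →
          T' f = T f := by
        rintro f ⟨f₂, e⟩
        obtain ⟨g, hg, -⟩ := GaussianHardy.exists_isNewRiesz α f₂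
        have h := hg.toL1_mem_rieszGraph
        rw [e] at h
        rw [GaussianHardy.eq_of_mem_rieszGraph (hT f) h]
        have h2 : ∀ᵐ x ∂(GaussianHardy.gaussMeasure n),
            (f : Lp ℂ 1 (GaussianHardy.gaussMeasure n)) x = f₂ x := by
          rw [← e]
          exact GaussianHardy.coeFn_toL1 f₂
        refine Lp.ext (Filter.EventuallyEq.trans (hT' f f₂ g h2 hg) ?_)
        exact (GaussianHardy.coeFn_toL1 g).symm
      ext1 f
      rw [← sub_eq_zero, ← norm_le_zero_iff]
      refine le_of_forall_pos_le_add fun ε hε => ?_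
      set D := |C| + |C'| + 1 with hD
      have hD0 : 0 < D := by positivity
      obtain ⟨f', hf', hf₂⟩ := GaussianHardy.exists_hardyNorm_sub_lt hr f
        (show 0 < ε / D by positivity)
      have e : T' f - T f = T' (f - f') - T (f - f') := by
        rw [map_sub, map_sub, hagree f' hf₂]
        abel
      have h0 := GaussianHardy.hardyNorm_nonneg (f - f')
      rw [e, zero_add]
      calc _ ≤ ‖T' (f - f')‖ + ‖T (f - f')‖ := norm_sub_le _ _
        _ ≤ C' * GaussianHardy.hardyNorm (f - f') + C * GaussianHardy.hardyNorm (f - f') :=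
          add_le_add (hC' _) (hC _)
        _ ≤ D * GaussianHardy.hardyNorm (f - f') := by
          rw [← add_mul]
          gcongr
          linarith [le_abs_self C, le_abs_self C']
        _ ≤ D * (ε / D) := by gcongr
        _ = ε := mul_div_cancel₀ _ hD0.ne'
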